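/- **Setting.** Fix $d,K\ge 0$, sample sizes $n,n'\ge 1$, put $N=n+n'$, and fix $B_x,B_y,B_u,B_w,B_v,\lambda>0$ and a $C^4$ function $r:\mathbb R\to\mathbb R$. Vector norms are Euclidean. An *input* $(\mathcal D_S,\mathcal D_T,x_*)$ consists of $\mathcal D_S=\{(x^S_i,y^S_i)\}_{i\le n}$, $\mathcal D_T=\{x^T_i\}_{i\le n'}$ and $x_*$, where all points lie in $\mathbb R^d$ and have norm at most $B_x$, and the labels are real with $|y^S_i|\le B_y$. For $u=(u_1,\dots,u_K)\in\mathbb R^{Kd}$ and $w,v\in\mathbb R^K$ let $$\Lambda(x;u,w)=\sum_k w_k\,r(u_k^\top x),\qquad \Delta(x;u,v)=\sum_k v_k\,r(u_k^\top x),$$ $$\mathcal L(u,w)=\sum_{(x,y)\in\mathcal D_S}\gamma(\Lambda(x;u,w),y),\qquad \Omega(u,v)=\frac1n\sum_{(x,y)\in\mathcal D_S}\gamma(\Delta(x;u,v),0)+\frac1{n'}\sum_{x\in\mathcal D_T}\gamma(\Delta(x;u,v),1),$$ where $\gamma(z,q)=-q\log\sigma(z)-(1-q)\log(1-\sigma(z))$,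 $\sigma(z)=1/(1+e^{-z})$, is the sigmoid cross entropy. Write $\vartheta=(u,w,v)$ and $\|\vartheta\|_{\max}=\max\{\|u\|,\|w\|,\|v\|\}$. Let $\mathcal W=\{\vartheta:\max_k\|u_k\|\le B_u,\ \|w\|\le B_w,\ \|v\|\le B_v\}$, let $\Pi_{\mathcal W}$ be the Euclidean projection onto $\mathcal W$, and for $\eta>0$ let $$G_\eta(\vartheta)=\bigl(u-\eta\nabla_u(\mathcal L-\lambda\Omega),\ w-\eta\nabla_w\mathcal L,\ v-\eta\lambda\nabla_v\Omega\bigr).$$ For $\vartheta^{(0)}\in\mathcal W$ let $\vartheta^{(l)}=\Pi_{\mathcal W}(G_\eta(\vartheta^{(l-1)}))$, $1\le l\le L$, and $\hat f^{\mathrm{DANN}}(x)=\Lambda(x;u^{(L)},w^{(L)})$. **Transformers.** A layer with $M$ heads and hidden width $D'$ maps a $D\times(N+1)$ matrix $X$ first to $X+\frac1{N+1}\sum_{m=1}^M V_mX\,\mathrm{ReLU}((Q_mX)^\top K_mX)$ and then $X$ to $X+W_2\,\mathrm{ReLU}(W_1X)$, with $Q_m,K_m,V_m\in\mathbb R^{D\times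 D}$, $W_1\in\mathbb R^{D'\times D}$, $W_2\in\mathbb R^{D\times D'}$. The norm $\|\theta\|_{\mathrm{TF}}$ is the maximum over the layers of $\max_m\max\{\|Q_m\|,\|K_m\|\}+\sum_m\|V_m\|+\|W_1\|+\|W_2\|$ (operator norms; a maximum over no heads is $0$). For an input and $\vartheta\in\mathcal W$, let $H(\vartheta)$ be the matrix with the columns $[z_i,u,w,v,0_F]$, $z_i=[x_i,y_i,t_i,s_i,1]$, $i\le N+1$, where $x_1,\dots,x_{N+1}$ are the source points, the target points and $x_*$; $y_i=y_i^S$ for $i\le n$ and $0$ otherwise; $t_i=1$ for $i\le n$ and $0$ otherwise; $s_i=1$ for $i\le N$ and $s_{N+1}=0$. So $D=d+4+Kd+2K+F$. The *query output* $\mathrm{TF}^*_\theta(H)$ is the entry of $\mathrm{TF}_\theta(H)$ in the row of $y$ and the column of $x_*$. **Projection blocks.** A projection block $\hat\Pi$ of width $D_{\mathrm{MLP}}$, norm $C_{\mathrm{MLP}}=\|P_1\|+\|P_2\|$, accuracy $\delta$ and range $R$ is a map $\hat\Pi(\vartheta)=\vartheta+P_2\,\mathrm{ReLU}(P_1[\vartheta;1])$,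 with $P_1$ having $D_{\mathrm{MLP}}$ rows, such that $\hat\Pi(\vartheta)\in\mathcal W$ and $\|\hat\Pi(\vartheta)-\Pi_{\mathcal W}(\vartheta)\|_{\max}\le\delta$ whenever $\|\vartheta\|_{\max}\le R$. If $\Pi_{\mathcal W}$ itself has this form, $\hat\Pi=\Pi_{\mathcal W}$ is allowed. **Statement.** There are $F\in\mathbb N$ and $A\in\mathbb R$, depending only on the data fixed in the setting, such that for all integers $L\ge1$ and all $\eta>0$ there are $C\in\mathbb R$, $q\in\mathbb N$, $c\in(0,1]$, $R>0$ with the following property. For every $\varepsilon>0$ there exists a projection block of accuracy $c\varepsilon$ and range $R$; and for every such block $\hat\Pi$, of width $D_{\mathrm{MLP}}$ and norm $C_{\mathrm{MLP}}$, there exists a transformer $\mathrm{TF}_\theta$ with $2L+1$ layers ($2L$ update layers and one readout layer) whose layers satisfy, with $b_\varepsilon=C(1+\varepsilon^{-2})(1+\log(1+\varepsilon^{-1}))^q$ (that is, $b_\varepsilon=\tilde O(\varepsilon^{-2})$), $$M^{(l)}\le b_\varepsilon,\qquad D'^{(l)}\le b_\varepsilon+D_{\mathrm{MLP}},\qquad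 \|\theta\|_{\mathrm{TF}}\le A(1+\eta)+C_{\mathrm{MLP}},$$ such that for every input: 1. For each $l\in\{1,\dots,L\}$ and each $\vartheta\in\mathcal W$, layers $2l-1$ and $2l$ together map $H(\vartheta)$ to $H(\vartheta')$ with $\vartheta'=\hat\Pi(G_\eta(\vartheta)+e)\in\mathcal W$ for some $e$ with $\|e\|_{\max}\le\varepsilon$, and $\|\vartheta'-\Pi_{\mathcal W}(G_\eta(\vartheta)+e)\|_{\max}\le\varepsilon$. 2. For every tuple of initial values $\vartheta^{(0)}\in\mathcal W$, the first $2L$ layers map $H(\vartheta^{(0)})$ to $H(\tilde\vartheta^{(L)})$ for some $\tilde\vartheta^{(L)}\in\mathcal W$; every column of the output $\mathrm{TF}_\theta(H(\vartheta^{(0)}))$ carries $\tilde\vartheta^{(L)}$ in its parameter rows; and $$\bigl|\mathrm{TF}^*_\theta(H(\vartheta^{(0)}))-\hat f^{\mathrm{DANN}}(x_*)\bigr|\le L\varepsilon .$$ -/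

import Mathlib

open scoped Matrix

noncomputable section

namespace DANN

/-! ### Transformers with ReLU attention -/

/-- The rectified linear unit. -/
def relu (t : ℝ) : ℝ := max t 0

/-- The spectral (Euclidean operator) norm of a rectangular matrix. -/
def opNorm {m n : Type} [Fintype m] [Fintype n] [DecidableEq n]
    (A : Matrix m n ℝ) : ℝ :=
  ‖LinearMap.toContinuousLinearMap (Matrix.toLpLin 2 2 A)‖

/-- The parameters of one transformer layer with token coordinates indexed by `ι`:
`heads` attention heads and a feed-forward block with `hidden` hidden units. -/
structure TFLayer (ι : Type) where
  heads : ℕ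
  Q : Fin heads → Matrix ι ι ℝ
  K : Fin heads → Matrix ι ι ℝ
  V : Fin heads → Matrix ι ι ℝ
  hidden : ℕ
  W₁ : Matrix (Fin hidden) ι ℝ
  W₂ : Matrix ι (Fin hidden) ℝ

section Transformer

variable {ι κ : Type} [Fintype ι] [DecidableEq ι] [Fintype κ]

/-- The self-attention block; the tokens are the columns of `X`, indexed by `κ`. -/
def TFLayer.attn (l : TFLayer ι) (X : Matrix ι κ ℝ) : Matrix ι κ ℝ :=
  X + (1 / (Fintype.card κ : ℝ)) •
    ∑ m, l.V m * X * (((l.Q m * X)ᵀ * (l.K m * X)).map relu)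

/-- The feed-forward block. -/
def TFLayer.mlp (l : TFLayer ι) (X : Matrix ι κ ℝ) : Matrix ι κ ℝ :=
  X + l.W₂ * (l.W₁ * X).map relu

/-- One transformer layer. -/
def TFLayer.apply (l : TFLayer ι) (X : Matrix ι κ ℝ) : Matrix ι κ ℝ :=
  l.mlp (l.attn X)

/-- The contribution of one layer to the norm of a transformer. -/
def TFLayer.norm (l : TFLayer ι) : ℝ :=
  (⨆ m, max (opNorm (l.Q m)) (opNorm (l.K m))) + ∑ m, opNorm (l.V m)
    + opNorm l.W₁ + opNorm l.W₂

/-- The map computed by the transformer with layers `T 0, …, T (m - 1)`,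
where `T 0` is applied first. -/
def runTF {m : ℕ} (T : Fin m → TFLayer ι) (X : Matrix ι κ ℝ) : Matrix ι κ ℝ :=
  Fin.foldl m (fun Y l => (T l).apply Y) X

/-- The norm of a transformer: the maximum over the layers. -/
def tfNorm {m : ℕ} (T : Fin m → TFLayer ι) : ℝ := ⨆ l, (T l).norm

end Transformer

/-! ### Data, networks and the DANN iteration -/

/-- An input: labelled source data, unlabelled target data and a query point. -/
structure Input (d n n' : ℕ) where
  xS : Fin n → EuclideanSpace ℝ (Fin d)
  yS : Fin n → ℝ
  xT : Fin n' → EuclideanSpace ℝ (Fin d)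
  xq : EuclideanSpace ℝ (Fin d)

/-- All points have norm at most `Bx` and all labels have absolute value at most `By`. -/
def Input.Bounded {d n n' : ℕ} (D : Input d n n') (Bx By : ℝ) : Prop :=
  (∀ i, ‖D.xS i‖ ≤ Bx) ∧ (∀ i, |D.yS i| ≤ By) ∧ (∀ i, ‖D.xT i‖ ≤ Bx) ∧ ‖D.xq‖ ≤ Bx

/-- The space of parameter tuples `(u, w, v)`, where `u = vec U` has the rows `u_1, …, u_K`.
Its norm is the maximum of the three Euclidean norms. -/
abbrev Params (d K : ℕ) : Type :=
  EuclideanSpace ℝ (Fin K × Fin d) × EuclideanSpace ℝ (Fin K) × EuclideanSpace ℝ (Fin K)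

/-- The row `u_k` of `u`. -/
def rowVec {d K : ℕ} (u : EuclideanSpace ℝ (Fin K × Fin d)) (k : Fin K) :
    EuclideanSpace ℝ (Fin d) :=
  WithLp.toLp 2 fun i => u (k, i)

/-- The two-layer network `x ↦ ∑ k, a_k r(u_kᵀ x)`: the label network for `a = w`,
the domain network for `a = v`. -/
def net {d K : ℕ} (r : ℝ → ℝ) (u : EuclideanSpace ℝ (Fin K × Fin d))
    (a : EuclideanSpace ℝ (Fin K)) (x : EuclideanSpace ℝ (Fin d)) : ℝ :=
  ∑ k, a k * r (∑ i, rowVec u k i * x i)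

/-- The cross entropy of a probability `p` and a label `q`. -/
def crossEntropy (p q : ℝ) : ℝ := -q * Real.log p - (1 - q) * Real.log (1 - p)

/-- The sigmoid cross entropy: the cross entropy at the probability with logit `z`. -/
def sigmoidCrossEntropy (z q : ℝ) : ℝ := crossEntropy (Real.sigmoid z) q

section Losses

variable {d K n n' : ℕ} (r : ℝ → ℝ) (D : Input d n n')

/-- The label classification loss. -/
def labelLoss (u : EuclideanSpace ℝ (Fin K × Fin d)) (w : EuclideanSpace ℝ (Fin K)) : ℝ :=
  ∑ i, sigmoidCrossEntropy (net r u w (D.xS i)) (D.yS i)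

/-- The domain classification loss. -/
def domainLoss (u : EuclideanSpace ℝ (Fin K × Fin d)) (v : EuclideanSpace ℝ (Fin K)) : ℝ :=
  (1 / (n : ℝ)) * ∑ i, sigmoidCrossEntropy (net r u v (D.xS i)) 0
    + (1 / (n' : ℝ)) * ∑ i, sigmoidCrossEntropy (net r u v (D.xT i)) 1

/-- The simultaneous gradient step in `(u, w, v)`, before projection. -/
def gradStep (lam η : ℝ) (θ : Params d K) : Params d K :=
  (θ.1 - η • gradient (fun u => labelLoss r D u θ.2.1 - lam * domainLoss r D u θ.2.2) θ.1,
   θ.2.1 - η • gradient (fun w => labelLoss r D θ.1 w) θ.2.1,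
   θ.2.2 - (η * lam) • gradient (fun v => domainLoss r D θ.1 v) θ.2.2)

end Losses

/-- The projection onto the closed centred Euclidean ball of radius `B`. -/
def projBall {ι : Type} [Fintype ι] (B : ℝ) (x : EuclideanSpace ℝ ι) : EuclideanSpace ℝ ι :=
  if ‖x‖ ≤ B then x else (B / ‖x‖) • x

lemma norm_projBall_le {ι : Type} [Fintype ι] {B : ℝ} (hB : 0 ≤ B)
    (x : EuclideanSpace ℝ ι) : ‖projBall B x‖ ≤ B := by
  unfold projBall
  split_ifs with h
  · exact h
  · have hx : 0 < ‖x‖ := lt_of_le_of_lt hB (not_le.mp h)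
    rw [norm_smul, Real.norm_of_nonneg (div_nonneg hB hx.le), div_mul_cancel₀ _ hx.ne']

/-- `projBall B x` is a point of the ball nearest to `x`. -/
lemma norm_sub_projBall_le {ι : Type} [Fintype ι] {B : ℝ} (hB : 0 ≤ B)
    (x y : EuclideanSpace ℝ ι) (hy : ‖y‖ ≤ B) : ‖x - projBall B x‖ ≤ ‖x - y‖ := by
  unfold projBall
  split_ifs with h
  · simp
  · have hlt : B < ‖x‖ := not_le.mp h
    have hx : 0 < ‖x‖ := lt_of_le_of_lt hB hlt
    have h1 : x - (B / ‖x‖) • x = (1 - B / ‖x‖) • x := by rw [sub_smul, one_smul]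
    have h2 : 0 ≤ 1 - B / ‖x‖ := by
      rw [sub_nonneg, div_le_one hx]; exact hlt.le
    rw [h1, norm_smul, Real.norm_of_nonneg h2, sub_mul, one_mul, div_mul_cancel₀ _ hx.ne']
    have := norm_sub_norm_le x y
    linarith

section ParameterSet

variable {d K : ℕ} (Bu Bw Bv : ℝ)

/-- The closed set of admissible parameters. -/
def paramSet : Set (Params d K) :=
  {θ | (∀ k, ‖rowVec θ.1 k‖ ≤ Bu) ∧ ‖θ.2.1‖ ≤ Bw ∧ ‖θ.2.2‖ ≤ Bv}

/-- The Euclidean projection onto `paramSet`, which is a product of Euclidean balls. -/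
def projW (θ : Params d K) : Params d K :=
  (WithLp.toLp 2 fun p => projBall Bu (rowVec θ.1 p.1) p.2,
   projBall Bw θ.2.1, projBall Bv θ.2.2)

/-- The parameters after `l` projected updates that start from `θ₀`. -/
def dannIter {n n' : ℕ} (r : ℝ → ℝ) (D : Input d n n') (lam η : ℝ) (θ₀ : Params d K)
    (l : ℕ) : Params d K :=
  (fun θ => projW Bu Bw Bv (gradStep r D lam η θ))^[l] θ₀

/-- The classifier obtained by `L` projected updates that start from `θ₀`. -/
def dannClassifier {n n' : ℕ} (r : ℝ → ℝ) (D : Input d n n') (lam η : ℝ) (θ₀ : Params d K)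
    (L : ℕ) (x : EuclideanSpace ℝ (Fin d)) : ℝ :=
  net r (dannIter Bu Bw Bv r D lam η θ₀ L).1 (dannIter Bu Bw Bv r D lam η θ₀ L).2.1 x

end ParameterSet

/-! ### Tokens -/

/-- Coordinates of a parameter tuple, in the order `u`, `w`, `v`. -/
abbrev ParamIdx (d K : ℕ) : Type := (Fin K × Fin d) ⊕ (Fin K ⊕ Fin K)

/-- Token coordinates: `x`, then `y, t, s, 1`, then the parameters, then `F` spare ones. -/
abbrev Row (d K F : ℕ) : Type := (Fin d ⊕ Fin 4) ⊕ (ParamIdx d K ⊕ Fin F)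

/-- Token positions: the source points, the target points and the query. -/
abbrev Col (n n' : ℕ) : Type := Fin n ⊕ (Fin n' ⊕ Unit)

/-- The coordinate vector of a parameter tuple. -/
def toCoords {d K : ℕ} (θ : Params d K) : ParamIdx d K → ℝ :=
  Sum.elim (fun p => θ.1 p) (Sum.elim (fun k => θ.2.1 k) (fun k => θ.2.2 k))

/-- The parameter tuple with a given coordinate vector. -/
def ofCoords {d K : ℕ} (c : ParamIdx d K → ℝ) : Params d K :=
  (WithLp.toLp 2 fun p => c (Sum.inl p), WithLp.toLp 2 fun k => c (Sum.inr (Sum.inl k)),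
   WithLp.toLp 2 fun k => c (Sum.inr (Sum.inr k)))

/-- The part `z_i = [x_i, y_i, t_i, s_i, 1]` of the token at a given position. -/
def zPart {d n n' : ℕ} (D : Input d n n') : Col n n' → Fin d ⊕ Fin 4 → ℝ
  | Sum.inl i => Sum.elim (fun a => D.xS i a) ![D.yS i, 1, 1, 1]
  | Sum.inr (Sum.inl i) => Sum.elim (fun a => D.xT i a) ![0, 0, 1, 1]
  | Sum.inr (Sum.inr _) => Sum.elim (fun a => D.xq a) ![0, 0, 0, 1]

/-- The matrix with the columns `[z_i, u, w, v, 0]`. -/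
def tokens {d K n n' : ℕ} (F : ℕ) (D : Input d n n') (θ : Params d K) :
    Matrix (Row d K F) (Col n n') ℝ :=
  fun a i => Sum.elim (zPart D i) (Sum.elim (toCoords θ) (fun _ => 0)) a

/-- The index of the label coordinate `y` of a token. -/
def yRow {d K F : ℕ} : Row d K F := Sum.inl (Sum.inr 0)

/-- The index of a parameter coordinate of a token. -/
def paramRow {d K F : ℕ} (p : ParamIdx d K) : Row d K F := Sum.inr (Sum.inl p)

/-- The position of the query token. -/
def queryCol {n n' : ℕ} : Col n n' := Sum.inr (Sum.inr ())

/-! ### Projection by a feed-forward block -/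

/-- A feed-forward ReLU block with skip connection acting on the parameter coordinates;
it also reads the constant coordinate `1` of the token. -/
structure ParamBlock (d K : ℕ) where
  width : ℕ
  P₁ : Matrix (Fin width) (ParamIdx d K ⊕ Unit) ℝ
  P₂ : Matrix (ParamIdx d K) (Fin width) ℝ

/-- The map on parameter tuples that the block computes. -/
def ParamBlock.map {d K : ℕ} (P : ParamBlock d K) (θ : Params d K) : Params d K :=
  ofCoords (toCoords θ
    + P.P₂ *ᵥ fun h => relu ((P.P₁ *ᵥ Sum.elim (toCoords θ) (fun _ => 1)) h))

/-- The norm of the block. -/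
def ParamBlock.norm {d K : ℕ} (P : ParamBlock d K) : ℝ := opNorm P.P₁ + opNorm P.P₂

/-- On the tuples of norm at most `R`, the block takes values in the parameter set and
differs from the projection onto it by at most `δ`. -/
def ParamBlock.Projects {d K : ℕ} (P : ParamBlock d K) (Bu Bw Bv δ R : ℝ) : Prop :=
  ∀ θ : Params d K, ‖θ‖ ≤ R →
    P.map θ ∈ paramSet Bu Bw Bv ∧ ‖P.map θ - projW Bu Bw Bv θ‖ ≤ δ

end DANN

end

/-! Every coordinate of the gradient is a sum over data points of (label residual · coefficient +
domain residual · coefficient) · activation (`toCoords_gradStep`). Such a sum fits two ReLU layers.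
Since all tokens carry the same parameters, a head of the first layer evaluates ReLU(u_kᵀx_j + b),
multiplied by w_k, v_k or 1, at each token j; averaging over the tokens then changes nothing.
Combining such heads yields the logits, r(u_kᵀx) and r'(u_kᵀx) (`evalLayer_attn`). The feed-forward
block turns the logits into residuals and obtains r'(u_kᵀx)·x_a by polarization
(`neuron_res_apply`). In the second layer a head is activation times ReLU of a form pairing
coefficients with residuals; two heads of opposite sign remove the ReLU, and the average over tokens
becomes the gradient sum (`secondLayer_attn`). Its feed-forward block applies the projection block
and clears the scratch coordinates (`secondLayer_mlp`).

The sigmoids must act only on source or only on target tokens. A shift by -B, with B larger than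
every logit plus every bias, switches all units off, so the masking is exact (`maskEval_neg_one`).

Quantitatively, Taylor's formula with integral remainder writes a C² function on an interval as a
superposition of ReLUs. Discretizing it with about N units gives error O(1/N) with total weight
bounded independently of N (`exists_reluSum_approx`). So N of order 1/ε is enough, within the
allowed ε⁻² even with logarithmic exponent 0. The layer norms depend only on total weights and
biases: value matrices contribute the sum of the weights, and a hidden weight c is split as √|c|
between the two matrices. Hence A is independent of ε, L and η.

Projection blocks exist because ReLU networks are dense (`reluApproximable_of_continuous`);
approximating a slightly shrunk projection forces the values into the parameter set. Finally the
exact update is Lipschitz on that set, uniformly in the data, so errors of size cε per update are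
amplified by at most a constant depending on L and η, which c absorbs
(`norm_iterate_sub_iterate_le`). -/

noncomputable section

namespace DANN

set_option linter.unusedSectionVars false

/-! ### Operator norms -/

section OpNorm

variable {m n l : Type} [Fintype m] [Fintype n] [Fintype l]
  [DecidableEq m] [DecidableEq n] [DecidableEq l]

lemma opNorm_nonneg (A : Matrix m n ℝ) : 0 ≤ opNorm A := norm_nonneg _

lemma opNorm_le {A : Matrix m n ℝ} {c : ℝ} (hc : 0 ≤ c)
    (h : ∀ x : n → ℝ, ‖WithLp.toLp 2 (A *ᵥ x)‖ ≤ c * ‖WithLp.toLp 2 x‖) : opNorm A ≤ c :=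
  ContinuousLinearMap.opNorm_le_bound _ hc fun x => h x.ofLp

lemma norm_mulVec_le (A : Matrix m n ℝ) (x : n → ℝ) :
    ‖WithLp.toLp 2 (A *ᵥ x)‖ ≤ opNorm A * ‖WithLp.toLp 2 x‖ :=
  (LinearMap.toContinuousLinearMap (Matrix.toLpLin 2 2 A)).le_opNorm (WithLp.toLp 2 x)

lemma opNorm_add_le (A B : Matrix m n ℝ) : opNorm (A + B) ≤ opNorm A + opNorm B := by
  unfold opNorm
  rw [map_add, map_add]
  exact norm_add_le _ _

lemma opNorm_zero : opNorm (0 : Matrix m n ℝ) = 0 := by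
  unfold opNorm
  rw [map_zero, map_zero, norm_zero]

lemma opNorm_sum_le {T : Type} (s : Finset T) (A : T → Matrix m n ℝ) :
    opNorm (∑ t ∈ s, A t) ≤ ∑ t ∈ s, opNorm (A t) := by
  classical
  induction s using Finset.induction_on with
  | empty => simp [opNorm_zero]
  | insert a s ha ih =>
    rw [Finset.sum_insert ha, Finset.sum_insert ha]
    exact (opNorm_add_le _ _).trans (by gcongr)

lemma opNorm_mul_le (A : Matrix m n ℝ) (B : Matrix n l ℝ) :
    opNorm (A * B) ≤ opNorm A * opNorm B := by
  refine opNorm_le (mul_nonneg (opNorm_nonneg _) (opNorm_nonneg _)) fun x => ?_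
  rw [← Matrix.mulVec_mulVec, mul_assoc]
  exact (norm_mulVec_le _ _).trans
    (mul_le_mul_of_nonneg_left (norm_mulVec_le _ _) (opNorm_nonneg _))

lemma opNorm_transpose (A : Matrix m n ℝ) : opNorm Aᵀ = opNorm A := by
  open scoped Matrix.Norms.L2Operator in
  exact Matrix.l2_opNorm_conjTranspose A

lemma opNorm_one_le : opNorm (1 : Matrix n n ℝ) ≤ 1 :=
  opNorm_le zero_le_one fun x => by simp

/-- The Frobenius bound, by Cauchy–Schwarz in each row. -/
lemma opNorm_le_sqrt (A : Matrix m n ℝ) : opNorm A ≤ √(∑ i, ∑ j, A i j ^ 2) := by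
  refine opNorm_le (Real.sqrt_nonneg _) fun x => ?_
  rw [EuclideanSpace.norm_eq, EuclideanSpace.norm_eq,
    ← Real.sqrt_mul' _ (Finset.sum_nonneg fun _ _ => sq_nonneg _)]
  refine Real.sqrt_le_sqrt ?_
  rw [Finset.sum_mul]
  refine Finset.sum_le_sum fun i _ => ?_
  simp only [Real.norm_eq_abs, sq_abs]
  exact Finset.sum_mul_sq_le_sq_mul_sq _ _ _

lemma opNorm_single_le (i : m) (j : n) (c : ℝ) : opNorm (Matrix.single i j c) ≤ |c| := by
  refine (opNorm_le_sqrt _).trans (Real.sqrt_le_iff.mpr ⟨abs_nonneg c, ?_⟩)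
  rw [Finset.sum_eq_single i, Finset.sum_eq_single j]
  · simp
  · intro b _ hb; simp [Matrix.single, hb.symm]
  · simp
  · intro b _ hb; simp [Matrix.single, hb.symm]
  · simp

/-- The squared norms of the two images add up, and √(a² + b²) ≤ a + b. Stacking hidden units next
to the projection block therefore lets its norm enter with factor one. -/
lemma opNorm_fromRows_le (A : Matrix m n ℝ) (B : Matrix l n ℝ) :
    opNorm (Matrix.fromRows A B) ≤ opNorm A + opNorm B := by
  refine opNorm_le (add_nonneg (opNorm_nonneg _) (opNorm_nonneg _)) fun x => ?_
  have h1 := norm_mulVec_le A x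
  have h2 := norm_mulVec_le B x
  have h : ‖WithLp.toLp 2 (Matrix.fromRows A B *ᵥ x)‖
      ≤ ‖WithLp.toLp 2 (A *ᵥ x)‖ + ‖WithLp.toLp 2 (B *ᵥ x)‖ := by
    refine abs_le_of_sq_le_sq' ?_ (by positivity) |>.2
    have e : ‖WithLp.toLp 2 (Matrix.fromRows A B *ᵥ x)‖ ^ 2
        = ‖WithLp.toLp 2 (A *ᵥ x)‖ ^ 2 + ‖WithLp.toLp 2 (B *ᵥ x)‖ ^ 2 := by
      simp [EuclideanSpace.norm_sq_eq, Fintype.sum_sum_type, Matrix.fromRows_mulVec]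
    rw [e]
    nlinarith [norm_nonneg (WithLp.toLp 2 (A *ᵥ x)), norm_nonneg (WithLp.toLp 2 (B *ᵥ x))]
  linarith

lemma opNorm_fromCols_le (A : Matrix n m ℝ) (B : Matrix n l ℝ) :
    opNorm (Matrix.fromCols A B) ≤ opNorm A + opNorm B := by
  rw [← opNorm_transpose, Matrix.transpose_fromCols, ← opNorm_transpose A, ← opNorm_transpose B]
  exact opNorm_fromRows_le _ _

/-- The matrix that reads the coordinates `f p`. -/
def selMatrix (f : m → n) : Matrix m n ℝ := fun i j => if f i = j then 1 else 0

lemma selMatrix_mulVec (f : m → n) (x : n → ℝ) : selMatrix f *ᵥ x = x ∘ f := by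
  ext i; simp [selMatrix, Matrix.mulVec, dotProduct]

lemma opNorm_selMatrix_le {f : m → n} (hf : Function.Injective f) : opNorm (selMatrix f) ≤ 1 := by
  refine opNorm_le zero_le_one fun x => ?_
  rw [selMatrix_mulVec, one_mul, EuclideanSpace.norm_eq, EuclideanSpace.norm_eq]
  refine Real.sqrt_le_sqrt ?_
  have : ∑ i, ‖x (f i)‖ ^ 2 = ∑ j ∈ Finset.univ.image f, ‖x j‖ ^ 2 := by
    rw [Finset.sum_image fun a _ b _ h => hf h]
  simp only [Function.comp]
  rw [this]
  exact Finset.sum_le_sum_of_subset_of_nonneg (Finset.subset_univ _) fun _ _ _ => sq_nonneg _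

/-- Taking a submatrix is multiplication by selection matrices, which have norm at most one for
injective index maps. -/
lemma opNorm_submatrix_le {m' n' : Type} [Fintype m'] [Fintype n'] [DecidableEq m']
    [DecidableEq n'] (A : Matrix m n ℝ) {f : m' → m} {g : n' → n} (hf : Function.Injective f)
    (hg : Function.Injective g) : opNorm (A.submatrix f g) ≤ opNorm A := by
  have e : A.submatrix f g = selMatrix f * A * (selMatrix g)ᵀ := by
    ext i j
    simp [Matrix.mul_apply, selMatrix]
  rw [e]
  refine (opNorm_mul_le _ _).trans ?_
  rw [opNorm_transpose]
  have h1 := opNorm_selMatrix_le hf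
  have h2 := opNorm_selMatrix_le hg
  have h3 := opNorm_mul_le (selMatrix f) A
  have h4 := opNorm_nonneg A
  have h5 := opNorm_nonneg (selMatrix g)
  have h6 := opNorm_nonneg (selMatrix f * A)
  nlinarith

end OpNorm

/-! ### Layers with sparse heads and balanced hidden units -/

lemma relu_mul_of_nonneg {a : ℝ} (ha : 0 ≤ a) (t : ℝ) : relu (a * t) = a * relu t := by
  unfold relu
  rw [mul_max_of_nonneg _ _ ha, mul_zero]

lemma relu_sub_relu_neg (t : ℝ) : relu t - relu (-t) = t := by
  unfold relu
  rcases le_total t 0 with h | h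
  · rw [max_eq_right h, max_eq_left (by linarith)]; ring
  · rw [max_eq_left h, max_eq_right (by linarith)]; ring

lemma relu_of_nonneg {t : ℝ} (h : 0 ≤ t) : relu t = t := max_eq_left h

lemma relu_of_nonpos {t : ℝ} (h : t ≤ 0) : relu t = 0 := max_eq_right h

section Layers

variable {ι κ : Type} [Fintype ι] [DecidableEq ι] [Fintype κ]

/-- A matrix given by a list of entries. -/
def sparse {T ι κ : Type} [Fintype T] [DecidableEq ι] [DecidableEq κ]
    (coef : T → ℝ) (p : T → ι) (q : T → κ) : Matrix ι κ ℝ :=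
  ∑ t, Matrix.single (p t) (q t) (coef t)

lemma sparse_mul_apply {T ι' : Type} [Fintype T] [DecidableEq ι'] (coef : T → ℝ) (p : T → ι')
    (q : T → ι) (X : Matrix ι κ ℝ) (b : ι') (i : κ) :
    (sparse coef p q * X) b i = ∑ t, if p t = b then coef t * X (q t) i else 0 := by
  unfold sparse
  rw [Matrix.sum_mul, Matrix.sum_apply]
  refine Finset.sum_congr rfl fun t _ => ?_
  split_ifs with h
  · subst h; simp
  · rw [Matrix.single_mul_apply_of_ne _ _ _ _ _ (Ne.symm h)]

lemma opNorm_sparse_le {T ι' : Type} [Fintype T] [Fintype ι'] [DecidableEq ι'] (coef : T → ℝ)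
    (p : T → ι') (q : T → ι) : opNorm (sparse coef p q) ≤ ∑ t, |coef t| :=
  (opNorm_sum_le _ _).trans (Finset.sum_le_sum fun _ _ => opNorm_single_le _ _ _)

/-- The layer whose head `h` copies `v h` times the coordinate `inp h` to the coordinate `out h`,
weighted by the rectified bilinear form with the entries `coef h t` at `(p h t, q h t)`. -/
def mkLayer {H T H' : Type} [Fintype H] [Fintype T] [Fintype H']
    (v : H → ℝ) (out inp : H → ι) (coef : H → T → ℝ) (p q : H → T → ι)
    (W₁ : Matrix H' ι ℝ) (W₂ : Matrix ι H' ℝ) : TFLayer ι where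
  heads := Fintype.card H
  Q m := sparse (coef ((Fintype.equivFin H).symm m)) (p ((Fintype.equivFin H).symm m))
    (q ((Fintype.equivFin H).symm m))
  K _ := 1
  V m := Matrix.single (out ((Fintype.equivFin H).symm m)) (inp ((Fintype.equivFin H).symm m))
    (v ((Fintype.equivFin H).symm m))
  hidden := Fintype.card H'
  W₁ := W₁.submatrix (Fintype.equivFin H').symm id
  W₂ := W₂.submatrix id (Fintype.equivFin H').symm

variable {H T H' : Type} [Fintype H] [Fintype T] [Fintype H']
    (v : H → ℝ) (out inp : H → ι) (coef : H → T → ℝ) (p q : H → T → ι)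
    (W₁ : Matrix H' ι ℝ) (W₂ : Matrix ι H' ℝ)

/-- With the identity as key matrix, `Q` alone is the bilinear form: the coordinates `p` are read at
the output column `j`, the coordinates `q` and `inp` at the summed column `i`. -/
lemma mkLayer_attn_apply (X : Matrix ι κ ℝ) (a : ι) (j : κ) :
    (mkLayer v out inp coef p q W₁ W₂).attn X a j
      = X a j + 1 / (Fintype.card κ : ℝ) * ∑ h, if out h = a then
          v h * ∑ i, X (inp h) i * relu (∑ t, coef h t * X (p h t) j * X (q h t) i) else 0 := by
  have key : ∀ h, (Matrix.single (out h) (inp h) (v h) * X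
      * ((((sparse (coef h) (p h) (q h)) * X)ᵀ * ((1 : Matrix ι ι ℝ) * X)).map relu)) a j
      = if out h = a then
          v h * ∑ i, X (inp h) i * relu (∑ t, coef h t * X (p h t) j * X (q h t) i) else 0 := by
    intro h
    rw [Matrix.mul_apply]
    split_ifs with hh
    · subst hh
      rw [Finset.mul_sum]
      refine Finset.sum_congr rfl fun i _ => ?_
      rw [Matrix.single_mul_apply_same, mul_assoc, Matrix.map_apply, Matrix.mul_apply]
      congr 3
      simp only [Matrix.transpose_apply, sparse_mul_apply, Matrix.one_mul, Finset.sum_mul]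
      rw [Finset.sum_comm]
      refine Finset.sum_congr rfl fun t _ => ?_
      simp only [ite_mul, zero_mul]
      rw [Finset.sum_ite_eq]
      simp only [Finset.mem_univ, if_true]
      ring
    · refine Finset.sum_eq_zero fun i _ => ?_
      rw [Matrix.single_mul_apply_of_ne _ _ _ _ _ (Ne.symm hh), zero_mul]
  unfold TFLayer.attn
  rw [Matrix.add_apply, Matrix.smul_apply, Matrix.sum_apply, smul_eq_mul]
  congr 2
  exact Fintype.sum_equiv (Fintype.equivFin H).symm _ _ fun m => key ((Fintype.equivFin H).symm m)

lemma mkLayer_mlp (X : Matrix ι κ ℝ) :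
    (mkLayer v out inp coef p q W₁ W₂).mlp X = X + W₂ * (W₁ * X).map relu := by
  unfold TFLayer.mlp mkLayer
  ext a j
  simp only [Matrix.add_apply, Matrix.mul_apply, Matrix.map_apply, Matrix.submatrix_apply, id]
  congr 1
  exact Fintype.sum_equiv (Fintype.equivFin H').symm _ _ fun m => rfl

lemma mkLayer_norm_le [DecidableEq H'] {B : ℝ} (hB : 0 ≤ B) (h : ∀ h, ∑ t, |coef h t| ≤ B) :
    (mkLayer v out inp coef p q W₁ W₂).norm
      ≤ B + 1 + ∑ h, |v h| + opNorm W₁ + opNorm W₂ := by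
  unfold TFLayer.norm
  gcongr ?_ + ?_ + ?_ + ?_
  -- This form of the supremum bound also covers a layer without heads, whose supremum is 0.
  · refine Real.iSup_le (fun m => max_le ?_ ?_) (by linarith)
    · exact ((opNorm_sparse_le _ _ _).trans (h _)).trans (by linarith)
    · exact opNorm_one_le.trans (by linarith)
  · refine le_of_le_of_eq (Finset.sum_le_sum fun m _ => opNorm_single_le _ _ _) ?_
    exact Fintype.sum_equiv (Fintype.equivFin H).symm _ _ fun m => rfl
  · exact opNorm_submatrix_le _ (Equiv.injective _) Function.injective_id
  · exact opNorm_submatrix_le _ Function.injective_id (Equiv.injective _)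

/-- The first weight matrix of the hidden units `c h • relu (∑ t, coef h t * X (q h t))`. -/
def neuronIn (c : H → ℝ) (coef : H → T → ℝ) (q : H → T → ι) : Matrix H ι ℝ :=
  Matrix.of fun h b => √|c h| * ∑ t, if q h t = b then coef h t else 0

/-- The second weight matrix of the hidden units with weights `c h` and targets `out h`. -/
def neuronOut (c : H → ℝ) (out : H → ι) : Matrix ι H ℝ :=
  Matrix.of fun a h => if out h = a then SignType.sign (c h) * √|c h| else 0

/-- Positive homogeneity of the ReLU moves the input factor √|c h| outside, where it meets sign(c
h)·√|c h| and restores c h. -/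
lemma neuron_apply (c : H → ℝ) (X : Matrix ι κ ℝ) (a : ι) (j : κ) :
    (neuronOut c out * (neuronIn c coef q * X).map relu) a j
      = ∑ h, if out h = a then c h * relu (∑ t, coef h t * X (q h t) j) else 0 := by
  rw [Matrix.mul_apply]
  refine Finset.sum_congr rfl fun h _ => ?_
  unfold neuronOut neuronIn
  rw [Matrix.map_apply, Matrix.mul_apply]
  simp only [Matrix.of_apply]
  split_ifs with hh
  · have : ∑ b, (√|c h| * ∑ t, if q h t = b then coef h t else 0) * X b j
        = √|c h| * ∑ t, coef h t * X (q h t) j := by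
      simp only [mul_assoc, ← Finset.mul_sum]
      congr 1
      simp only [Finset.sum_mul]
      rw [Finset.sum_comm]
      refine Finset.sum_congr rfl fun t _ => ?_
      simp
    rw [this, relu_mul_of_nonneg (Real.sqrt_nonneg _)]
    have h2 : √|c h| * √|c h| = |c h| := Real.mul_self_sqrt (abs_nonneg _)
    calc _ = (SignType.sign (c h) * (√|c h| * √|c h|))
          * relu (∑ t, coef h t * X (q h t) j) := by ring
      _ = _ := by rw [h2, sign_mul_abs]
  · rw [zero_mul]

/-- The balanced split makes both weight matrices as small as the square root of the total weight,
whatever the number of hidden units. -/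
lemma opNorm_neuronIn_le [DecidableEq H] (c : H → ℝ) {B : ℝ} (hB : 0 ≤ B)
    (h : ∀ h, ∑ t, |coef h t| ≤ B) : opNorm (neuronIn c coef q) ≤ B * √(∑ h, |c h|) := by
  refine (opNorm_le_sqrt _).trans ?_
  rw [← Real.sqrt_sq hB, ← Real.sqrt_mul (sq_nonneg B)]
  refine Real.sqrt_le_sqrt ?_
  rw [Finset.mul_sum]
  refine Finset.sum_le_sum fun k _ => ?_
  unfold neuronIn
  simp only [Matrix.of_apply, mul_pow, Real.sq_sqrt (abs_nonneg _)]
  rw [← Finset.mul_sum, mul_comm]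
  refine mul_le_mul_of_nonneg_right ?_ (abs_nonneg _)
  calc ∑ b, (∑ t, if q k t = b then coef k t else 0) ^ 2
      ≤ ∑ b, (∑ t, if q k t = b then |coef k t| else 0) ^ 2 := by
        refine Finset.sum_le_sum fun b _ => sq_le_sq' ?_ ?_
        · rw [← Finset.sum_neg_distrib]
          refine Finset.sum_le_sum fun t _ => ?_
          split_ifs
          · exact neg_abs_le _
          · simp
        · refine Finset.sum_le_sum fun t _ => ?_
          split_ifs
          · exact le_abs_self _
          · simp
    _ ≤ (∑ b, ∑ t, if q k t = b then |coef k t| else 0) ^ 2 :=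
        Finset.sum_sq_le_sq_sum_of_nonneg fun b _ =>
          Finset.sum_nonneg fun t _ => by split_ifs <;> simp
    _ = (∑ t, |coef k t|) ^ 2 := by rw [Finset.sum_comm]; simp
    _ ≤ B ^ 2 := pow_le_pow_left₀ (Finset.sum_nonneg fun _ _ => abs_nonneg _) (h k) 2

lemma opNorm_neuronOut_le [DecidableEq H] (c : H → ℝ) :
    opNorm (neuronOut c out) ≤ √(∑ h, |c h|) := by
  refine (opNorm_le_sqrt _).trans (Real.sqrt_le_sqrt ?_)
  rw [Finset.sum_comm]
  refine Finset.sum_le_sum fun k _ => ?_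
  unfold neuronOut
  rw [Finset.sum_eq_single (out k)]
  · simp only [Matrix.of_apply, if_true, mul_pow, Real.sq_sqrt (abs_nonneg _)]
    rcases lt_trichotomy (c k) 0 with h | h | h
    · simp [h]
    · simp [h]
    · simp [h]
  · intro b _ hb; simp [hb.symm]
  · simp

end Layers


/-! ### Univariate approximation by sums of rectified linear units -/

lemma abs_relu_sub_relu_le (s t : ℝ) : |relu s - relu t| ≤ |s - t| :=
  abs_max_sub_max_le_abs s t 0

lemma continuous_relu : Continuous relu := continuous_id.max continuous_const

/-- Taylor's formula of order one with the remainder over the whole interval. -/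
lemma taylor_relu {f : ℝ → ℝ} (hf : ContDiff ℝ 2 f) {B s : ℝ} (hs : |s| ≤ B) :
    f s = f (-B) + deriv f (-B) * (s + B)
      + ∫ t in (-B)..B, deriv (deriv f) t * relu (s - t) := by
  have hf1 : Differentiable ℝ f := hf.differentiable (by norm_num)
  have hd : ContDiff ℝ 1 (deriv f) := ((contDiff_succ_iff_deriv (n := 1)).1 hf).2.2
  have hd1 : Differentiable ℝ (deriv f) := hd.differentiable (by norm_num)
  have hdd : Continuous (deriv (deriv f)) := hd.continuous_deriv (le_refl _)
  obtain ⟨h1, h2⟩ := abs_le.1 hs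
  have hc : Continuous fun t => deriv (deriv f) t * relu (s - t) :=
    hdd.mul (continuous_relu.comp (by fun_prop))
  have hsplit := intervalIntegral.integral_add_adjacent_intervals
    (hc.intervalIntegrable (μ := MeasureTheory.volume) (-B) s) (hc.intervalIntegrable s B)
  -- For t beyond s the rectified factor vanishes; below s it is s - t, and f'(t)(s - t) + f(t) is
  -- an antiderivative.
  have hz : ∫ t in s..B, deriv (deriv f) t * relu (s - t) = 0 := by
    rw [intervalIntegral.integral_congr (g := fun _ => 0)]
    · simp
    · intro t ht
      rw [Set.uIcc_of_le h2] at ht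
      simp only
      rw [relu_of_nonpos (by linarith [ht.1]), mul_zero]
  have hm : ∫ t in (-B)..s, deriv (deriv f) t * relu (s - t)
      = (deriv f s * (s - s) + f s) - (deriv f (-B) * (s - -B) + f (-B)) := by
    rw [intervalIntegral.integral_congr (g := fun t => deriv (deriv f) t * (s - t))]
    · refine intervalIntegral.integral_eq_sub_of_hasDerivAt
        (f := fun t => deriv f t * (s - t) + f t) (fun t _ => ?_) ?_
      · have := (((hd1 t).hasDerivAt.mul ((hasDerivAt_id t).const_sub s))).add (hf1 t).hasDerivAt
        refine (this.congr_deriv ?_).congr_of_eventuallyEq (Filter.Eventually.of_forall ?_)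
        · simp only [id]; ring
        · intro x; rfl
      · exact (hdd.mul (by fun_prop)).intervalIntegrable _ _
    · intro t ht
      rw [Set.uIcc_of_le h1] at ht
      simp only
      rw [relu_of_nonneg (by linarith [ht.2])]
  rw [← hsplit, hz, hm]
  ring

/-- A sum of rectified linear units of slope one. -/
def reluSum {M : ℕ} (c b : Fin M → ℝ) (s : ℝ) : ℝ := ∑ m, c m * relu (s + b m)

/-- A `C²` function is approximated on an interval, with bounded total weight, by sums of
rectified linear units with an error inversely proportional to their number. -/
lemma exists_reluSum_approx {f : ℝ → ℝ} (hf : ContDiff ℝ 2 f) {B : ℝ} (hB : 0 ≤ B) :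
    ∃ C : ℝ, 0 ≤ C ∧ ∀ N : ℕ, 0 < N → ∃ c b : Fin (N + 3) → ℝ,
      (∑ m, |c m| ≤ C) ∧ (∀ m, |b m| ≤ B + 1) ∧
      ∀ s, |s| ≤ B → |reluSum c b s - f s| ≤ C / N := by
  have hd : ContDiff ℝ 1 (deriv f) := ((contDiff_succ_iff_deriv (n := 1)).1 hf).2.2
  have hdd : Continuous (deriv (deriv f)) := hd.continuous_deriv (le_refl _)
  obtain ⟨S, hS⟩ := (isCompact_Icc (a := -B) (b := B)).exists_bound_of_continuousOn
    hdd.continuousOn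
  have hS0 : 0 ≤ S := (norm_nonneg _).trans (hS 0 ⟨by linarith, hB⟩)
  refine ⟨2 * |f (-B)| + |deriv f (-B)| + S * (2 * B) + S * (2 * B) ^ 2, by positivity, ?_⟩
  intro N hN
  have hN' : (0 : ℝ) < N := by exact_mod_cast hN
  set h : ℝ := 2 * B / N with hh
  have hh0 : 0 ≤ h := by positivity
  set t : ℕ → ℝ := fun j => -B + j * h with ht
  have hNh : N * h = 2 * B := by rw [hh]; field_simp
  have ht1 : ∀ j, t (j + 1) = t j + h := fun j => by simp only [ht]; push_cast; ring
  have htN : t N = B := by simp only [ht, hNh]; ring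
  have ht0 : t 0 = -B := by simp [ht]
  have htmem : ∀ j, j ≤ N → -B ≤ t j ∧ t j ≤ B := by
    intro j hj
    have hj' : (j : ℝ) ≤ N := by exact_mod_cast hj
    constructor
    · simp only [ht]; nlinarith [mul_nonneg (Nat.cast_nonneg (α := ℝ) j) hh0]
    · rw [← htN]; simp only [ht]; nlinarith
  -- The weight of the unit with kink `t j` is the mass of f'' on its cell, so the weights sum to at
  -- most 2BS.
  set I : ℕ → ℝ := fun j => ∫ x in (t j)..(t (j + 1)), deriv (deriv f) x with hI
  have hbound : ∀ j, j < N → ∀ x ∈ Set.uIoc (t j) (t (j + 1)), |deriv (deriv f) x| ≤ S := by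
    intro j hj x hx
    rw [Set.uIoc_of_le (by rw [ht1]; linarith)] at hx
    exact hS x ⟨by linarith [(htmem j hj.le).1, hx.1], hx.2.trans (htmem (j + 1) hj).2⟩
  have hIle : ∀ j, j < N → |I j| ≤ S * h := by
    intro j hj
    have := intervalIntegral.norm_integral_le_of_norm_le_const
      (f := fun x => deriv (deriv f) x) (hbound j hj)
    rw [ht1, add_sub_cancel_left, abs_of_nonneg hh0, ← ht1] at this
    exact this
  -- The three extra units produce the affine part: ReLU(s + B + 1) - ReLU(s + B) equals 1 on the
  -- interval, and ReLU(s + B) = s + B.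
  refine ⟨Fin.append (fun j : Fin N => I j) ![f (-B), -f (-B), deriv f (-B)],
    Fin.append (fun j : Fin N => -t j) ![B + 1, B, B], ?_, ?_, ?_⟩
  · rw [Fin.sum_univ_add]
    simp only [Fin.append_left, Fin.append_right, Fin.sum_univ_three, Matrix.cons_val_zero,
      Matrix.cons_val_one, Matrix.cons_val]
    have : ∑ j : Fin N, |I j| ≤ ∑ j : Fin N, S * h := Finset.sum_le_sum fun j _ => hIle j j.2
    rw [Finset.sum_const, Finset.card_univ, Fintype.card_fin, nsmul_eq_mul] at this
    have e : (N : ℝ) * (S * h) = S * (2 * B) := by rw [← hNh]; ring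
    rw [abs_neg]
    nlinarith [mul_nonneg hS0 (sq_nonneg (2 * B))]
  · intro m
    refine Fin.addCases (fun j => ?_) (fun j => ?_) m
    · rw [Fin.append_left, abs_neg, abs_le]
      obtain ⟨h1, h2⟩ := htmem j j.2.le
      constructor <;> linarith
    · rw [Fin.append_right]
      fin_cases j <;> simp [abs_of_nonneg, hB, add_nonneg]
  · intro s hs
    obtain ⟨hs1, hs2⟩ := abs_le.1 hs
    have hc : Continuous fun x => deriv (deriv f) x * relu (s - x) :=
      hdd.mul (continuous_relu.comp (by fun_prop))
    have hsum : ∫ x in (-B)..B, deriv (deriv f) x * relu (s - x)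
        = ∑ j ∈ Finset.range N, ∫ x in (t j)..(t (j + 1)), deriv (deriv f) x * relu (s - x) := by
      rw [intervalIntegral.sum_integral_adjacent_intervals fun k _ => hc.intervalIntegrable _ _,
        ht0, htN]
    have hval : reluSum (Fin.append (fun j : Fin N => I j) ![f (-B), -f (-B), deriv f (-B)])
        (Fin.append (fun j : Fin N => -t j) ![B + 1, B, B]) s
        = f (-B) + deriv f (-B) * (s + B) + ∑ j ∈ Finset.range N, I j * relu (s - t j) := by
      unfold reluSum
      rw [Fin.sum_univ_add, ← Fin.sum_univ_eq_sum_range (fun j => I j * relu (s - t j))]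
      simp only [Fin.append_left, Fin.append_right, Fin.sum_univ_three, Matrix.cons_val_zero,
        Matrix.cons_val_one, Matrix.cons_val]
      rw [relu_of_nonneg (show 0 ≤ s + (B + 1) by linarith),
        relu_of_nonneg (show 0 ≤ s + B by linarith)]
      simp only [← sub_eq_add_neg]
      ring
    rw [hval, taylor_relu hf hs, hsum, add_sub_add_left_eq_sub, ← Finset.sum_sub_distrib]
    -- Moving the kink to the left end of the cell changes the ReLU by at most h, on a cell of
    -- length h where |f''| ≤ S. Summing over N cells gives S(2B)²/N.
    have hterm : ∀ j ∈ Finset.range N, |I j * relu (s - t j)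
        - ∫ x in (t j)..(t (j + 1)), deriv (deriv f) x * relu (s - x)| ≤ S * h * h := by
      intro j hj
      have hj := Finset.mem_range.1 hj
      rw [hI]
      simp only
      rw [← intervalIntegral.integral_mul_const, ← intervalIntegral.integral_sub
        ((show Continuous fun x => deriv (deriv f) x * relu (s - t j) from
          hdd.mul continuous_const).intervalIntegrable _ _) (hc.intervalIntegrable _ _)]
      have := intervalIntegral.norm_integral_le_of_norm_le_const (C := S * h)
        (f := fun x => deriv (deriv f) x * relu (s - t j) - deriv (deriv f) x * relu (s - x))
        (a := t j) (b := t (j + 1)) (fun x hx => by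
          rw [← mul_sub, norm_mul]
          refine mul_le_mul (hbound j hj x hx) ?_ (norm_nonneg _) hS0
          refine (abs_relu_sub_relu_le _ _).trans ?_
          rw [Set.uIoc_of_le (by rw [ht1]; linarith), ht1] at hx
          rw [abs_le]
          constructor <;> linarith [hx.1, hx.2])
      rw [ht1, add_sub_cancel_left, abs_of_nonneg hh0, ← ht1] at this
      exact this
    refine (Finset.abs_sum_le_sum_abs _ _).trans ((Finset.sum_le_sum hterm).trans ?_)
    rw [Finset.sum_const, Finset.card_range, nsmul_eq_mul]
    have e : (N : ℝ) * (S * h * h) = S * (2 * B) ^ 2 / N := by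
      rw [hh]; field_simp
    rw [e]
    gcongr
    have h1 := abs_nonneg (f (-B))
    have h2 := abs_nonneg (deriv f (-B))
    nlinarith [mul_nonneg hS0 hB]


/-! ### Approximation of continuous functions by shallow networks -/

section Universal

variable {ι : Type} [Fintype ι]

/-- Uniform approximability on a ball by shallow networks of rectified linear units. -/
def ReluApproximable (R : ℝ) (f : (ι → ℝ) → ℝ) : Prop :=
  ∀ ν : ℝ, 0 < ν → ∃ (H : Type) (_ : Fintype H) (c : H → ℝ) (a : H → ι → ℝ) (b : H → ℝ),
    ∀ x, ‖x‖ ≤ R → |∑ h, c h * relu (∑ i, a h i * x i + b h) - f x| ≤ ν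

lemma ReluApproximable.add {R : ℝ} {f g : (ι → ℝ) → ℝ} (hf : ReluApproximable R f)
    (hg : ReluApproximable R g) : ReluApproximable R (fun x => f x + g x) := by
  intro ν hν
  obtain ⟨H, _, c, a, b, h⟩ := hf (ν / 2) (by positivity)
  obtain ⟨H', _, c', a', b', h'⟩ := hg (ν / 2) (by positivity)
  refine ⟨H ⊕ H', inferInstance, Sum.elim c c', Sum.elim a a', Sum.elim b b', fun x hx => ?_⟩
  rw [Fintype.sum_sum_type]
  simp only [Sum.elim_inl, Sum.elim_inr]
  rw [add_sub_add_comm]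
  exact (abs_add_le _ _).trans (by linarith [h x hx, h' x hx])

lemma ReluApproximable.const_mul {R : ℝ} {f : (ι → ℝ) → ℝ} (hf : ReluApproximable R f) (r : ℝ) :
    ReluApproximable R (fun x => r * f x) := by
  intro ν hν
  obtain ⟨H, _, c, a, b, h⟩ := hf (ν / (|r| + 1)) (by positivity)
  refine ⟨H, inferInstance, fun h => r * c h, a, b, fun x hx => ?_⟩
  simp only [mul_assoc]
  rw [← Finset.mul_sum, ← mul_sub, abs_mul]
  have h1 := h x hx
  rw [le_div_iff₀ (by positivity)] at h1
  nlinarith [abs_nonneg (∑ h, c h * relu (∑ i, a h i * x i + b h) - f x)]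

lemma reluApproximable_zero (R : ℝ) : ReluApproximable R (fun _ : ι → ℝ => 0) := by
  intro ν hν
  exact ⟨Empty, inferInstance, Empty.elim, Empty.elim, Empty.elim, fun x _ => by simpa using hν.le⟩

/-- A ridge function depends on one linear form, which is bounded on the ball, so the univariate
approximation applies. -/
lemma reluApproximable_ridge {f : ℝ → ℝ} (hf : ContDiff ℝ 2 f) (R : ℝ) (a : ι → ℝ) :
    ReluApproximable R (fun x => f (∑ i, a i * x i)) := by
  intro ν hν
  obtain ⟨C, hC, h⟩ := exists_reluSum_approx hf (B := (∑ i, |a i|) * |R|) (by positivity)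
  obtain ⟨N, hN⟩ := exists_nat_gt (C / ν)
  have hN0 : (0 : ℝ) < N := lt_of_le_of_lt (by positivity) hN
  obtain ⟨c, b, -, -, hcb⟩ := h N (by exact_mod_cast hN0)
  refine ⟨Fin (N + 3), inferInstance, c, fun _ => a, b, fun x hx => ?_⟩
  refine (hcb _ ?_).trans ?_
  · refine (Finset.abs_sum_le_sum_abs _ _).trans ?_
    rw [Finset.sum_mul]
    refine Finset.sum_le_sum fun i _ => ?_
    rw [abs_mul]
    exact mul_le_mul_of_nonneg_left
      (((norm_le_pi_norm x i).trans hx).trans (le_abs_self R)) (abs_nonneg _)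
  · rw [div_le_iff₀ hN0]
    rw [div_lt_iff₀ hν] at hN
    linarith

/-- The exponential of a linear form. -/
def ridgeExp (a : ι → ℝ) : C(ι → ℝ, ℝ) :=
  ⟨fun x => Real.exp (∑ i, a i * x i), by fun_prop⟩

/-- Stone–Weierstrass for the algebra generated by exponentials of linear forms. These are closed
under multiplication, so the algebra is their linear span, and each of them is a ridge function. -/
lemma reluApproximable_of_continuous (R : ℝ) {f : (ι → ℝ) → ℝ} (hf : Continuous f) :
    ReluApproximable R f := by
  classical
  intro ν hν
  set A : Subalgebra ℝ C(ι → ℝ, ℝ) := Algebra.adjoin ℝ (Set.range ridgeExp) with hA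
  have hsep : A.SeparatesPoints := by
    intro x y hxy
    obtain ⟨i, hi⟩ := Function.ne_iff.1 hxy
    refine ⟨_, ⟨ridgeExp (Pi.single i 1), Algebra.subset_adjoin ⟨_, rfl⟩, rfl⟩, ?_⟩
    have e : ∀ z : ι → ℝ, ridgeExp (Pi.single i 1) z = Real.exp (z i) := by
      intro z
      change Real.exp (∑ j, (Pi.single i 1 : ι → ℝ) j * z j) = _
      simp [Pi.single_apply]
    simp only [e]
    exact fun h => hi (Real.exp_injective h)
  have hspan : Subalgebra.toSubmodule A = Submodule.span ℝ (Set.range (ridgeExp (ι := ι))) := by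
    refine Algebra.adjoin_eq_span_of_subset _ ?_
    let S : Submonoid C(ι → ℝ, ℝ) :=
      { carrier := Set.range ridgeExp
        mul_mem' := by
          rintro _ _ ⟨a, rfl⟩ ⟨b, rfl⟩
          refine ⟨a + b, ContinuousMap.ext fun x => ?_⟩
          change Real.exp (∑ i, (a + b) i * x i)
            = Real.exp (∑ i, a i * x i) * Real.exp (∑ i, b i * x i)
          rw [← Real.exp_add, ← Finset.sum_add_distrib]
          simp only [Pi.add_apply, add_mul]
        one_mem' := ⟨0, ContinuousMap.ext fun x => by
          change Real.exp (∑ i, (0 : ι → ℝ) i * x i) = 1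
          simp⟩ }
    have : Submonoid.closure (Set.range (ridgeExp (ι := ι))) ≤ S :=
      Submonoid.closure_le.2 fun _ h => h
    exact fun x hx => Submodule.subset_span (this hx)
  obtain ⟨g, hgA, hg⟩ :=
    ContinuousMap.exists_mem_subalgebra_near_continuous_of_isCompact_of_separatesPoints hsep
      ⟨f, hf⟩ (isCompact_closedBall (0 : ι → ℝ) R) (half_pos hν)
  have happ : ReluApproximable R g := by
    have hgS : g ∈ Submodule.span ℝ (Set.range (ridgeExp (ι := ι))) := by
      rw [← hspan]; exact hgA
    clear hg hgA
    induction hgS using Submodule.span_induction with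
    | mem x hx =>
      obtain ⟨a, rfl⟩ := hx
      exact reluApproximable_ridge Real.contDiff_exp R a
    | zero => exact reluApproximable_zero R
    | add x y _ _ hx hy => exact hx.add hy
    | smul r x _ hx => exact hx.const_mul r
  obtain ⟨H, _, c, a, b, h⟩ := happ (ν / 2) (half_pos hν)
  refine ⟨H, inferInstance, c, a, b, fun x hx => ?_⟩
  have h1 := h x hx
  have h2 := hg x (by simpa using hx)
  rw [Real.norm_eq_abs] at h2
  have h3 := abs_sub_le (∑ h, c h * relu (∑ i, a h i * x i + b h)) (g x) (f x)
  have h4 : |g x - f x| < ν / 2 := h2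
  linarith

end Universal

/-! ### Coordinates of parameter tuples and the projection -/

section ParamFacts

variable {d K : ℕ}

lemma norm_le_card_mul {ι : Type} [Fintype ι] {x : EuclideanSpace ℝ ι} {b : ℝ}
    (h : ∀ i, |x i| ≤ b) : ‖x‖ ≤ Fintype.card ι * b := by
  have h1 : ‖x‖ ≤ ∑ i, |x i| := by
    rw [EuclideanSpace.norm_eq]
    refine Real.sqrt_le_iff.2 ⟨Finset.sum_nonneg fun _ _ => abs_nonneg _, ?_⟩
    exact Finset.sum_sq_le_sq_sum_of_nonneg fun i _ => abs_nonneg _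
  refine h1.trans ((Finset.sum_le_sum fun i _ => h i).trans ?_)
  simp

lemma abs_apply_le_norm {ι : Type} [Fintype ι] (x : EuclideanSpace ℝ ι) (i : ι) :
    |x i| ≤ ‖x‖ := PiLp.norm_apply_le x i

lemma toCoords_ofCoords (c : ParamIdx d K → ℝ) : toCoords (ofCoords c) = c := by
  ext (p | p | p) <;> rfl

lemma ofCoords_toCoords (θ : Params d K) : ofCoords (toCoords θ) = θ := rfl

lemma toCoords_sub (θ θ' : Params d K) : toCoords (θ - θ') = toCoords θ - toCoords θ' := by
  ext (p | p | p) <;> rfl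

lemma toCoords_smul (r : ℝ) (θ : Params d K) : toCoords (r • θ) = r • toCoords θ := by
  ext (p | p | p) <;> rfl

lemma abs_toCoords_le (θ : Params d K) (p : ParamIdx d K) : |toCoords θ p| ≤ ‖θ‖ := by
  rcases p with p | p | p
  · exact (abs_apply_le_norm θ.1 p).trans (norm_fst_le θ)
  · exact (abs_apply_le_norm θ.2.1 p).trans ((norm_fst_le θ.2).trans (norm_snd_le θ))
  · exact (abs_apply_le_norm θ.2.2 p).trans ((norm_snd_le θ.2).trans (norm_snd_le θ))

/-- Coordinatewise bounds pass to the maximum norm; Kd + K dominates the dimension of each of the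
three components. -/
lemma params_norm_le {θ : Params d K} {b : ℝ} (hb : 0 ≤ b) (h : ∀ p, |toCoords θ p| ≤ b) :
    ‖θ‖ ≤ (K * d + K) * b := by
  have h1 : ‖θ.1‖ ≤ _ := norm_le_card_mul fun p => h (Sum.inl p)
  have h2 : ‖θ.2.1‖ ≤ _ := norm_le_card_mul fun p => h (Sum.inr (Sum.inl p))
  have h3 : ‖θ.2.2‖ ≤ _ := norm_le_card_mul fun p => h (Sum.inr (Sum.inr p))
  simp only [Fintype.card_prod, Fintype.card_fin, Nat.cast_mul] at h1 h2 h3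
  have h4 : 0 ≤ (K : ℝ) * d * b := by positivity
  have h5 : 0 ≤ (K : ℝ) * b := by positivity
  rw [Prod.norm_def, Prod.norm_def]
  refine max_le ?_ (max_le ?_ ?_) <;> linarith

lemma norm_rowVec_le (u : EuclideanSpace ℝ (Fin K × Fin d)) (k : Fin K) :
    ‖rowVec u k‖ ≤ ‖u‖ := by
  rw [EuclideanSpace.norm_eq, EuclideanSpace.norm_eq]
  refine Real.sqrt_le_sqrt ?_
  rw [Fintype.sum_prod_type]
  exact Finset.single_le_sum (f := fun k => ∑ i, ‖u (k, i)‖ ^ 2)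
    (fun _ _ => Finset.sum_nonneg fun _ _ => sq_nonneg _) (Finset.mem_univ k)

/-- A Lipschitz constant 2 is enough here. If one point lies in the ball, the other is at least as
close to its own projection; if neither does, the change of the scaling factor and the change of the
point each cost at most the distance. -/
lemma norm_projBall_sub_le {ι : Type} [Fintype ι] {B : ℝ} (hB : 0 < B)
    (x y : EuclideanSpace ℝ ι) : ‖projBall B x - projBall B y‖ ≤ 2 * ‖x - y‖ := by
  by_cases hx : ‖x‖ ≤ B
  · have h1 : projBall B x = x := if_pos hx
    have h2 := norm_sub_projBall_le hB.le y x hx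
    rw [h1]
    calc ‖x - projBall B y‖ ≤ ‖x - y‖ + ‖y - projBall B y‖ := norm_sub_le_norm_sub_add_norm_sub ..
      _ ≤ _ := by rw [norm_sub_rev y x] at h2; linarith
  by_cases hy : ‖y‖ ≤ B
  · have h1 : projBall B y = y := if_pos hy
    have h2 := norm_sub_projBall_le hB.le x y hy
    rw [h1]
    calc ‖projBall B x - y‖ ≤ ‖projBall B x - x‖ + ‖x - y‖ := norm_sub_le_norm_sub_add_norm_sub ..
      _ ≤ _ := by rw [norm_sub_rev] at h2; linarith
  unfold projBall
  rw [if_neg hx, if_neg hy]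
  push Not at hx hy
  have hx0 : 0 < ‖x‖ := hB.trans hx
  have hy0 : 0 < ‖y‖ := hB.trans hy
  have e : (B / ‖x‖) • x - (B / ‖y‖) • y
      = (B / ‖x‖) • (x - y) + (B / ‖x‖ - B / ‖y‖) • y := by
    rw [smul_sub, sub_smul]; abel
  rw [e]
  refine (norm_add_le _ _).trans ?_
  rw [norm_smul, norm_smul, Real.norm_of_nonneg (by positivity), Real.norm_eq_abs]
  have h1 : B / ‖x‖ ≤ 1 := (div_le_one hx0).2 hx.le
  have h2 : |B / ‖x‖ - B / ‖y‖| * ‖y‖ = B / ‖x‖ * |‖y‖ - ‖x‖| := by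
    have : B / ‖x‖ - B / ‖y‖ = B / ‖x‖ * ((‖y‖ - ‖x‖) / ‖y‖) := by field_simp
    rw [this, abs_mul, abs_div, abs_div, abs_norm, abs_norm, abs_of_pos hB]
    field_simp
  have h3 : |‖y‖ - ‖x‖| ≤ ‖x - y‖ := by rw [norm_sub_rev]; exact abs_norm_sub_norm_le y x
  rw [h2]
  nlinarith [norm_nonneg (x - y), abs_nonneg (‖y‖ - ‖x‖), div_pos hB hx0]

variable {Bu Bw Bv : ℝ}

lemma projW_mem (hBu : 0 ≤ Bu) (hBw : 0 ≤ Bw) (hBv : 0 ≤ Bv) (θ : Params d K) :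
    projW Bu Bw Bv θ ∈ paramSet Bu Bw Bv :=
  ⟨fun k => norm_projBall_le hBu (rowVec θ.1 k), norm_projBall_le hBw _,
    norm_projBall_le hBv _⟩

lemma norm_projW_sub_le (hBu : 0 < Bu) (hBw : 0 < Bw) (hBv : 0 < Bv) (θ θ' : Params d K) :
    ‖projW Bu Bw Bv θ - projW Bu Bw Bv θ'‖ ≤ (K * d + K) * (2 * ‖θ - θ'‖) := by
  refine params_norm_le (by positivity) fun p => ?_
  rcases p with ⟨k, i⟩ | p | p
  · refine (abs_apply_le_norm (projBall Bu (rowVec θ.1 k) - projBall Bu (rowVec θ'.1 k)) i).trans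
      ((norm_projBall_sub_le hBu _ _).trans ?_)
    have h : ‖rowVec (θ.1 - θ'.1) k‖ ≤ _ := norm_rowVec_le _ _
    have h' : ‖θ.1 - θ'.1‖ ≤ ‖θ - θ'‖ := norm_fst_le (θ - θ')
    have e : rowVec θ.1 k - rowVec θ'.1 k = rowVec (θ.1 - θ'.1) k := rfl
    rw [e]; linarith
  · refine (abs_apply_le_norm (projBall Bw θ.2.1 - projBall Bw θ'.2.1) p).trans
      ((norm_projBall_sub_le hBw _ _).trans ?_)
    have h' : ‖θ.2.1 - θ'.2.1‖ ≤ ‖θ - θ'‖ :=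
      (norm_fst_le (θ - θ').2).trans (norm_snd_le (θ - θ'))
    linarith
  · refine (abs_apply_le_norm (projBall Bv θ.2.2 - projBall Bv θ'.2.2) p).trans
      ((norm_projBall_sub_le hBv _ _).trans ?_)
    have h' : ‖θ.2.2 - θ'.2.2‖ ≤ ‖θ - θ'‖ :=
      (norm_snd_le (θ - θ').2).trans (norm_snd_le (θ - θ'))
    linarith

lemma continuous_projW (hBu : 0 < Bu) (hBw : 0 < Bw) (hBv : 0 < Bv) :
    Continuous (projW (d := d) (K := K) Bu Bw Bv) := by
  refine (LipschitzWith.of_dist_le_mul (K := ((K * d + K) * 2 : NNReal)) fun θ θ' => ?_).continuous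
  rw [dist_eq_norm, dist_eq_norm]
  refine (norm_projW_sub_le hBu hBw hBv θ θ').trans_eq ?_
  push_cast
  ring

lemma abs_toCoords_le_of_mem (hBu : 0 ≤ Bu) (hBw : 0 ≤ Bw) (hBv : 0 ≤ Bv) {θ : Params d K}
    (h : θ ∈ paramSet Bu Bw Bv) (p : ParamIdx d K) : |toCoords θ p| ≤ Bu + Bw + Bv := by
  obtain ⟨h1, h2, h3⟩ := h
  rcases p with ⟨k, i⟩ | p | p
  · exact (abs_apply_le_norm (rowVec θ.1 k) i).trans ((h1 k).trans (by linarith))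
  · exact (abs_apply_le_norm θ.2.1 p).trans (h2.trans (by linarith))
  · exact (abs_apply_le_norm θ.2.2 p).trans (h3.trans (by linarith))

lemma norm_le_of_mem (hBu : 0 ≤ Bu) (hBw : 0 ≤ Bw) (hBv : 0 ≤ Bv) {θ : Params d K}
    (h : θ ∈ paramSet Bu Bw Bv) : ‖θ‖ ≤ (K * d + K) * (Bu + Bw + Bv) :=
  params_norm_le (by positivity) (abs_toCoords_le_of_mem hBu hBw hBv h)

lemma continuous_toCoords (p : ParamIdx d K) : Continuous fun θ : Params d K => toCoords θ p := by
  rcases p with p | p | p <;> simp only [toCoords, Sum.elim_inl, Sum.elim_inr] <;> fun_prop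

lemma continuous_ofCoords : Continuous (ofCoords (d := d) (K := K)) := by
  unfold ofCoords
  fun_prop

/-- Shallow networks that project onto the parameter set exist for every accuracy and range. -/
lemma exists_projects (hBu : 0 < Bu) (hBw : 0 < Bw) (hBv : 0 < Bv) {δ : ℝ} (hδ : 0 < δ) (R : ℝ) :
    ∃ P : ParamBlock d K, P.Projects Bu Bw Bv δ R := by
  classical
  set W : ℝ := (K * d + K) * (Bu + Bw + Bv) with hW
  have hW0 : 0 ≤ W := by positivity
  -- The block will approximate (1 - τ) times the projection; the shrinking costs at most δ/2 in
  -- accuracy.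
  set τ : ℝ := min 1 (δ / (2 * (W + 1))) with hτ
  have hτ0 : 0 < τ := lt_min one_pos (by positivity)
  have hτ1 : τ ≤ 1 := min_le_left _ _
  have hτW : τ * W ≤ δ / 2 := by
    have h : τ ≤ δ / (2 * (W + 1)) := min_le_right _ _
    rw [le_div_iff₀ (by positivity)] at h
    nlinarith
  -- Total approximation error: it fits into the margin that the shrinking leaves in each ball, and
  -- into the remaining δ/2.
  set m : ℝ := min (τ * min Bu (min Bw Bv)) (δ / 2) with hm
  have hm0 : 0 < m := lt_min (mul_pos hτ0 (lt_min hBu (lt_min hBw hBv))) (by positivity)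
  set E : ℝ := K * d + K + d + 1 with hE
  have hE0 : 0 < E := by positivity
  have hEν : E * (m / E) = m := by field_simp
  -- The identity is subtracted because the block has a skip connection.
  have happ : ∀ p : ParamIdx d K, ReluApproximable R
      (fun c => (1 - τ) * toCoords (projW Bu Bw Bv (ofCoords c)) p - c p) := fun p =>
    reluApproximable_of_continuous R (by
      refine Continuous.sub (continuous_const.mul ?_) (continuous_apply p)
      exact (continuous_toCoords p).comp ((continuous_projW hBu hBw hBv).comp continuous_ofCoords))
  choose H hH c a b h using fun p => happ p (m / E) (by positivity)
  let e := (Fintype.equivFin (Σ p, H p)).symm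
  refine ⟨⟨Fintype.card (Σ p, H p), Matrix.of fun i => Sum.elim (a (e i).1 (e i).2)
    (fun _ => b (e i).1 (e i).2), Matrix.of fun p i => if (e i).1 = p then c (e i).1 (e i).2 else 0⟩,
    fun θ hθ => ?_⟩
  set P : ParamBlock d K := ⟨_, _, _⟩ with hP
  have hR : ‖toCoords θ‖ ≤ R := (pi_norm_le_iff_of_nonneg (norm_nonneg θ)).2
    (fun p => abs_toCoords_le θ p) |>.trans hθ
  set χ : Params d K := P.map θ - (1 - τ) • projW Bu Bw Bv θ with hχ
  have hmap : P.map θ = (1 - τ) • projW Bu Bw Bv θ + χ := by rw [hχ]; abel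
  have hχle : ∀ p, |toCoords χ p| ≤ m / E := by
    intro p
    have h1 := h p (toCoords θ) hR
    simp only [ofCoords_toCoords] at h1
    refine le_of_eq_of_le (congrArg _ ?_) h1
    rw [hχ, toCoords_sub, toCoords_smul]
    unfold ParamBlock.map
    rw [toCoords_ofCoords]
    simp only [Pi.sub_apply, Pi.add_apply, Pi.smul_apply, smul_eq_mul]
    have key : (P.P₂ *ᵥ fun h => relu ((P.P₁ *ᵥ Sum.elim (toCoords θ) fun _ => 1) h)) p
        = ∑ h, c p h * relu (∑ i, a p h i * toCoords θ i + b p h) := by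
      have e1 : (P.P₂ *ᵥ fun h => relu ((P.P₁ *ᵥ Sum.elim (toCoords θ) fun _ => 1) h)) p
          = ∑ s : Σ p, H p, (if s.1 = p then c s.1 s.2 else 0)
            * relu (∑ i, a s.1 s.2 i * toCoords θ i + b s.1 s.2) := by
        refine Fintype.sum_equiv e _ _ fun i => ?_
        have : (P.P₁ *ᵥ Sum.elim (toCoords θ) fun _ => 1) i
            = ∑ j, a (e i).1 (e i).2 j * toCoords θ j + b (e i).1 (e i).2 := by
          simp only [Matrix.mulVec, dotProduct, Fintype.sum_sum_type,
            Sum.elim_inl, Sum.elim_inr, Finset.univ_unique, Finset.sum_singleton, mul_one]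
          rfl
        exact congrArg (fun z => (if (e i).1 = p then c (e i).1 (e i).2 else 0) * relu z) this
      rw [e1, Fintype.sum_sigma, Finset.sum_eq_single p]
      · simp
      · intro q _ hq; simp [hq]
      · simp
    rw [key]
    ring
  have hνm : ∀ t : ℝ, 0 ≤ t → t ≤ E → t * (m / E) ≤ m := fun t _ ht =>
    (mul_le_mul_of_nonneg_right ht (by positivity)).trans_eq hEν
  have hd0 : (0 : ℝ) ≤ d := Nat.cast_nonneg _
  have hK0 : (0 : ℝ) ≤ K := Nat.cast_nonneg _
  have hKd0 : (0 : ℝ) ≤ K * d := by positivity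
  have hmin : ∀ {B x y : ℝ}, min Bu (min Bw Bv) ≤ B → x ≤ B → y ≤ m → (1 - τ) * x + y ≤ B := by
    intro B x y hB hx hy
    have h1 : m ≤ τ * B := (min_le_left _ _).trans (mul_le_mul_of_nonneg_left hB hτ0.le)
    nlinarith
  have hproj := projW_mem hBu.le hBw.le hBv.le θ
  refine ⟨?_, ?_⟩
  · rw [hmap]
    refine ⟨fun k => ?_, ?_, ?_⟩
    · have e : rowVec ((1 - τ) • projW Bu Bw Bv θ + χ).1 k
          = (1 - τ) • rowVec (projW Bu Bw Bv θ).1 k + rowVec χ.1 k := rfl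
      rw [e]
      refine (norm_add_le _ _).trans ?_
      rw [norm_smul, Real.norm_of_nonneg (by linarith)]
      refine hmin (min_le_left _ _) (hproj.1 k) ?_
      refine (norm_le_card_mul (b := m / E) fun i => hχle (Sum.inl (k, i))).trans ?_
      rw [Fintype.card_fin]
      exact hνm _ hd0 (by linarith)
    · refine (norm_add_le ((1 - τ) • (projW Bu Bw Bv θ).2.1) χ.2.1).trans ?_
      rw [norm_smul, Real.norm_of_nonneg (by linarith)]
      refine hmin ((min_le_right _ _).trans (min_le_left _ _)) hproj.2.1 ?_
      refine (norm_le_card_mul (b := m / E) fun i => hχle (Sum.inr (Sum.inl i))).trans ?_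
      rw [Fintype.card_fin]
      exact hνm _ hK0 (by linarith)
    · refine (norm_add_le ((1 - τ) • (projW Bu Bw Bv θ).2.2) χ.2.2).trans ?_
      rw [norm_smul, Real.norm_of_nonneg (by linarith)]
      refine hmin ((min_le_right _ _).trans (min_le_right _ _)) hproj.2.2 ?_
      refine (norm_le_card_mul (b := m / E) fun i => hχle (Sum.inr (Sum.inr i))).trans ?_
      rw [Fintype.card_fin]
      exact hνm _ hK0 (by linarith)
  · have e : P.map θ - projW Bu Bw Bv θ = χ - τ • projW Bu Bw Bv θ := by
      rw [hmap, sub_smul, one_smul]; abel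
    rw [e]
    refine (norm_sub_le _ _).trans ?_
    rw [norm_smul, Real.norm_of_nonneg hτ0.le]
    have h1 : ‖χ‖ ≤ _ := params_norm_le (by positivity) hχle
    have h2 := hνm (K * d + K) (by positivity) (by linarith)
    have h3 : m ≤ δ / 2 := min_le_right _ _
    have h4 : τ * ‖projW Bu Bw Bv θ‖ ≤ τ * W :=
      mul_le_mul_of_nonneg_left (norm_le_of_mem hBu.le hBw.le hBv.le hproj) hτ0.le
    linarith

end ParamFacts


/-! ### The gradient step in coordinates -/

/-- Since σ' = σ(1 - σ), the denominators from the logarithms cancel. -/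
lemma hasDerivAt_sigmoidCrossEntropy (z q : ℝ) :
    HasDerivAt (fun z => sigmoidCrossEntropy z q) (Real.sigmoid z - q) z := by
  have h0 := Real.sigmoid_pos z
  have h1 := Real.sigmoid_lt_one z
  have h := Real.hasDerivAt_sigmoid z
  have h2 := ((h.log h0.ne').const_mul (-q)).sub
    (((h.const_sub 1).log (by linarith : (1 : ℝ) - Real.sigmoid z ≠ 0)).const_mul (1 - q))
  refine h2.congr_deriv ?_
  have h3 : 1 - Real.sigmoid z ≠ 0 := by linarith
  field_simp
  ring

lemma gradient_apply_of_hasDerivAt {ι : Type} [Fintype ι] [DecidableEq ι]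
    {f : EuclideanSpace ℝ ι → ℝ} {x : EuclideanSpace ℝ ι} {i : ι} {f' : ℝ}
    (hf : DifferentiableAt ℝ f x)
    (h : HasDerivAt (fun t : ℝ => f (x + t • EuclideanSpace.single i (1 : ℝ))) f' 0) :
    gradient f x i = f' := by
  have h1 : gradient f x i = inner ℝ (gradient f x) (EuclideanSpace.single i (1 : ℝ)) := by
    rw [EuclideanSpace.inner_single_right]; simp
  rw [h1]
  unfold gradient
  rw [InnerProductSpace.toDual_symm_apply]
  have h2 : HasDerivAt (fun t : ℝ => x + t • EuclideanSpace.single i (1 : ℝ))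
      (EuclideanSpace.single i (1 : ℝ)) 0 := by
    simpa using ((hasDerivAt_id (0 : ℝ)).smul_const (EuclideanSpace.single i (1 : ℝ))).const_add x
  have h3 : HasFDerivAt f (fderiv ℝ f x) (x + (0 : ℝ) • EuclideanSpace.single i (1 : ℝ)) := by
    simpa using hf.hasFDerivAt
  exact (h3.comp_hasDerivAt (0 : ℝ) h2).unique h

section Gradient

variable {d K n n' : ℕ} {r : ℝ → ℝ}

/-- The inner product `u_kᵀ x`. -/
def preact (u : EuclideanSpace ℝ (Fin K × Fin d)) (x : EuclideanSpace ℝ (Fin d)) (k : Fin K) : ℝ :=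
  ∑ i, u (k, i) * x i

lemma net_eq (r : ℝ → ℝ) (u : EuclideanSpace ℝ (Fin K × Fin d)) (a : EuclideanSpace ℝ (Fin K))
    (x : EuclideanSpace ℝ (Fin d)) : net r u a x = ∑ k, a k * r (preact u x k) := rfl

/-- The factor of `σ(Λ) - y` in a gradient coordinate, up to `activation`. -/
def labelCoef (θ : Params d K) : ParamIdx d K → ℝ :=
  Sum.elim (fun p => θ.2.1 p.1) (Sum.elim (fun _ => 1) (fun _ => 0))

/-- The factor of the domain residual in a gradient coordinate, up to `activation`. -/
def domainCoef (lam : ℝ) (θ : Params d K) : ParamIdx d K → ℝ :=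
  Sum.elim (fun p => -lam * θ.2.2 p.1) (Sum.elim (fun _ => 0) (fun _ => lam))

/-- The factor of a gradient coordinate that depends on the hidden units. -/
def activation (r : ℝ → ℝ) (u : EuclideanSpace ℝ (Fin K × Fin d))
    (x : EuclideanSpace ℝ (Fin d)) : ParamIdx d K → ℝ :=
  Sum.elim (fun p => deriv r (preact u x p.1) * x p.2)
    (Sum.elim (fun k => r (preact u x k)) (fun k => r (preact u x k)))

/-- The contribution of a source point to a gradient coordinate. -/
def sourceTerm (n : ℕ) (r : ℝ → ℝ) (lam : ℝ) (θ : Params d K) (x : EuclideanSpace ℝ (Fin d))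
    (y : ℝ) (p : ParamIdx d K) : ℝ :=
  ((Real.sigmoid (net r θ.1 θ.2.1 x) - y) * labelCoef θ p
    + 1 / (n : ℝ) * Real.sigmoid (net r θ.1 θ.2.2 x) * domainCoef lam θ p) * activation r θ.1 x p

/-- The contribution of a target point to a gradient coordinate. -/
def targetTerm (n' : ℕ) (r : ℝ → ℝ) (lam : ℝ) (θ : Params d K) (x : EuclideanSpace ℝ (Fin d))
    (p : ParamIdx d K) : ℝ :=
  (1 / (n' : ℝ) * (Real.sigmoid (net r θ.1 θ.2.2 x) - 1) * domainCoef lam θ p)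
    * activation r θ.1 x p

/-- The formulation along curves serves inner and outer coordinate directions alike. -/
lemma hasDerivAt_labelLoss {D : Input d n n'} {U : ℝ → EuclideanSpace ℝ (Fin K × Fin d)}
    {A : ℝ → EuclideanSpace ℝ (Fin K)} {N' : EuclideanSpace ℝ (Fin d) → ℝ}
    (h : ∀ x, HasDerivAt (fun t => net r (U t) (A t) x) (N' x) 0) :
    HasDerivAt (fun t => labelLoss r D (U t) (A t))
      (∑ i, (Real.sigmoid (net r (U 0) (A 0) (D.xS i)) - D.yS i) * N' (D.xS i)) 0 := by
  unfold labelLoss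
  refine HasDerivAt.fun_sum fun i _ => ?_
  have h1 := (hasDerivAt_sigmoidCrossEntropy (net r (U 0) (A 0) (D.xS i)) (D.yS i)).comp (0 : ℝ)
    (h (D.xS i))
  exact h1

lemma hasDerivAt_domainLoss {D : Input d n n'} {U : ℝ → EuclideanSpace ℝ (Fin K × Fin d)}
    {A : ℝ → EuclideanSpace ℝ (Fin K)} {N' : EuclideanSpace ℝ (Fin d) → ℝ}
    (h : ∀ x, HasDerivAt (fun t => net r (U t) (A t) x) (N' x) 0) :
    HasDerivAt (fun t => domainLoss r D (U t) (A t))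
      (1 / (n : ℝ) * ∑ i, (Real.sigmoid (net r (U 0) (A 0) (D.xS i)) - 0) * N' (D.xS i)
        + 1 / (n' : ℝ) * ∑ i, (Real.sigmoid (net r (U 0) (A 0) (D.xT i)) - 1) * N' (D.xT i)) 0 := by
  unfold domainLoss
  exact ((HasDerivAt.fun_sum fun i _ =>
    (hasDerivAt_sigmoidCrossEntropy (net r (U 0) (A 0) (D.xS i)) 0).comp (0 : ℝ) (h _)).const_mul
      (1 / (n : ℝ))).add ((HasDerivAt.fun_sum fun i _ =>
    (hasDerivAt_sigmoidCrossEntropy (net r (U 0) (A 0) (D.xT i)) 1).comp (0 : ℝ) (h _)).const_mul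
      (1 / (n' : ℝ)))

lemma hasDerivAt_net_inner (hr : Differentiable ℝ r) (u : EuclideanSpace ℝ (Fin K × Fin d))
    (a : EuclideanSpace ℝ (Fin K)) (k : Fin K) (i : Fin d) (x : EuclideanSpace ℝ (Fin d)) :
    HasDerivAt (fun t : ℝ => net r (u + t • EuclideanSpace.single (k, i) (1 : ℝ)) a x)
      (a k * (deriv r (preact u x k) * x i)) 0 := by
  have hlin : ∀ (t : ℝ) k', preact (u + t • EuclideanSpace.single (k, i) (1 : ℝ)) x k'
      = preact u x k' + t * (if k' = k then x i else 0) := by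
    intro t k'
    unfold preact
    simp only [PiLp.add_apply, PiLp.smul_apply, PiLp.single_apply, smul_eq_mul, add_mul,
      Finset.sum_add_distrib, Prod.mk.injEq]
    congr 1
    split_ifs with h <;> simp [h]
  simp only [net_eq, hlin]
  have h : ∀ k' ∈ Finset.univ, HasDerivAt
      (fun t : ℝ => a k' * r (preact u x k' + t * (if k' = k then x i else 0)))
      (a k' * (deriv r (preact u x k') * (if k' = k then x i else 0))) 0 := by
    intro k' _
    refine HasDerivAt.const_mul _ ?_
    have h1 : HasDerivAt (fun t : ℝ => preact u x k' + t * (if k' = k then x i else 0))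
        (if k' = k then x i else 0) 0 := by
      simpa using ((hasDerivAt_id (0 : ℝ)).mul_const (if k' = k then x i else 0)).const_add
        (preact u x k')
    have h2 : HasDerivAt r (deriv r (preact u x k'))
        (preact u x k' + 0 * (if k' = k then x i else 0)) := by
      simpa using (hr (preact u x k')).hasDerivAt
    exact h2.comp (0 : ℝ) h1
  refine (HasDerivAt.fun_sum h).congr_deriv ?_
  rw [Finset.sum_eq_single k]
  · simp
  · intro b _ hb; simp [hb]
  · simp

lemma hasDerivAt_net_outer (r : ℝ → ℝ) (u : EuclideanSpace ℝ (Fin K × Fin d))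
    (a : EuclideanSpace ℝ (Fin K)) (k : Fin K) (x : EuclideanSpace ℝ (Fin d)) :
    HasDerivAt (fun t : ℝ => net r u (a + t • EuclideanSpace.single k (1 : ℝ)) x)
      (r (preact u x k)) 0 := by
  have hlin : ∀ t : ℝ, net r u (a + t • EuclideanSpace.single k (1 : ℝ)) x
      = net r u a x + t * r (preact u x k) := by
    intro t
    simp only [net_eq, PiLp.add_apply, PiLp.smul_apply, PiLp.single_apply, smul_eq_mul, add_mul,
      Finset.sum_add_distrib]
    simp
  simp only [hlin]
  simpa using ((hasDerivAt_id (0 : ℝ)).mul_const (r (preact u x k))).const_add (net r u a x)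

lemma differentiable_net (hr : Differentiable ℝ r) (x : EuclideanSpace ℝ (Fin d)) :
    Differentiable ℝ fun z : EuclideanSpace ℝ (Fin K × Fin d) × EuclideanSpace ℝ (Fin K) =>
      net r z.1 z.2 x := by
  simp only [net_eq, preact]
  fun_prop

lemma differentiable_sigmoidCrossEntropy (q : ℝ) :
    Differentiable ℝ fun z => sigmoidCrossEntropy z q :=
  fun z => (hasDerivAt_sigmoidCrossEntropy z q).differentiableAt

lemma differentiable_labelLoss (hr : Differentiable ℝ r) (D : Input d n n') :
    Differentiable ℝ fun z : EuclideanSpace ℝ (Fin K × Fin d) × EuclideanSpace ℝ (Fin K) =>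
      labelLoss r D z.1 z.2 := by
  unfold labelLoss
  exact Differentiable.fun_sum fun i _ =>
    (differentiable_sigmoidCrossEntropy _).comp (differentiable_net hr _)

lemma differentiable_domainLoss (hr : Differentiable ℝ r) (D : Input d n n') :
    Differentiable ℝ fun z : EuclideanSpace ℝ (Fin K × Fin d) × EuclideanSpace ℝ (Fin K) =>
      domainLoss r D z.1 z.2 := by
  unfold domainLoss
  refine Differentiable.add (Differentiable.const_mul ?_ _) (Differentiable.const_mul ?_ _) <;>
  exact Differentiable.fun_sum fun i _ =>
    (differentiable_sigmoidCrossEntropy _).comp (differentiable_net hr _)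

lemma differentiable_left {E G : Type} [NormedAddCommGroup E] [NormedSpace ℝ E]
    [NormedAddCommGroup G] [NormedSpace ℝ G] {f : E × G → ℝ} (hf : Differentiable ℝ f) (b : G) :
    Differentiable ℝ fun a => f (a, b) := by
  fun_prop

lemma differentiable_right {E G : Type} [NormedAddCommGroup E] [NormedSpace ℝ E]
    [NormedAddCommGroup G] [NormedSpace ℝ G] {f : E × G → ℝ} (hf : Differentiable ℝ f) (a : E) :
    Differentiable ℝ fun b => f (a, b) := by
  fun_prop

/-- One formula for the three blocks of coordinates: `domainCoef` carries -λ for u, where the domain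
loss is ascended, and λ for v. The product of residual, coefficient and activation is the shape that
an attention head can reproduce. -/
lemma toCoords_gradStep (hr : Differentiable ℝ r) (D : Input d n n') (lam η : ℝ)
    (θ : Params d K) (p : ParamIdx d K) :
    toCoords (gradStep r D lam η θ) p = toCoords θ p
      - η * (∑ i, sourceTerm n r lam θ (D.xS i) (D.yS i) p
          + ∑ i, targetTerm n' r lam θ (D.xT i) p) := by
  have hL := differentiable_labelLoss (K := K) hr D
  have hD := differentiable_domainLoss (K := K) hr D
  rcases p with ⟨k, i⟩ | k | k
  · change θ.1 (k, i) - η * gradient (fun u => labelLoss r D u θ.2.1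
      - lam * domainLoss r D u θ.2.2) θ.1 (k, i) = _
    have h1 : Differentiable ℝ fun u => labelLoss r D u θ.2.1 :=
      differentiable_left hL θ.2.1
    have h2 : Differentiable ℝ fun u => domainLoss r D u θ.2.2 :=
      differentiable_left hD θ.2.2
    rw [gradient_apply_of_hasDerivAt (h1.fun_sub (h2.const_mul lam)).differentiableAt
      ((hasDerivAt_labelLoss fun x => hasDerivAt_net_inner hr θ.1 θ.2.1 k i x).fun_sub
        ((hasDerivAt_domainLoss fun x => hasDerivAt_net_inner hr θ.1 θ.2.2 k i x).const_mul lam))]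
    simp only [zero_smul, add_zero, sourceTerm, targetTerm, labelCoef, domainCoef, activation,
      Sum.elim_inl, toCoords, sub_zero]
    congr 2
    rw [mul_add, Finset.mul_sum, Finset.mul_sum, Finset.mul_sum, Finset.mul_sum,
      sub_add_eq_sub_sub, ← Finset.sum_sub_distrib, sub_eq_add_neg, ← Finset.sum_neg_distrib]
    congr 1 <;> refine Finset.sum_congr rfl fun j _ => ?_ <;> ring
  · change θ.2.1 k - η * gradient (fun w => labelLoss r D θ.1 w) θ.2.1 k = _
    have h1 : Differentiable ℝ fun w => labelLoss r D θ.1 w :=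
      differentiable_right hL θ.1
    rw [gradient_apply_of_hasDerivAt h1.differentiableAt
      (hasDerivAt_labelLoss (U := fun _ => θ.1) fun x => hasDerivAt_net_outer r θ.1 θ.2.1 k x)]
    simp [sourceTerm, targetTerm, labelCoef, domainCoef, activation, toCoords]
  · change θ.2.2 k - (η * lam) * gradient (fun v => domainLoss r D θ.1 v) θ.2.2 k = _
    have h1 : Differentiable ℝ fun w => domainLoss r D θ.1 w :=
      differentiable_right hD θ.1
    rw [gradient_apply_of_hasDerivAt h1.differentiableAt
      (hasDerivAt_domainLoss (U := fun _ => θ.1) fun x => hasDerivAt_net_outer r θ.1 θ.2.2 k x)]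
    simp only [zero_smul, add_zero, sourceTerm, targetTerm, labelCoef, domainCoef, activation,
      Sum.elim_inr, toCoords, sub_zero, mul_zero, zero_add]
    rw [mul_assoc]
    congr 2
    rw [mul_add, Finset.mul_sum, Finset.mul_sum, Finset.mul_sum, Finset.mul_sum]
    congr 1 <;> refine Finset.sum_congr rfl fun j _ => ?_ <;> ring

/-! ### Bounds that are uniform in the data -/

/-- Compactness bounds `F` and its derivative on the product ball, and convexity gives the mean
value inequality. As `z` will be a data point, the constant is uniform in the data. -/
lemma exists_bound_lipschitz {E G : Type} [NormedAddCommGroup E] [NormedSpace ℝ E]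
    [FiniteDimensional ℝ E] [NormedAddCommGroup G] [NormedSpace ℝ G] [FiniteDimensional ℝ G]
    {F : E × G → ℝ} (hF : ContDiff ℝ 1 F) (R : ℝ) :
    ∃ C : ℝ, 0 ≤ C ∧ ∀ z, ‖z‖ ≤ R → ∀ θ, ‖θ‖ ≤ R → |F (θ, z)| ≤ C ∧
      ∀ θ', ‖θ'‖ ≤ R → |F (θ, z) - F (θ', z)| ≤ C * ‖θ - θ'‖ := by
  have : ProperSpace (E × G) := FiniteDimensional.proper ℝ (E × G)
  have hK := isCompact_closedBall (0 : E × G) R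
  obtain ⟨C₁, h₁⟩ := hK.exists_bound_of_continuousOn hF.continuous.continuousOn
  obtain ⟨C₂, h₂⟩ := hK.exists_bound_of_continuousOn
    (hF.continuous_fderiv (by norm_num)).continuousOn
  have hmem : ∀ z : G, ‖z‖ ≤ R → ∀ θ : E, ‖θ‖ ≤ R → (θ, z) ∈ Metric.closedBall (0 : E × G) R := by
    intro z hz θ hθ
    rw [mem_closedBall_zero_iff, Prod.norm_def]
    exact max_le hθ hz
  refine ⟨max 0 (max C₁ C₂), le_max_left _ _, fun z hz θ hθ => ⟨?_, fun θ' hθ' => ?_⟩⟩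
  · exact (h₁ _ (hmem z hz θ hθ)).trans ((le_max_left _ _).trans (le_max_right _ _))
  · have h := (convex_closedBall (0 : E × G) R).norm_image_sub_le_of_norm_fderiv_le (𝕜 := ℝ)
      (fun x _ => (hF.differentiable (by norm_num)) x) h₂ (hmem z hz θ' hθ') (hmem z hz θ hθ)
    have e : ‖(θ, z) - (θ', z)‖ = ‖θ - θ'‖ := by
      rw [Prod.mk_sub_mk, sub_self, Prod.norm_def]
      simp
    rw [e] at h
    exact h.trans (mul_le_mul_of_nonneg_right ((le_max_right _ _).trans (le_max_right _ _))
      (norm_nonneg _))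

lemma contDiff_net (hr : ContDiff ℝ 1 r) :
    ContDiff ℝ 1 fun z : (EuclideanSpace ℝ (Fin K × Fin d) × EuclideanSpace ℝ (Fin K))
      × EuclideanSpace ℝ (Fin d) => net r z.1.1 z.1.2 z.2 := by
  simp only [net_eq, preact]
  fun_prop

lemma contDiff_activation (hr : ContDiff ℝ 1 r) (hr' : ContDiff ℝ 1 (deriv r))
    (p : ParamIdx d K) :
    ContDiff ℝ 1 fun z : EuclideanSpace ℝ (Fin K × Fin d) × EuclideanSpace ℝ (Fin d) =>
      activation r z.1 z.2 p := by
  rcases p with p | p | p <;> simp only [activation, preact, Sum.elim_inl, Sum.elim_inr] <;>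
  fun_prop

lemma contDiff_labelCoef (p : ParamIdx d K) :
    ContDiff ℝ 1 fun θ : Params d K => labelCoef θ p := by
  rcases p with p | p | p <;> simp only [labelCoef, Sum.elim_inl, Sum.elim_inr] <;> fun_prop

lemma contDiff_domainCoef (lam : ℝ) (p : ParamIdx d K) :
    ContDiff ℝ 1 fun θ : Params d K => domainCoef lam θ p := by
  rcases p with p | p | p <;> simp only [domainCoef, Sum.elim_inl, Sum.elim_inr] <;> fun_prop

lemma contDiff_sigmoid_one : ContDiff ℝ 1 Real.sigmoid := contDiff_sigmoid.of_le (by simp)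

lemma contDiff_sourceTerm (n : ℕ) (hr : ContDiff ℝ 1 r) (hr' : ContDiff ℝ 1 (deriv r)) (lam : ℝ)
    (p : ParamIdx d K) :
    ContDiff ℝ 1 fun z : Params d K × (EuclideanSpace ℝ (Fin d) × ℝ) =>
      sourceTerm n r lam z.1 z.2.1 z.2.2 p := by
  unfold sourceTerm
  have h1 := contDiff_sigmoid_one.comp ((contDiff_net (d := d) (K := K) hr).comp (by fun_prop :
    ContDiff ℝ 1 fun z : Params d K × (EuclideanSpace ℝ (Fin d) × ℝ) =>
      ((z.1.1, z.1.2.1), z.2.1)))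
  have h2 := contDiff_sigmoid_one.comp ((contDiff_net (d := d) (K := K) hr).comp (by fun_prop :
    ContDiff ℝ 1 fun z : Params d K × (EuclideanSpace ℝ (Fin d) × ℝ) =>
      ((z.1.1, z.1.2.2), z.2.1)))
  have h3 := (contDiff_activation hr hr' p).comp (by fun_prop :
    ContDiff ℝ 1 fun z : Params d K × (EuclideanSpace ℝ (Fin d) × ℝ) => (z.1.1, z.2.1))
  have h4 := (contDiff_labelCoef p).comp (contDiff_fst :
    ContDiff ℝ 1 fun z : Params d K × (EuclideanSpace ℝ (Fin d) × ℝ) => z.1)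
  have h5 := (contDiff_domainCoef lam p).comp (contDiff_fst :
    ContDiff ℝ 1 fun z : Params d K × (EuclideanSpace ℝ (Fin d) × ℝ) => z.1)
  have h6 : ContDiff ℝ 1 fun z : Params d K × (EuclideanSpace ℝ (Fin d) × ℝ) => z.2.2 := by
    fun_prop
  exact (((h1.sub h6).mul h4).add ((contDiff_const.mul h2).mul h5)).mul h3

lemma contDiff_targetTerm (n' : ℕ) (hr : ContDiff ℝ 1 r) (hr' : ContDiff ℝ 1 (deriv r)) (lam : ℝ)
    (p : ParamIdx d K) :
    ContDiff ℝ 1 fun z : Params d K × EuclideanSpace ℝ (Fin d) =>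
      targetTerm n' r lam z.1 z.2 p := by
  unfold targetTerm
  have h2 := contDiff_sigmoid_one.comp ((contDiff_net (d := d) (K := K) hr).comp (by fun_prop :
    ContDiff ℝ 1 fun z : Params d K × EuclideanSpace ℝ (Fin d) => ((z.1.1, z.1.2.2), z.2)))
  have h3 := (contDiff_activation hr hr' p).comp (by fun_prop :
    ContDiff ℝ 1 fun z : Params d K × EuclideanSpace ℝ (Fin d) => (z.1.1, z.2))
  have h5 := (contDiff_domainCoef lam p).comp (contDiff_fst :
    ContDiff ℝ 1 fun z : Params d K × EuclideanSpace ℝ (Fin d) => z.1)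
  exact ((contDiff_const.mul (h2.sub contDiff_const)).mul h5).mul h3

variable {Bx By Bu Bw Bv : ℝ}

/-- On the parameter set the gradient step is bounded and Lipschitz, uniformly in the data. -/
lemma exists_gradStep_bound (hBu : 0 ≤ Bu) (hBw : 0 ≤ Bw) (hBv : 0 ≤ Bv)
    (hr : ContDiff ℝ 1 r) (hr' : ContDiff ℝ 1 (deriv r)) (n n' : ℕ) (lam η : ℝ) :
    ∃ C : ℝ, 0 ≤ C ∧ ∀ D : Input d n n', D.Bounded Bx By →
      ∀ θ ∈ paramSet (d := d) (K := K) Bu Bw Bv, ‖gradStep r D lam η θ‖ ≤ C ∧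
        ∀ θ' ∈ paramSet Bu Bw Bv,
          ‖gradStep r D lam η θ - gradStep r D lam η θ'‖ ≤ C * ‖θ - θ'‖ := by
  have hrd : Differentiable ℝ r := hr.differentiable (by norm_num)
  set W : ℝ := (K * d + K) * (Bu + Bw + Bv) with hW
  set R : ℝ := max W (max Bx By) with hR
  have hRW : W ≤ R := le_max_left _ _
  have hRx : Bx ≤ R := (le_max_left _ _).trans (le_max_right _ _)
  have hRy : By ≤ R := (le_max_right _ _).trans (le_max_right _ _)
  choose C₁ hC₁ h₁ using fun p => exists_bound_lipschitz
    (contDiff_sourceTerm (d := d) (K := K) n hr hr' lam p) R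
  choose C₂ hC₂ h₂ using fun p => exists_bound_lipschitz
    (contDiff_targetTerm (d := d) (K := K) n' hr hr' lam p) R
  set S : ℝ := ∑ p, (C₁ p + C₂ p) with hS
  have hS1 : ∀ p, C₁ p + C₂ p ≤ S := fun p =>
    Finset.single_le_sum (f := fun p => C₁ p + C₂ p) (fun q _ => add_nonneg (hC₁ q) (hC₂ q))
      (Finset.mem_univ p)
  have hS0 : 0 ≤ S := Finset.sum_nonneg fun q _ => add_nonneg (hC₁ q) (hC₂ q)
  set N : ℝ := n + n' with hN
  have hN0 : 0 ≤ N := by positivity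
  set T : ℝ := W + 1 + |η| * (N * S) with hT
  have hW0 : 0 ≤ W := by positivity
  have hT0 : 0 ≤ T := by positivity
  -- Used with t = 1 for the bound and with t = ‖θ - θ'‖ for the Lipschitz estimate.
  have hsum : ∀ (a : Fin n → ℝ) (b : Fin n' → ℝ) (p : ParamIdx d K) (t : ℝ), 0 ≤ t →
      (∀ i, |a i| ≤ C₁ p * t) → (∀ i, |b i| ≤ C₂ p * t) →
      |∑ i, a i + ∑ i, b i| ≤ N * S * t := by
    intro a b p t ht ha hb
    have ha' : |∑ i, a i| ≤ n * (S * t) := by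
      refine (Finset.abs_sum_le_sum_abs _ _).trans ((Finset.sum_le_sum fun i _ =>
        (ha i).trans (mul_le_mul_of_nonneg_right (b := C₁ p) (c := S) ?_ ht)).trans ?_)
      · linarith [hS1 p, hC₂ p]
      · simp
    have hb' : |∑ i, b i| ≤ n' * (S * t) := by
      refine (Finset.abs_sum_le_sum_abs _ _).trans ((Finset.sum_le_sum fun i _ =>
        (hb i).trans (mul_le_mul_of_nonneg_right (b := C₂ p) (c := S) ?_ ht)).trans ?_)
      · linarith [hS1 p, hC₁ p]
      · simp
    refine (abs_add_le _ _).trans ((add_le_add ha' hb').trans_eq ?_)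
    rw [hN]; ring
  refine ⟨(K * d + K) * T, by positivity, fun D hD θ hθ => ⟨?_, fun θ' hθ' => ?_⟩⟩
  · refine params_norm_le hT0 fun p => ?_
    have hθn := norm_le_of_mem hBu hBw hBv hθ
    rw [toCoords_gradStep hrd]
    refine (abs_sub _ _).trans ?_
    have h3 := hsum (fun i => sourceTerm n r lam θ (D.xS i) (D.yS i) p)
      (fun i => targetTerm n' r lam θ (D.xT i) p) p 1 zero_le_one
      (fun i => by
        rw [mul_one]
        exact (h₁ p (D.xS i, D.yS i) (max_le ((hD.1 i).trans hRx) ((hD.2.1 i).trans hRy)) θ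
          (hθn.trans hRW)).1)
      (fun i => by
        rw [mul_one]
        exact (h₂ p (D.xT i) ((hD.2.2.1 i).trans hRx) θ (hθn.trans hRW)).1)
    have h4 := (abs_toCoords_le θ p).trans hθn
    rw [abs_mul]
    have h5 := mul_le_mul_of_nonneg_left h3 (abs_nonneg η)
    rw [mul_one] at h5
    linarith
  · rw [mul_assoc]
    refine params_norm_le (by positivity) fun p => ?_
    have hθn := norm_le_of_mem hBu hBw hBv hθ
    have hθn' := norm_le_of_mem hBu hBw hBv hθ'
    have h3 := hsum
      (fun i => sourceTerm n r lam θ (D.xS i) (D.yS i) p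
        - sourceTerm n r lam θ' (D.xS i) (D.yS i) p)
      (fun i => targetTerm n' r lam θ (D.xT i) p - targetTerm n' r lam θ' (D.xT i) p) p
      ‖θ - θ'‖ (norm_nonneg _)
      (fun i => (h₁ p (D.xS i, D.yS i) (max_le ((hD.1 i).trans hRx) ((hD.2.1 i).trans hRy)) θ
          (hθn.trans hRW)).2 θ' (hθn'.trans hRW))
      (fun i => (h₂ p (D.xT i) ((hD.2.2.1 i).trans hRx) θ (hθn.trans hRW)).2 θ' (hθn'.trans hRW))
    rw [Finset.sum_sub_distrib, Finset.sum_sub_distrib] at h3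
    have h4 := abs_toCoords_le (θ - θ') p
    rw [toCoords_sub, Pi.sub_apply] at h4 ⊢
    rw [toCoords_gradStep hrd, toCoords_gradStep hrd, sub_sub_sub_comm, ← mul_sub,
      add_sub_add_comm]
    refine (abs_sub _ _).trans ?_
    rw [abs_mul]
    have h5 := mul_le_mul_of_nonneg_left h3 (abs_nonneg η)
    have h6 := mul_nonneg hW0 (norm_nonneg (θ - θ'))
    rw [hT]
    nlinarith

/-- On the parameter set the label network is Lipschitz in the parameters. -/
lemma exists_net_lipschitz (hBu : 0 ≤ Bu) (hBw : 0 ≤ Bw) (hBv : 0 ≤ Bv) (hr : ContDiff ℝ 1 r) :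
    ∃ C : ℝ, 0 ≤ C ∧ ∀ x : EuclideanSpace ℝ (Fin d), ‖x‖ ≤ Bx →
      ∀ θ ∈ paramSet (d := d) (K := K) Bu Bw Bv, ∀ θ' ∈ paramSet Bu Bw Bv,
        |net r θ.1 θ.2.1 x - net r θ'.1 θ'.2.1 x| ≤ C * ‖θ - θ'‖ := by
  obtain ⟨C, hC, h⟩ := exists_bound_lipschitz (E := Params d K)
    ((contDiff_net (d := d) (K := K) hr).comp (by fun_prop :
      ContDiff ℝ 1 fun z : Params d K × EuclideanSpace ℝ (Fin d) => ((z.1.1, z.1.2.1), z.2)))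
    (max ((K * d + K) * (Bu + Bw + Bv)) Bx)
  exact ⟨C, hC, fun x hx θ hθ θ' hθ' => (h x (hx.trans (le_max_right _ _)) θ
    ((norm_le_of_mem hBu hBw hBv hθ).trans (le_max_left _ _))).2 θ'
    ((norm_le_of_mem hBu hBw hBv hθ').trans (le_max_left _ _))⟩

end Gradient


/-! ### Intermediate states of the transformer -/

section States

variable {d K n n' M : ℕ}

/-- Spare coordinates: two logits and two residuals, the activations of the hidden units and
of their derivatives, and the products of the latter with the coordinates of the point. -/
abbrev Spare (d K : ℕ) : Type := Fin 4 ⊕ ((Fin K ⊕ Fin K) ⊕ (Fin K × Fin d))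

/-- The number of spare coordinates. -/
abbrev spareCard (d K : ℕ) : ℕ := Fintype.card (Spare d K)

/-- The index of a spare coordinate of a token. -/
def spareRow (s : Spare d K) : Row d K (spareCard d K) :=
  Sum.inr (Sum.inr (Fintype.equivFin (Spare d K) s))

/-- The index of the constant coordinate of a token. -/
abbrev oneRow {F : ℕ} : Row d K F := Sum.inl (Sum.inr 3)

lemma spareRow_injective : Function.Injective (spareRow (d := d) (K := K)) := fun _ _ h =>
  (Fintype.equivFin (Spare d K)).injective (Sum.inr.inj (Sum.inr.inj h))

lemma spareRow_eq_iff {s t : Spare d K} : spareRow s = spareRow t ↔ s = t :=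
  spareRow_injective.eq_iff

lemma exists_row (a : Row d K (spareCard d K)) :
    (∃ z, a = Sum.inl z) ∨ (∃ p, a = paramRow p) ∨ ∃ s, a = spareRow s := by
  rcases a with z | p | f
  · exact Or.inl ⟨z, rfl⟩
  · exact Or.inr (Or.inl ⟨p, rfl⟩)
  · exact Or.inr (Or.inr ⟨(Fintype.equivFin (Spare d K)).symm f, by simp [spareRow]⟩)

/-- The point at a token position. -/
def point (D : Input d n n') : Col n n' → EuclideanSpace ℝ (Fin d)
  | Sum.inl i => D.xS i
  | Sum.inr (Sum.inl i) => D.xT i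
  | Sum.inr (Sum.inr _) => D.xq

lemma zPart_inl (D : Input d n n') (j : Col n n') (a : Fin d) :
    zPart D j (Sum.inl a) = point D j a := by
  rcases j with j | j | j <;> rfl

lemma zPart_one (D : Input d n n') (j : Col n n') : zPart D j (Sum.inr 3) = 1 := by
  rcases j with j | j | j <;> rfl

/-- The tokens with parameter coordinates `c` and spare coordinates `s`. -/
def state (D : Input d n n') (c : ParamIdx d K → ℝ) (s : Col n n' → Spare d K → ℝ) :
    Matrix (Row d K (spareCard d K)) (Col n n') ℝ :=
  Matrix.of fun a j => Sum.elim (zPart D j)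
    (Sum.elim c (fun f => s j ((Fintype.equivFin (Spare d K)).symm f))) a

lemma tokens_eq_state (D : Input d n n') (θ : Params d K) :
    tokens (spareCard d K) D θ = state D (toCoords θ) 0 := rfl

section Entries

variable (D : Input d n n') (c : ParamIdx d K → ℝ) (s : Col n n' → Spare d K → ℝ) (j : Col n n')

@[simp] lemma state_inl (z) : state D c s (Sum.inl z) j = zPart D j z := rfl

@[simp] lemma state_paramRow (p) : state D c s (paramRow p) j = c p := rfl

@[simp] lemma state_spareRow (t) : state D c s (spareRow t) j = s j t := by
  simp [state, spareRow]

@[simp] lemma spareRow_ne_inl (t : Spare d K) (z) : ¬ spareRow t = Sum.inl z := by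
  simp [spareRow]

@[simp] lemma spareRow_ne_paramRow (t : Spare d K) (p) : ¬ spareRow t = paramRow p := by
  simp [spareRow, paramRow]

@[simp] lemma paramRow_ne_inl {F : ℕ} (p : ParamIdx d K) (z) :
    ¬ (paramRow p : Row d K F) = Sum.inl z := by
  simp [paramRow]

@[simp] lemma paramRow_ne_spareRow (t : Spare d K) (p) : ¬ paramRow p = spareRow t := by
  simp [spareRow, paramRow]

lemma paramRow_eq_iff {F : ℕ} {p q : ParamIdx d K} :
    (paramRow p : Row d K F) = paramRow q ↔ p = q := by
  simp [paramRow]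

end Entries

/-- The weights and biases of a sum of rectified linear units of slope one. -/
structure ReluNet (M : ℕ) where
  c : Fin M → ℝ
  b : Fin M → ℝ

/-- The function that a `ReluNet` computes. -/
def ReluNet.eval (f : ReluNet M) : ℝ → ℝ := reluSum f.c f.b

/-- A layer whose heads evaluate rectified linear units at the products `u_kᵀ x`. -/
def preactLayer {H H' : Type} [Fintype H] [Fintype H'] (v : H → ℝ)
    (out inp : H → Row d K (spareCard d K)) (k : H → Fin K) (b : H → ℝ)
    (W₁ : Matrix H' (Row d K (spareCard d K)) ℝ) (W₂ : Matrix (Row d K (spareCard d K)) H' ℝ) :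
    TFLayer (Row d K (spareCard d K)) :=
  mkLayer (T := Option (Fin d)) v out inp (fun h t => t.elim (b h) (fun _ => 1))
    (fun _ t => t.elim oneRow (fun a => Sum.inl (Sum.inl a)))
    (fun h t => t.elim oneRow (fun a => paramRow (Sum.inl (k h, a)))) W₁ W₂

/-- The point is read at column `j`, but u_k and the value at column `i` are the same for all `i`.
The sum over `i` thus has equal terms and cancels the normalization. -/
lemma preactLayer_attn_apply {H H' : Type} [Fintype H] [Fintype H'] (v : H → ℝ)
    (out inp : H → Row d K (spareCard d K)) (k : H → Fin K) (b : H → ℝ)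
    (W₁ : Matrix H' (Row d K (spareCard d K)) ℝ) (W₂ : Matrix (Row d K (spareCard d K)) H' ℝ)
    (D : Input d n n') (θ : Params d K) (s : Col n n' → Spare d K → ℝ) (g : H → ℝ)
    (hg : ∀ h i, state D (toCoords θ) s (inp h) i = g h) (a : Row d K (spareCard d K))
    (j : Col n n') :
    (preactLayer v out inp k b W₁ W₂).attn (state D (toCoords θ) s) a j
      = state D (toCoords θ) s a j + ∑ h, if out h = a then
          v h * (g h * relu (preact θ.1 (point D j) (k h) + b h)) else 0 := by
  unfold preactLayer
  rw [mkLayer_attn_apply, Finset.mul_sum]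
  congr 1
  refine Finset.sum_congr rfl fun h _ => ?_
  split_ifs
  · have e : ∀ i, (∑ t : Option (Fin d), t.elim (b h) (fun _ => 1)
        * state D (toCoords θ) s (t.elim oneRow (fun a => Sum.inl (Sum.inl a))) j
        * state D (toCoords θ) s (t.elim oneRow (fun a => paramRow (Sum.inl (k h, a)))) i)
        = preact θ.1 (point D j) (k h) + b h := by
      intro i
      rw [Fintype.sum_option]
      simp only [Option.elim, state_inl, state_paramRow, zPart_one, zPart_inl, one_mul, mul_one]
      rw [add_comm]
      congr 1
      exact Finset.sum_congr rfl fun a _ => mul_comm _ _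
    simp only [e, hg]
    rw [Finset.sum_const, Finset.card_univ, nsmul_eq_mul]
    have hc : (Fintype.card (Col n n') : ℝ) ≠ 0 := by
      have : Nonempty (Col n n') := ⟨Sum.inr (Sum.inr ())⟩
      exact_mod_cast Fintype.card_ne_zero
    field_simp
  · simp

/-! ### The first layer of an update -/

variable (ρ ρ' ς ς' sq : ReluNet M)

/-- The approximate activations of the hidden units. -/
def actHat (θ : Params d K) (x : EuclideanSpace ℝ (Fin d)) (k : Fin K) : ℝ :=
  ρ.eval (preact θ.1 x k)

/-- The approximate output of the network with outer weights `a`. -/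
def netHat (θ : Params d K) (a : EuclideanSpace ℝ (Fin K)) (x : EuclideanSpace ℝ (Fin d)) : ℝ :=
  ∑ k, a k * actHat ρ θ x k

/-- The spare coordinates after the first attention block. -/
def spareAttn (D : Input d n n') (θ : Params d K) (j : Col n n') : Spare d K → ℝ :=
  Sum.elim ![netHat ρ θ θ.2.1 (point D j), netHat ρ θ θ.2.2 (point D j), 0, 0]
    (Sum.elim (Sum.elim (actHat ρ θ (point D j)) (actHat ρ' θ (point D j))) 0)

/-- The layer that computes the logits, the activations and the residuals. -/
def evalLayer {H' : Type} [Fintype H'] (W₁ : Matrix H' (Row d K (spareCard d K)) ℝ)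
    (W₂ : Matrix (Row d K (spareCard d K)) H' ℝ) : TFLayer (Row d K (spareCard d K)) :=
  preactLayer (H := Fin 4 × Fin K × Fin M)
    (fun h => ![ρ.c h.2.2, ρ.c h.2.2, ρ.c h.2.2, ρ'.c h.2.2] h.1)
    (fun h => ![spareRow (Sum.inl 0), spareRow (Sum.inl 1), spareRow (Sum.inr (Sum.inl (Sum.inl h.2.1))),
      spareRow (Sum.inr (Sum.inl (Sum.inr h.2.1)))] h.1)
    (fun h => ![paramRow (Sum.inr (Sum.inl h.2.1)), paramRow (Sum.inr (Sum.inr h.2.1)),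
      oneRow, oneRow] h.1)
    (fun h => h.2.1)
    (fun h => ![ρ.b h.2.2, ρ.b h.2.2, ρ.b h.2.2, ρ'.b h.2.2] h.1) W₁ W₂

/-- The four families of heads yield the two logits (with values w_k and v_k) and the activations r
and r' (with the constant coordinate as value). -/
lemma evalLayer_attn {H' : Type} [Fintype H'] (W₁ : Matrix H' (Row d K (spareCard d K)) ℝ)
    (W₂ : Matrix (Row d K (spareCard d K)) H' ℝ) (D : Input d n n') (θ : Params d K) :
    (evalLayer ρ ρ' W₁ W₂).attn (state D (toCoords θ) 0)
      = state D (toCoords θ) (spareAttn ρ ρ' D θ) := by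
  ext a j
  unfold evalLayer
  rw [preactLayer_attn_apply (g := fun h => ![θ.2.1 h.2.1, θ.2.2 h.2.1, 1, 1] h.1)]
  · rw [Fintype.sum_prod_type, Fin.sum_univ_four]
    rcases exists_row a with ⟨z, rfl⟩ | ⟨p, rfl⟩ | ⟨s, rfl⟩
    · simp
    · simp
    · rcases s with s | (s | s) | s
      · fin_cases s <;>
        simp [spareRow_eq_iff, spareAttn, netHat, actHat, ReluNet.eval, reluSum,
          Fintype.sum_prod_type, Finset.mul_sum, mul_left_comm]
      · simp [spareRow_eq_iff, spareAttn, netHat, actHat, ReluNet.eval, reluSum,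
          Fintype.sum_prod_type, Finset.sum_ite_irrel]
      · simp [spareRow_eq_iff, spareAttn, netHat, actHat, ReluNet.eval, reluSum,
          Fintype.sum_prod_type, Finset.sum_ite_irrel]
      · simp [spareRow_eq_iff, spareAttn]
  · rintro ⟨τ, k, m⟩ i
    fin_cases τ <;> simp [zPart_one, toCoords]

/-- A `ReluNet` whose units are switched off where the mask `μ` is `-1`. -/
def maskEval (f : ReluNet M) (B z μ : ℝ) : ℝ := ∑ m, f.c m * relu (z + B * μ + f.b m)

/-- The hidden units of the first layer of an update. -/
abbrev ResIdx (d K M : ℕ) : Type :=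
  (Fin 3 × Fin M) ⊕ (Fin 2 ⊕ (Fin 2 × (Fin K × Fin d) × Fin M))

/-- The weights of the hidden units of the first layer. -/
def resC (n n' : ℕ) : ResIdx d K M → ℝ :=
  Sum.elim (fun h => ![ς.c h.2, 1 / n * ς.c h.2, 1 / n' * ς'.c h.2] h.1)
    (Sum.elim ![-1, 1] fun h => ![1 / 4 * sq.c h.2.2, -(1 / 4) * sq.c h.2.2] h.1)

/-- The targets of the hidden units of the first layer. -/
def resOut : ResIdx d K M → Row d K (spareCard d K) :=
  Sum.elim (fun h => ![spareRow (Sum.inl 2), spareRow (Sum.inl 3), spareRow (Sum.inl 3)] h.1)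
    (Sum.elim (fun _ => spareRow (Sum.inl 2)) fun h => spareRow (Sum.inr (Sum.inr h.2.1)))

/-- The coefficients of the hidden units of the first layer. -/
def resCoef (B : ℝ) : ResIdx d K M → Fin 4 → ℝ :=
  Sum.elim (fun h => ![![1, B, 0, ς.b h.2 - B] , ![1, B, 0, ς.b h.2 - B],
      ![1, -B, B, ς'.b h.2 - B]] h.1)
    (Sum.elim ![![1, 0, 0, 0], ![-1, 0, 0, 0]]
      fun h => ![![1, 1, sq.b h.2.2, 0], ![1, -1, sq.b h.2.2, 0]] h.1)

/-- The coordinates that the hidden units of the first layer read. -/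
def resInp : ResIdx d K M → Fin 4 → Row d K (spareCard d K) :=
  Sum.elim (fun h => ![![spareRow (Sum.inl 0), Sum.inl (Sum.inr 1), Sum.inl (Sum.inr 2), oneRow],
      ![spareRow (Sum.inl 1), Sum.inl (Sum.inr 1), Sum.inl (Sum.inr 2), oneRow],
      ![spareRow (Sum.inl 1), Sum.inl (Sum.inr 1), Sum.inl (Sum.inr 2), oneRow]] h.1)
    (Sum.elim (fun _ _ => yRow)
      fun h => ![spareRow (Sum.inr (Sum.inl (Sum.inr h.2.1.1))), Sum.inl (Sum.inl h.2.1.2),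
        oneRow, oneRow])

/-- The approximate label residual of a token. -/
def labelRes (B : ℝ) (D : Input d n n') (θ : Params d K) (j : Col n n') : ℝ :=
  maskEval ς B (netHat ρ θ θ.2.1 (point D j)) (zPart D j (Sum.inr 1) - 1) - zPart D j (Sum.inr 0)

/-- The approximate weighted domain residual of a token. -/
def domainRes (B : ℝ) (D : Input d n n') (θ : Params d K) (j : Col n n') : ℝ :=
  1 / (n : ℝ) * maskEval ς B (netHat ρ θ θ.2.2 (point D j)) (zPart D j (Sum.inr 1) - 1)
    + 1 / (n' : ℝ) * maskEval ς' B (netHat ρ θ θ.2.2 (point D j))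
      (zPart D j (Sum.inr 2) - zPart D j (Sum.inr 1) - 1)

/-- The approximate product of the derivative of a hidden unit with a coordinate. -/
def prodHat (θ : Params d K) (x : EuclideanSpace ℝ (Fin d)) (p : Fin K × Fin d) : ℝ :=
  1 / 4 * (sq.eval (actHat ρ' θ x p.1 + x p.2) - sq.eval (actHat ρ' θ x p.1 - x p.2))

/-- The spare coordinates after the first layer. -/
def spareRes (B : ℝ) (D : Input d n n') (θ : Params d K) (j : Col n n') : Spare d K → ℝ :=
  Sum.elim ![netHat ρ θ θ.2.1 (point D j), netHat ρ θ θ.2.2 (point D j),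
      labelRes ρ ς B D θ j, domainRes ρ ς ς' B D θ j]
    (Sum.elim (Sum.elim (actHat ρ θ (point D j)) (actHat ρ' θ (point D j)))
      (prodHat ρ' sq θ (point D j)))

/-- The first layer of an update. -/
def firstLayer (n n' : ℕ) (B : ℝ) : TFLayer (Row d K (spareCard d K)) :=
  evalLayer ρ ρ' (neuronIn (resC ς ς' sq n n') (resCoef ς ς' sq B) resInp)
    (neuronOut (resC ς ς' sq n n') resOut)

/-- The masks t - 1 and s - t - 1 are 0 on source and on target tokens respectively, and -1 on all
others; they are affine in the token, so B times a mask fits inside a hidden unit. The label is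
subtracted as -ReLU(y) + ReLU(-y), and products come from ab = ((a + b)² - (a - b)²)/4. -/
lemma neuron_res_apply (B : ℝ) (D : Input d n n') (θ : Params d K) (a : Row d K (spareCard d K))
    (j : Col n n') :
    (∑ h : ResIdx d K M, if resOut h = a then resC ς ς' sq n n' h * relu (∑ t,
        resCoef ς ς' sq B h t * state D (toCoords θ) (spareAttn ρ ρ' D θ) (resInp h t) j) else 0)
      = state D (toCoords θ) (spareRes ρ ρ' ς ς' sq B D θ) a j
        - state D (toCoords θ) (spareAttn ρ ρ' D θ) a j := by
  simp only [Fintype.sum_sum_type, resOut, resC, resCoef, resInp, Sum.elim_inl, Sum.elim_inr,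
    Fintype.sum_prod_type (α₁ := Fin 3), Fintype.sum_prod_type (α₁ := Fin 2), Fin.sum_univ_three,
    Fin.sum_univ_two, Fin.sum_univ_four]
  rcases exists_row a with ⟨z, rfl⟩ | ⟨p, rfl⟩ | ⟨s, rfl⟩
  · simp
  · simp
  · rcases s with s | (s | s) | s
    · fin_cases s
      · simp [spareRow_eq_iff, spareAttn, spareRes]
      · simp [spareRow_eq_iff, spareAttn, spareRes]
      · have e := relu_sub_relu_neg (zPart D j (Sum.inr 0))
        simp [spareRow_eq_iff, spareAttn, spareRes, labelRes, maskEval, yRow, zPart_one]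
        have e' : ∀ m, netHat ρ θ θ.2.1 (point D j) + B * zPart D j (Sum.inr 1) + (ς.b m - B)
            = netHat ρ θ θ.2.1 (point D j) + B * (zPart D j (Sum.inr 1) - 1) + ς.b m := by
          intro m; ring
        simp only [e']
        linarith
      · simp [spareRow_eq_iff, spareAttn, spareRes, domainRes, maskEval, zPart_one, Finset.mul_sum]
        congr 1 <;> refine Finset.sum_congr rfl fun m _ => ?_ <;> rw [mul_assoc] <;> congr 3 <;>
          ring
    · simp [spareRow_eq_iff, spareAttn, spareRes]
    · simp [spareRow_eq_iff, spareAttn, spareRes]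
    · simp [spareRow_eq_iff, spareAttn, spareRes, prodHat, ReluNet.eval, reluSum,
        Fintype.sum_prod_type, zPart_one, zPart_inl]
      simp only [mul_assoc, ← Finset.mul_sum, ← sub_eq_add_neg]
      ring

lemma firstLayer_apply (B : ℝ) (D : Input d n n') (θ : Params d K) :
    (firstLayer ρ ρ' ς ς' sq n n' B).apply (state D (toCoords θ) 0)
      = state D (toCoords θ) (spareRes ρ ρ' ς ς' sq B D θ) := by
  unfold firstLayer TFLayer.apply
  rw [evalLayer_attn]
  unfold evalLayer preactLayer
  rw [mkLayer_mlp]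
  ext a j
  rw [Matrix.add_apply, neuron_apply, neuron_res_apply]
  ring

/-! ### The second layer of an update -/

/-- The spare coordinate that holds the factor `activation` of a gradient coordinate. -/
def actRow : ParamIdx d K → Spare d K :=
  Sum.elim (fun p => Sum.inr (Sum.inr p)) (Sum.elim (fun k => Sum.inr (Sum.inl (Sum.inl k)))
    (fun k => Sum.inr (Sum.inl (Sum.inl k))))

/-- The coefficients of the rows that hold `labelCoef` and `domainCoef`. -/
def gradCoef (lam : ℝ) : ParamIdx d K → Fin 2 → ℝ :=
  Sum.elim (fun _ => ![1, -lam]) (Sum.elim (fun _ => ![1, 0]) (fun _ => ![0, lam]))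

/-- The rows that hold `labelCoef` and `domainCoef`. -/
def gradRow : ParamIdx d K → Fin 2 → Row d K (spareCard d K) :=
  Sum.elim (fun p => ![paramRow (Sum.inr (Sum.inl p.1)), paramRow (Sum.inr (Sum.inr p.1))])
    (Sum.elim (fun _ => ![oneRow, oneRow]) (fun _ => ![oneRow, oneRow]))

/-- The coordinates that the projection block reads. -/
def blockRow : ParamIdx d K ⊕ Unit → Row d K (spareCard d K) :=
  Sum.elim paramRow (fun _ => oneRow)

/-- The first weight matrix of the block that projects and clears the spare coordinates. -/
def projIn (P : ParamBlock d K) :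
    Matrix (Fin P.width ⊕ (Fin 2 × Spare d K)) (Row d K (spareCard d K)) ℝ :=
  Matrix.fromRows (P.P₁ * selMatrix (blockRow (d := d) (K := K)))
    (neuronIn (T := Unit) (fun h => ![-1, 1] h.1) (fun h _ => ![1, -1] h.1)
      (fun h _ => spareRow h.2))

/-- The second weight matrix of the block that projects and clears the spare coordinates. -/
def projOut (P : ParamBlock d K) :
    Matrix (Row d K (spareCard d K)) (Fin P.width ⊕ (Fin 2 × Spare d K)) ℝ :=
  Matrix.fromCols ((selMatrix (paramRow (d := d) (K := K) (F := spareCard d K)))ᵀ * P.P₂)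
    (neuronOut (fun h => ![-1, 1] h.1) (fun h => spareRow h.2))

/-- The second layer of an update. -/
def secondLayer (n n' : ℕ) (lam η : ℝ) (P : ParamBlock d K) :
    TFLayer (Row d K (spareCard d K)) :=
  mkLayer (H := Fin 2 × ParamIdx d K) (T := Fin 2)
    (fun h => ![-1, 1] h.1 * (η * Fintype.card (Col n n'))) (fun h => paramRow h.2)
    (fun h => spareRow (actRow h.2)) (fun h t => ![1, -1] h.1 * gradCoef lam h.2 t)
    (fun h t => gradRow h.2 t) (fun _ t => ![spareRow (Sum.inl 2), spareRow (Sum.inl 3)] t)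
    (projIn P) (projOut P)

/-- All gradient coefficients are multiples of a single token coordinate: w_k or v_k for u, the
constant coordinate for w and v. -/
lemma gradCoef_mul_state (D : Input d n n') (θ : Params d K) (s : Col n n' → Spare d K → ℝ)
    (lam : ℝ) (p : ParamIdx d K) (j : Col n n') :
    gradCoef lam p 0 * state D (toCoords θ) s (gradRow p 0) j = labelCoef θ p ∧
    gradCoef lam p 1 * state D (toCoords θ) s (gradRow p 1) j = domainCoef lam θ p := by
  rcases p with p | p | p <;>
    simp [gradCoef, gradRow, labelCoef, domainCoef, toCoords, zPart_one]

/-- The parameter coordinates before the projection. -/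
def stepCoords (lam η : ℝ) (θ : Params d K) (s : Col n n' → Spare d K → ℝ) (p : ParamIdx d K) :
    ℝ :=
  toCoords θ p - η * ∑ i, (s i (Sum.inl 2) * labelCoef θ p
    + s i (Sum.inl 3) * domainCoef lam θ p) * s i (actRow p)

/-- The two heads of a coordinate have opposite scores and opposite values, and ReLU(a) - ReLU(-a) =
a makes the attention linear in the score. The factor N + 1 in the value matrices undoes the
averaging. -/
lemma secondLayer_attn (lam η : ℝ) (P : ParamBlock d K) (D : Input d n n') (θ : Params d K)
    (s : Col n n' → Spare d K → ℝ) :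
    (secondLayer n n' lam η P).attn (state D (toCoords θ) s)
      = state D (stepCoords lam η θ s) s := by
  ext a j
  unfold secondLayer
  have hc : (Fintype.card (Col n n') : ℝ) ≠ 0 := by
    have : Nonempty (Col n n') := ⟨Sum.inr (Sum.inr ())⟩
    exact_mod_cast Fintype.card_ne_zero
  have e : ∀ (β : ℝ) (p : ParamIdx d K) (i : Col n n'),
      ∑ t : Fin 2, β * gradCoef lam p t * state D (toCoords θ) s (gradRow p t) j
        * state D (toCoords θ) s (![spareRow (Sum.inl 2), spareRow (Sum.inl 3)] t) i
      = β * (s i (Sum.inl 2) * labelCoef θ p + s i (Sum.inl 3) * domainCoef lam θ p) := by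
    intro β p i
    obtain ⟨h1, h2⟩ := gradCoef_mul_state D θ s lam p j
    rw [Fin.sum_univ_two]
    simp only [Matrix.cons_val_zero, Matrix.cons_val_one, state_spareRow]
    linear_combination β * s i (Sum.inl 2) * h1 + β * s i (Sum.inl 3) * h2
  rw [mkLayer_attn_apply, Fintype.sum_prod_type, Fin.sum_univ_two]
  simp only [e]
  rcases exists_row a with ⟨z, rfl⟩ | ⟨p, rfl⟩ | ⟨t, rfl⟩
  · simp
  · simp only [paramRow_eq_iff, Matrix.cons_val_zero, Matrix.cons_val_one, state_paramRow,
      state_spareRow, Finset.sum_ite_eq', Finset.mem_univ, if_true, stepCoords]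
    rw [sub_eq_add_neg]
    congr 1
    rw [← neg_mul, neg_one_mul, one_mul, neg_mul, neg_mul, neg_add_eq_sub, ← mul_sub,
      ← Finset.sum_sub_distrib, ← mul_neg, ← Finset.sum_neg_distrib]
    rw [mul_comm η, mul_assoc, ← mul_assoc, one_div, inv_mul_cancel₀ hc, one_mul]
    congr 1
    refine Finset.sum_congr rfl fun i _ => ?_
    have h := relu_sub_relu_neg
      (s i (Sum.inl 2) * labelCoef θ p + s i (Sum.inl 3) * domainCoef lam θ p)
    rw [one_mul, neg_one_mul, ← mul_sub]
    linear_combination -(s i (actRow p)) * h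
  · simp

lemma blockRow_injective : Function.Injective (blockRow (d := d) (K := K)) := by
  rintro (p | p) (q | q) h <;> simp_all [blockRow, paramRow]

/-- The hidden units of `P` act on the parameter rows only; the added units contribute -ReLU(s) +
ReLU(-s) = -s to each spare row, which resets it for the next update. -/
lemma secondLayer_mlp (lam η : ℝ) (P : ParamBlock d K) (D : Input d n n') (θ : Params d K)
    (s : Col n n' → Spare d K → ℝ) :
    (secondLayer n n' lam η P).mlp (state D (toCoords θ) s)
      = state D (toCoords (P.map θ)) 0 := by
  unfold secondLayer
  rw [mkLayer_mlp]
  have h1 : (projIn P * state D (toCoords θ) s).map relu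
      = Matrix.fromRows ((P.P₁ * (selMatrix (blockRow (d := d) (K := K)) * state D (toCoords θ) s)).map relu)
        ((neuronIn (H := Fin 2 × Spare d K) (T := Unit) (fun h => ![-1, 1] h.1)
          (fun h _ => ![1, -1] h.1) (fun h _ => spareRow h.2) * state D (toCoords θ) s).map relu) := by
    unfold projIn
    rw [Matrix.fromRows_mul, Matrix.mul_assoc]
    ext (i | i) j <;> rfl
  have h2 : ∀ p j, (P.P₂ * (P.P₁ * (selMatrix (blockRow (d := d) (K := K)) * state D (toCoords θ) s)).map relu) p j
      = toCoords (P.map θ) p - toCoords θ p := by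
    intro p j
    unfold ParamBlock.map
    rw [toCoords_ofCoords, Pi.add_apply, add_sub_cancel_left, Matrix.mul_apply]
    refine Finset.sum_congr rfl fun h _ => ?_
    congr 1
    rw [Matrix.map_apply]
    congr 1
    rw [Matrix.mul_apply]
    refine Finset.sum_congr rfl fun q _ => ?_
    congr 1
    rw [Matrix.mul_apply]
    simp only [selMatrix, ite_mul, one_mul, zero_mul, Finset.sum_ite_eq, Finset.mem_univ, if_true]
    rcases q with q | q
    · rfl
    · exact zPart_one D j
  rw [h1, projOut, Matrix.fromCols_mul_fromRows, Matrix.mul_assoc]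
  ext a j
  rw [Matrix.add_apply, Matrix.add_apply, neuron_apply, Matrix.mul_apply]
  simp only [h2, Matrix.transpose_apply, selMatrix]
  rw [Fintype.sum_prod_type, Fin.sum_univ_two]
  rcases exists_row a with ⟨z, rfl⟩ | ⟨p, rfl⟩ | ⟨t, rfl⟩
  · simp
  · simp [paramRow_eq_iff]
  · have h := relu_sub_relu_neg (s j t)
    simp [spareRow_eq_iff]
    linarith

lemma secondLayer_apply (lam η : ℝ) (P : ParamBlock d K) (D : Input d n n') (θ : Params d K)
    (s : Col n n' → Spare d K → ℝ) :
    (secondLayer n n' lam η P).apply (state D (toCoords θ) s)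
      = state D (toCoords (P.map (ofCoords (stepCoords lam η θ s)))) 0 := by
  unfold TFLayer.apply
  rw [secondLayer_attn, ← toCoords_ofCoords (stepCoords lam η θ s), secondLayer_mlp,
    toCoords_ofCoords]

/-! ### The readout layer -/

/-- The layer that adds the output of the label network to the label coordinate. -/
def readoutLayer : TFLayer (Row d K (spareCard d K)) :=
  preactLayer (H := Fin K × Fin M) (H' := Fin 0) (fun h => ρ.c h.2) (fun _ => yRow)
    (fun h => paramRow (Sum.inr (Sum.inl h.1))) (fun h => h.1) (fun h => ρ.b h.2) 0 0

/-- Only the label row changes, so the parameter rows survive; at the query, whose label entry is 0,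
the row then holds the network output. -/
lemma readoutLayer_apply (D : Input d n n') (θ : Params d K) (a : Row d K (spareCard d K))
    (j : Col n n') :
    (readoutLayer ρ).apply (tokens (spareCard d K) D θ) a j
      = tokens (spareCard d K) D θ a j
        + if yRow = a then netHat ρ θ θ.2.1 (point D j) else 0 := by
  unfold TFLayer.apply readoutLayer
  conv_lhs => unfold preactLayer
  rw [mkLayer_mlp]
  have h := preactLayer_attn_apply (H := Fin K × Fin M) (H' := Fin 0) (fun h => ρ.c h.2)
    (fun _ => yRow) (fun h => paramRow (Sum.inr (Sum.inl h.1))) (fun h => h.1)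
    (fun h => ρ.b h.2) 0 0 D θ 0 (fun h => θ.2.1 h.1) (fun h i => rfl) a j
  unfold preactLayer at h
  rw [tokens_eq_state, Matrix.zero_mul, add_zero, h]
  congr 1
  split_ifs
  · simp [Fintype.sum_prod_type, netHat, actHat, ReluNet.eval, reluSum, Finset.mul_sum,
      mul_left_comm]
  · simp

end States


/-! ### Size and norm of the layers -/

section Size

variable {d K n n' M : ℕ}

/-- Total weight and biases of the net are at most `C`. -/
def ReluNet.Bounded (f : ReluNet M) (C : ℝ) : Prop := (∑ m, |f.c m| ≤ C) ∧ ∀ m, |f.b m| ≤ C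

variable {ρ ρ' ς ς' sq : ReluNet M} {B C : ℝ}

lemma preactLayer_norm_le {H H' : Type} [Fintype H] [Fintype H'] [DecidableEq H'] {v : H → ℝ}
    {out inp : H → Row d K (spareCard d K)} {k : H → Fin K} {b : H → ℝ}
    {W₁ : Matrix H' (Row d K (spareCard d K)) ℝ} {W₂ : Matrix (Row d K (spareCard d K)) H' ℝ}
    (hC : 0 ≤ C) (hb : ∀ h, |b h| ≤ C) :
    (preactLayer v out inp k b W₁ W₂).norm
      ≤ C + d + 1 + ∑ h, |v h| + opNorm W₁ + opNorm W₂ := by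
  refine mkLayer_norm_le _ _ _ _ _ _ _ _ (by positivity) fun h => ?_
  rw [Fintype.sum_option]
  simp only [Option.elim, abs_one, Finset.sum_const, Finset.card_univ, Fintype.card_fin,
    nsmul_eq_mul, mul_one]
  linarith [hb h]

lemma readoutLayer_norm_le (hC : 0 ≤ C) (hρ : ρ.Bounded C) :
    (readoutLayer (d := d) (K := K) ρ).norm ≤ C + d + 1 + K * C := by
  unfold readoutLayer
  refine (preactLayer_norm_le hC ?_).trans ?_
  · exact fun h => hρ.2 h.2
  rw [opNorm_zero, opNorm_zero, Fintype.sum_prod_type]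
  simp only [Finset.sum_const, Finset.card_univ, Fintype.card_fin, nsmul_eq_mul, add_zero]
  gcongr
  exact hρ.1

lemma evalLayer_norm_le {H' : Type} [Fintype H'] [DecidableEq H']
    {W₁ : Matrix H' (Row d K (spareCard d K)) ℝ} {W₂ : Matrix (Row d K (spareCard d K)) H' ℝ}
    (hC : 0 ≤ C) (hρ : ρ.Bounded C) (hρ' : ρ'.Bounded C) :
    (evalLayer ρ ρ' W₁ W₂).norm ≤ C + d + 1 + 4 * (K * C) + opNorm W₁ + opNorm W₂ := by
  refine (preactLayer_norm_le hC ?_).trans ?_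
  · rintro ⟨τ, k, m⟩
    fin_cases τ
    · exact hρ.2 m
    · exact hρ.2 m
    · exact hρ.2 m
    · exact hρ'.2 m
  · gcongr
    rw [Fintype.sum_prod_type, Fin.sum_univ_four]
    simp only [Fintype.sum_prod_type, Matrix.cons_val_zero, Matrix.cons_val_one, Matrix.cons_val,
      Finset.sum_const, Finset.card_univ, Fintype.card_fin, nsmul_eq_mul]
    have h1 := mul_le_mul_of_nonneg_left hρ.1 (Nat.cast_nonneg (α := ℝ) K)
    have h2 := mul_le_mul_of_nonneg_left hρ'.1 (Nat.cast_nonneg (α := ℝ) K)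
    linarith

lemma one_div_natCast_le_one (n : ℕ) : 1 / (n : ℝ) ≤ 1 := by
  -- For n = 0 the quotient is 0 by convention.
  rcases Nat.eq_zero_or_pos n with h | h
  · simp [h]
  · exact (div_le_one (by exact_mod_cast h)).2 (by exact_mod_cast h)

lemma sum_abs_resC_le (hC : 0 ≤ C) (hς : ς.Bounded C) (hς' : ς'.Bounded C) (hsq : sq.Bounded C) :
    ∑ h, |resC (d := d) (K := K) ς ς' sq n n' h| ≤ 3 * C + 2 + K * d * C := by
  simp only [Fintype.sum_sum_type, resC, Sum.elim_inl, Sum.elim_inr,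
    Fintype.sum_prod_type (α₁ := Fin 3), Fintype.sum_prod_type (α₁ := Fin 2), Fin.sum_univ_three,
    Fin.sum_univ_two, Matrix.cons_val_zero, Matrix.cons_val_one, Matrix.cons_val, abs_mul, abs_neg,
    Fintype.sum_prod_type, Finset.sum_const, Finset.card_univ, Fintype.card_prod, Fintype.card_fin,
    Nat.cast_mul, nsmul_eq_mul, ← Finset.mul_sum, abs_one]
  have h0 : ∀ k : ℕ, |1 / (k : ℝ)| ≤ 1 := fun k => by
    rw [abs_of_nonneg (by positivity)]; exact one_div_natCast_le_one k
  have h1 : |1 / (n : ℝ)| * ∑ m, |ς.c m| ≤ 1 * C :=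
    mul_le_mul (h0 n) hς.1 (Finset.sum_nonneg fun _ _ => abs_nonneg _) zero_le_one
  have h2 : |1 / (n' : ℝ)| * ∑ m, |ς'.c m| ≤ 1 * C :=
    mul_le_mul (h0 n') hς'.1 (Finset.sum_nonneg fun _ _ => abs_nonneg _) zero_le_one
  have h3 : |(1 : ℝ) / 4| = 1 / 4 := abs_of_pos (by norm_num)
  have h4 : (K : ℝ) * d * ∑ m, |sq.c m| ≤ K * d * C :=
    mul_le_mul_of_nonneg_left hsq.1 (by positivity)
  have h5 : 0 ≤ (K : ℝ) * d * C := by positivity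
  rw [h3]
  linarith [hς.1]

/-- The target units dominate in B, with coefficients 1, -B, B and a bias shifted by -B; the units
for squares account for the summand 2. -/
lemma sum_abs_resCoef_le (hB : 0 ≤ B) (hς : ς.Bounded C) (hς' : ς'.Bounded C)
    (hsq : sq.Bounded C) (hC : 0 ≤ C) (h : ResIdx d K M) :
    ∑ t, |resCoef ς ς' sq B h t| ≤ 2 + 3 * B + C := by
  rw [Fin.sum_univ_four]
  rcases h with ⟨τ, m⟩ | β | ⟨β, p, m⟩
  · have h1 := (abs_sub (ς.b m) B).trans (add_le_add (hς.2 m) (abs_of_nonneg hB).le)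
    have h2 := (abs_sub (ς'.b m) B).trans (add_le_add (hς'.2 m) (abs_of_nonneg hB).le)
    fin_cases τ <;> simp [resCoef, abs_of_nonneg hB] <;> linarith
  · fin_cases β <;> simp [resCoef] <;> linarith
  · have h1 := hsq.2 m
    fin_cases β <;> simp [resCoef] <;> linarith

/-- Total weights and biases enter, but not the number of units; this keeps the norm independent of
the accuracy. -/
lemma firstLayer_norm_le (hB : 0 ≤ B) (hC : 0 ≤ C) (hρ : ρ.Bounded C) (hρ' : ρ'.Bounded C)
    (hς : ς.Bounded C) (hς' : ς'.Bounded C) (hsq : sq.Bounded C) :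
    (firstLayer (d := d) (K := K) ρ ρ' ς ς' sq n n' B).norm
      ≤ C + d + 1 + 4 * (K * C) + (3 + 3 * B + C) * √(3 * C + 2 + K * d * C) := by
  refine (evalLayer_norm_le hC hρ hρ').trans ?_
  have h1 := opNorm_neuronIn_le (coef := resCoef (d := d) (K := K) ς ς' sq B) (q := resInp)
    (resC ς ς' sq n n') (by positivity) (sum_abs_resCoef_le hB hς hς' hsq hC)
  have h2 := opNorm_neuronOut_le (out := resOut) (resC (d := d) (K := K) ς ς' sq n n')
  have h3 := Real.sqrt_le_sqrt
    (sum_abs_resC_le (d := d) (K := K) (n := n) (n' := n') hC hς hς' hsq)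
  have h4 := mul_le_mul_of_nonneg_left h3 (by positivity : 0 ≤ 2 + 3 * B + C)
  linarith

/-- The value matrices have entries of size η(N + 1), the source of the linear dependence of the
norm on η. -/
lemma secondLayer_norm_le (P : ParamBlock d K) {lam η : ℝ} (hlam : 0 ≤ lam) (hη : 0 ≤ η) :
    (secondLayer n n' lam η P).norm
      ≤ (1 + lam) + 1 + 2 * Fintype.card (ParamIdx d K) * (η * Fintype.card (Col n n'))
        + 2 * √(2 * spareCard d K) + P.norm := by
  have h0 : ∀ h : Fin 2 × ParamIdx d K,
      ∑ t, |![(1 : ℝ), -1] h.1 * gradCoef lam h.2 t| ≤ 1 + lam := by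
    rintro ⟨β, p⟩
    have e : |![(1 : ℝ), -1] β| = 1 := by fin_cases β <;> simp
    rw [Fin.sum_univ_two]
    simp only [abs_mul, e, one_mul]
    rcases p with p | p | p <;> simp [gradCoef, abs_of_nonneg hlam, hlam]
  refine (mkLayer_norm_le _ _ _ _ _ _ _ _ (by positivity) h0).trans ?_
  have h1 : ∑ h : Fin 2 × ParamIdx d K, |![(-1 : ℝ), 1] h.1 * (η * Fintype.card (Col n n'))|
      = 2 * Fintype.card (ParamIdx d K) * (η * Fintype.card (Col n n')) := by
    rw [Fintype.sum_prod_type, Fin.sum_univ_two]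
    simp only [Matrix.cons_val_zero, Matrix.cons_val_one, neg_mul, one_mul, abs_neg,
      Finset.sum_const, Finset.card_univ, nsmul_eq_mul]
    rw [abs_of_nonneg (by positivity)]
    ring
  have hc : ∑ h : Fin 2 × Spare d K, |![(-1 : ℝ), 1] h.1| = 2 * spareCard d K := by
    rw [Fintype.sum_prod_type, Fin.sum_univ_two]
    simp only [Matrix.cons_val_zero, Matrix.cons_val_one, abs_neg, abs_one,
      Finset.sum_const, Finset.card_univ, nsmul_eq_mul]
    ring
  have h2 : opNorm (projIn P) ≤ opNorm P.P₁ + √(2 * spareCard d K) := by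
    refine (opNorm_fromRows_le _ _).trans (add_le_add ?_ ?_)
    · refine (opNorm_mul_le _ _).trans ?_
      exact mul_le_of_le_one_right (opNorm_nonneg _) (opNorm_selMatrix_le blockRow_injective)
    · refine (opNorm_neuronIn_le _ _ _ zero_le_one ?_).trans_eq ?_
      · rintro ⟨β, s⟩
        fin_cases β <;> simp
      · rw [hc, one_mul]
  have h3 : opNorm (projOut P) ≤ opNorm P.P₂ + √(2 * spareCard d K) := by
    refine (opNorm_fromCols_le _ _).trans (add_le_add ?_ ?_)
    · refine (opNorm_mul_le _ _).trans ?_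
      rw [opNorm_transpose]
      exact mul_le_of_le_one_left (opNorm_nonneg _)
        (opNorm_selMatrix_le fun p q h => paramRow_eq_iff.1 h)
    · exact (opNorm_neuronOut_le _ _).trans_eq (by rw [hc])
  rw [h1]
  unfold ParamBlock.norm
  linarith

end Size

/-! ### Accuracy of one update -/

section Accuracy

variable {d K n n' M : ℕ}

/-- The nets approximate, with accuracy `δ`, the functions that the layers need; `m` bounds
the activation function and its derivative. -/
structure GoodNets (K : ℕ) (r : ℝ → ℝ) (Bx Bu Bw Bv m C δ : ℝ) (ρ ρ' ς ς' sq : ReluNet M) :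
    Prop where
  bρ : ρ.Bounded C
  bρ' : ρ'.Bounded C
  bς : ς.Bounded C
  bς' : ς'.Bounded C
  bsq : sq.Bounded C
  hρ : ∀ s, |s| ≤ Bu * Bx → |ρ.eval s - r s| ≤ δ
  hρ' : ∀ s, |s| ≤ Bu * Bx → |ρ'.eval s - deriv r s| ≤ δ
  hς : ∀ s, |s| ≤ K * (Bw + Bv) * (m + 1) → |ς.eval s - Real.sigmoid s| ≤ δ
  hς' : ∀ s, |s| ≤ K * (Bw + Bv) * (m + 1) → |ς'.eval s - (Real.sigmoid s - 1)| ≤ δ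
  hsq : ∀ s, |s| ≤ m + 1 + Bx → |sq.eval s - s ^ 2| ≤ δ

lemma exists_reluNet {f : ℝ → ℝ} (hf : ContDiff ℝ 2 f) {B : ℝ} (hB : 0 ≤ B) :
    ∃ C : ℝ, 0 ≤ C ∧ ∀ N : ℕ, 0 < N → ∃ g : ReluNet (N + 3), g.Bounded C ∧
      ∀ s, |s| ≤ B → |g.eval s - f s| ≤ C / N := by
  obtain ⟨C, hC, h⟩ := exists_reluSum_approx hf hB
  refine ⟨max C (B + 1), hC.trans (le_max_left _ _), fun N hN => ?_⟩
  obtain ⟨c, b, h1, h2, h3⟩ := h N hN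
  refine ⟨⟨c, b⟩, ⟨h1.trans (le_max_left _ _), fun m => (h2 m).trans (le_max_right _ _)⟩,
    fun s hs => (h3 s hs).trans ?_⟩
  gcongr
  exact le_max_left _ _

lemma ReluNet.Bounded.mono {f : ReluNet M} {C C' : ℝ} (h : f.Bounded C) (hC : C ≤ C') :
    f.Bounded C' := ⟨h.1.trans hC, fun m => (h.2 m).trans hC⟩

/-- The ranges are those of the computed quantities: approximate activations are at most m + 1,
which bounds the logits, and the squares are taken at sums of such an activation and a coordinate of
x. A single `C` bounds weights, biases and N times the error. -/
lemma exists_goodNets (K : ℕ) {r : ℝ → ℝ} (hr : ContDiff ℝ 2 r) (hr' : ContDiff ℝ 2 (deriv r))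
    {Bx Bu Bw Bv m : ℝ} (hBx : 0 ≤ Bx) (hBu : 0 ≤ Bu) (hBw : 0 ≤ Bw) (hBv : 0 ≤ Bv)
    (hm : 0 ≤ m) :
    ∃ C : ℝ, 0 ≤ C ∧ ∀ N : ℕ, 0 < N → ∃ ρ ρ' ς ς' sq : ReluNet (N + 3),
      GoodNets K r Bx Bu Bw Bv m C (C / N) ρ ρ' ς ς' sq := by
  have hσ : ContDiff ℝ 2 Real.sigmoid := contDiff_sigmoid.of_le (by simp)
  have hσ' : ContDiff ℝ 2 fun z => Real.sigmoid z - 1 := hσ.sub contDiff_const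
  have hs : ContDiff ℝ 2 fun z : ℝ => z ^ 2 := by fun_prop
  obtain ⟨C₁, hC₁, h₁⟩ := exists_reluNet hr (B := Bu * Bx) (by positivity)
  obtain ⟨C₂, hC₂, h₂⟩ := exists_reluNet hr' (B := Bu * Bx) (by positivity)
  obtain ⟨C₃, hC₃, h₃⟩ := exists_reluNet hσ (B := K * (Bw + Bv) * (m + 1)) (by positivity)
  obtain ⟨C₄, hC₄, h₄⟩ := exists_reluNet hσ' (B := K * (Bw + Bv) * (m + 1)) (by positivity)
  obtain ⟨C₅, hC₅, h₅⟩ := exists_reluNet hs (B := m + 1 + Bx) (by positivity)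
  refine ⟨C₁ + C₂ + C₃ + C₄ + C₅, by positivity, fun N hN => ?_⟩
  have hN' : (0 : ℝ) < N := by exact_mod_cast hN
  obtain ⟨ρ, b₁, e₁⟩ := h₁ N hN
  obtain ⟨ρ', b₂, e₂⟩ := h₂ N hN
  obtain ⟨ς, b₃, e₃⟩ := h₃ N hN
  obtain ⟨ς', b₄, e₄⟩ := h₄ N hN
  obtain ⟨sq, b₅, e₅⟩ := h₅ N hN
  have hdiv : ∀ {x y : ℝ}, x ≤ y → x / N ≤ y / N := fun h => div_le_div_of_nonneg_right h hN'.le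
  exact ⟨ρ, ρ', ς, ς', sq, b₁.mono (by linarith), b₂.mono (by linarith), b₃.mono (by linarith),
    b₄.mono (by linarith), b₅.mono (by linarith),
    fun s hs => (e₁ s hs).trans (hdiv (by linarith)),
    fun s hs => (e₂ s hs).trans (hdiv (by linarith)),
    fun s hs => (e₃ s hs).trans (hdiv (by linarith)),
    fun s hs => (e₄ s hs).trans (hdiv (by linarith)),
    fun s hs => (e₅ s hs).trans (hdiv (by linarith))⟩

lemma abs_preact_le (u : EuclideanSpace ℝ (Fin K × Fin d)) (x : EuclideanSpace ℝ (Fin d))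
    (k : Fin K) : |preact u x k| ≤ ‖rowVec u k‖ * ‖x‖ := by
  have h := abs_real_inner_le_norm (rowVec u k) x
  have e : inner ℝ (rowVec u k) x = preact u x k := by
    rw [PiLp.inner_apply]
    exact Finset.sum_congr rfl fun i _ => mul_comm _ _
  rwa [e] at h

lemma abs_sigmoid_sub_le (s t : ℝ) : |Real.sigmoid s - Real.sigmoid t| ≤ |s - t| := by
  have h := (convex_univ (𝕜 := ℝ) (E := ℝ)).norm_image_sub_le_of_norm_deriv_le
    (f := Real.sigmoid) (C := 1) (x := t) (y := s) (fun x _ => differentiableAt_sigmoid)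
    (fun x _ => by
      rw [Real.deriv_sigmoid, Real.norm_eq_abs]
      have h0 := Real.sigmoid_pos x
      have h1 := Real.sigmoid_lt_one x
      rw [abs_le]
      constructor <;> nlinarith) trivial trivial
  simpa using h

lemma maskEval_zero (f : ReluNet M) (B z : ℝ) : maskEval f B z 0 = f.eval z := by
  simp [maskEval, ReluNet.eval, reluSum]

/-- Every unit receives the nonpositive argument z - B + b, so masked tokens contribute exactly
zero. -/
lemma maskEval_neg_one {f : ReluNet M} {B C z : ℝ} (hf : f.Bounded C) (h : |z| + C ≤ B) :
    maskEval f B z (-1) = 0 := by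
  refine Finset.sum_eq_zero fun m _ => ?_
  have h1 := hf.2 m
  have h2 := le_abs_self z
  have h3 := le_abs_self (f.b m)
  rw [relu_of_nonpos (by linarith), mul_zero]

/-- Error propagation through one gradient term: a, b are residuals, k₁, k₂ exact coefficients, s an
activation. The product error is split by changing the residuals before the activation; δ ≤ 1 keeps
|s'| at most S + F. -/
lemma abs_term_sub_le {a a' b b' k₁ k₂ s s' κ E G Y S F δ : ℝ} (hF : 0 ≤ F) (hδ1 : δ ≤ 1)
    (ha : |a' - a| ≤ E * δ) (hb : |b' - b| ≤ E * δ) (hka : |k₁| ≤ κ) (hkb : |k₂| ≤ κ)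
    (hG : |a| ≤ G) (hY : |b| ≤ Y) (hs : |s' - s| ≤ F * δ) (hsS : |s| ≤ S) :
    |(a' * k₁ + b' * k₂) * s' - (a * k₁ + b * k₂) * s|
      ≤ (2 * (E * κ) * (S + F) + (G + Y) * κ * F) * δ := by
  have e : (a' * k₁ + b' * k₂) * s' - (a * k₁ + b * k₂) * s
      = ((a' - a) * k₁ + (b' - b) * k₂) * s' + (a * k₁ + b * k₂) * (s' - s) := by ring
  have hs' : |s'| ≤ S + F := by
    have h1 : |s'| ≤ |s| + |s' - s| := by
      have := abs_add_le s (s' - s)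
      rwa [add_sub_cancel] at this
    have : F * δ ≤ F := mul_le_of_le_one_right hF hδ1
    linarith
  have hmul : ∀ {x y X Y : ℝ}, |x| ≤ X → |y| ≤ Y → |x * y| ≤ X * Y := fun hx hy => by
    rw [abs_mul]; exact mul_le_mul hx hy (abs_nonneg _) ((abs_nonneg _).trans hx)
  rw [e]
  have h1 : |(a' - a) * k₁ + (b' - b) * k₂| ≤ E * δ * κ + E * δ * κ :=
    (abs_add_le _ _).trans (add_le_add (hmul ha hka) (hmul hb hkb))
  have h2 : |a * k₁ + b * k₂| ≤ G * κ + Y * κ :=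
    (abs_add_le _ _).trans (add_le_add (hmul hG hka) (hmul hY hkb))
  refine (abs_add_le _ _).trans ((add_le_add (hmul h1 hs') (hmul h2 hs)).trans_eq ?_)
  ring

variable {r : ℝ → ℝ} {Bx By Bu Bw Bv m C δ lam : ℝ} {ρ ρ' ς ς' sq : ReluNet M}

/-- A constant that bounds the coefficients of the gradient. -/
def coefBound (Bw Bv lam : ℝ) : ℝ := 1 + lam + Bw + lam * Bv

/-- The Lipschitz constant of a gradient term in the accuracy of the nets. -/
def termBound (K : ℕ) (Bx By Bw Bv m lam : ℝ) : ℝ :=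
  2 * ((1 + K * (Bw + Bv)) * coefBound Bw Bv lam) * (m * (1 + Bx) + (1 + Bx))
    + ((1 + By) + 1) * coefBound Bw Bv lam * (1 + Bx)

section

variable (hg : GoodNets K r Bx Bu Bw Bv m C δ ρ ρ' ς ς' sq) (hδ : 0 ≤ δ) (hδ1 : δ ≤ 1)
  (hBx : 0 ≤ Bx) (hBu : 0 ≤ Bu) (hBw : 0 ≤ Bw) (hBv : 0 ≤ Bv) (hm : 0 ≤ m)
  (hm1 : ∀ s, |s| ≤ Bu * Bx → |r s| ≤ m) (hm2 : ∀ s, |s| ≤ Bu * Bx → |deriv r s| ≤ m)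
  {θ : Params d K} (hθ : θ ∈ paramSet Bu Bw Bv) {x : EuclideanSpace ℝ (Fin d)} (hx : ‖x‖ ≤ Bx)

include hBu hθ hx in
lemma abs_preact_le_of_mem (k : Fin K) : |preact θ.1 x k| ≤ Bu * Bx :=
  (abs_preact_le _ _ _).trans (mul_le_mul (hθ.1 k) hx (norm_nonneg _) hBu)

include hg hBu hθ hx in
lemma abs_netHat_sub_le {a : EuclideanSpace ℝ (Fin K)} {Ba : ℝ} (ha : ‖a‖ ≤ Ba) :
    |netHat ρ θ a x - net r θ.1 a x| ≤ K * Ba * δ := by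
  rw [net_eq, netHat, ← Finset.sum_sub_distrib]
  refine (Finset.abs_sum_le_sum_abs _ _).trans ((Finset.sum_le_sum (g := fun _ => Ba * δ)
    fun k _ => ?_).trans_eq ?_)
  · rw [← mul_sub, abs_mul]
    exact mul_le_mul ((abs_apply_le_norm a k).trans ha)
      (hg.hρ _ (abs_preact_le_of_mem hBu hθ hx k)) (abs_nonneg _) ((norm_nonneg _).trans ha)
  · simp [mul_assoc]

include hg hδ1 hBu hm1 hθ hx in
lemma abs_netHat_le {a : EuclideanSpace ℝ (Fin K)} {Ba : ℝ} (ha : ‖a‖ ≤ Ba) :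
    |netHat ρ θ a x| ≤ K * Ba * (m + 1) := by
  rw [netHat]
  refine (Finset.abs_sum_le_sum_abs _ _).trans ((Finset.sum_le_sum (g := fun _ => Ba * (m + 1))
    fun k _ => ?_).trans_eq ?_)
  · rw [abs_mul]
    have hp := abs_preact_le_of_mem hBu hθ hx k
    refine mul_le_mul ((abs_apply_le_norm a k).trans ha) ?_ (abs_nonneg _) ((norm_nonneg _).trans ha)
    have h1 := hg.hρ _ hp
    have h2 := hm1 _ hp
    have h3 := abs_add_le (ρ.eval (preact θ.1 x k) - r (preact θ.1 x k)) (r (preact θ.1 x k))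
    rw [sub_add_cancel] at h3
    exact h3.trans (by linarith)
  · simp [mul_assoc]

include hg hδ hδ1 hBx hBu hm hm1 hm2 hθ hx in
-- In the polarized product the two squares contribute at most δ/2, and the error of r' contributes
-- δ·Bx.
lemma abs_spareRes_actRow_sub_le (B : ℝ) (D : Input d n n') (j : Col n n') (hj : point D j = x)
    (p : ParamIdx d K) :
    |spareRes ρ ρ' ς ς' sq B D θ j (actRow p) - activation r θ.1 x p| ≤ (1 + Bx) * δ ∧
      |activation r θ.1 x p| ≤ m * (1 + Bx) := by
  have h1δ : δ ≤ (1 + Bx) * δ := by nlinarith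
  have hm' : m ≤ m * (1 + Bx) := by nlinarith
  subst hj
  rcases p with ⟨k, a⟩ | k | k
  · have hp := abs_preact_le_of_mem hBu hθ hx k
    have hxa : |point D j a| ≤ Bx := (abs_apply_le_norm _ a).trans hx
    have e1 := hg.hρ' _ hp
    have e2 := hm2 _ hp
    refine ⟨?_, ?_⟩
    · change |prodHat ρ' sq θ (point D j) (k, a)
        - deriv r (preact θ.1 (point D j) k) * point D j a| ≤ _
      unfold prodHat
      change |1 / 4 * (sq.eval (ρ'.eval (preact θ.1 (point D j) k) + point D j a)
        - sq.eval (ρ'.eval (preact θ.1 (point D j) k) - point D j a)) - _| ≤ _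
      generalize ρ'.eval (preact θ.1 (point D j) k) = s' at *
      generalize deriv r (preact θ.1 (point D j) k) = s at *
      generalize point D j a = y at *
      have hs' : |s'| ≤ m + 1 := by
        have h3 := abs_add_le (s' - s) s
        rw [sub_add_cancel] at h3
        linarith
      have q1 := hg.hsq (s' + y) ((abs_add_le _ _).trans (by linarith))
      have q2 := hg.hsq (s' - y) ((abs_sub _ _).trans (by linarith))
      have e : 1 / 4 * (sq.eval (s' + y) - sq.eval (s' - y)) - s * y
          = 1 / 4 * ((sq.eval (s' + y) - (s' + y) ^ 2) - (sq.eval (s' - y) - (s' - y) ^ 2))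
            + (s' - s) * y := by ring
      rw [e]
      have q3 : |(s' - s) * y| ≤ δ * Bx := by
        rw [abs_mul]; exact mul_le_mul e1 hxa (abs_nonneg _) hδ
      have q4 := abs_sub (sq.eval (s' + y) - (s' + y) ^ 2) (sq.eval (s' - y) - (s' - y) ^ 2)
      refine (abs_add_le _ _).trans ?_
      rw [abs_mul, abs_of_pos (by norm_num : (0 : ℝ) < 1 / 4)]
      nlinarith
    · change |deriv r (preact θ.1 (point D j) k) * point D j a| ≤ _
      rw [abs_mul]
      nlinarith [mul_le_mul e2 hxa (abs_nonneg _) hm]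
  · have hp := abs_preact_le_of_mem hBu hθ hx k
    exact ⟨(hg.hρ _ hp).trans h1δ, (hm1 _ hp).trans hm'⟩
  · have hp := abs_preact_le_of_mem hBu hθ hx k
    exact ⟨(hg.hρ _ hp).trans h1δ, (hm1 _ hp).trans hm'⟩

include hg hδ1 hBu hm1 hθ hx in
-- The 1 is the error of the sigmoid net at the approximate logit; K(Bw + Bv) is the error of the
-- logit, passed through the 1-Lipschitz sigmoid.
lemma abs_sigmoid_netHat_sub_le {a : EuclideanSpace ℝ (Fin K)} {Ba : ℝ} (ha : ‖a‖ ≤ Ba)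
    (hBa : Ba ≤ Bw + Bv) :
    |ς.eval (netHat ρ θ a x) - Real.sigmoid (net r θ.1 a x)| ≤ (1 + K * (Bw + Bv)) * δ ∧
    |ς'.eval (netHat ρ θ a x) - (Real.sigmoid (net r θ.1 a x) - 1)|
      ≤ (1 + K * (Bw + Bv)) * δ ∧ |netHat ρ θ a x| ≤ K * (Bw + Bv) * (m + 1) := by
  have ha' := ha.trans hBa
  have h1 := abs_netHat_sub_le hg hBu hθ hx ha'
  have h2 := abs_netHat_le hg hδ1 hBu hm1 hθ hx ha'
  have h3 := hg.hς _ h2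
  have h4 := hg.hς' _ h2
  have h5 := (abs_sigmoid_sub_le (netHat ρ θ a x) (net r θ.1 a x)).trans h1
  refine ⟨(abs_sub_le _ (Real.sigmoid (netHat ρ θ a x)) _).trans (by linarith),
    (abs_sub_le _ (Real.sigmoid (netHat ρ θ a x) - 1) _).trans ?_, h2⟩
  rw [sub_sub_sub_cancel_right]
  linarith

include hBw hBv hθ in
lemma abs_coef_le (hlam : 0 ≤ lam) (p : ParamIdx d K) :
    |labelCoef θ p| ≤ coefBound Bw Bv lam ∧ |domainCoef lam θ p| ≤ coefBound Bw Bv lam := by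
  have h0 : 0 ≤ lam * Bv := by positivity
  have h0' : 0 ≤ coefBound Bw Bv lam := by unfold coefBound; positivity
  unfold coefBound at *
  rcases p with p | p | p
  · have h1 : |θ.2.1 p.1| ≤ Bw := (abs_apply_le_norm _ _).trans hθ.2.1
    have h2 : |θ.2.2 p.1| ≤ Bv := (abs_apply_le_norm _ _).trans hθ.2.2
    have h3 : |-lam * θ.2.2 p.1| ≤ lam * Bv := by
      rw [abs_mul, abs_neg, abs_of_nonneg hlam]
      exact mul_le_mul_of_nonneg_left h2 hlam
    exact ⟨h1.trans (by linarith), h3.trans (by linarith)⟩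
  · refine ⟨?_, ?_⟩
    · change |(1 : ℝ)| ≤ _
      rw [abs_one]; linarith
    · change |(0 : ℝ)| ≤ _
      rw [abs_zero]; linarith
  · refine ⟨?_, ?_⟩
    · change |(0 : ℝ)| ≤ _
      rw [abs_zero]; linarith
    · change |lam| ≤ _
      rw [abs_of_nonneg hlam]; linarith

include hg hδ hδ1 hBx hBu hBw hBv hm hm1 hm2 hθ in
/-- The first layer followed by the attention of the second layer performs the gradient step. -/
lemma abs_stepCoords_sub_le (hr : Differentiable ℝ r) (hlam : 0 ≤ lam) (hBy : 0 ≤ By) (η : ℝ)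
    {D : Input d n n'} (hD : D.Bounded Bx By) (p : ParamIdx d K) :
    |stepCoords lam η θ (spareRes ρ ρ' ς ς' sq (K * (Bw + Bv) * (m + 1) + C) D θ) p
      - toCoords (gradStep r D lam η θ) p|
      ≤ |η| * ((n + n') * termBound K Bx By Bw Bv m lam) * δ := by
  set B : ℝ := K * (Bw + Bv) * (m + 1) + C with hB
  have hκ : 0 ≤ coefBound Bw Bv lam := (abs_nonneg _).trans (abs_coef_le hBw hBv hθ hlam p).1
  obtain ⟨hk1, hk2⟩ := abs_coef_le hBw hBv hθ hlam p
  have hw := hθ.2.1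
  have hv := hθ.2.2
  have hE : 0 ≤ 1 + K * (Bw + Bv) := by positivity
  have hnn : ∀ k : ℕ, 0 ≤ 1 / (k : ℝ) := fun k => by positivity
  have hmask : ∀ (y : EuclideanSpace ℝ (Fin d)) (hy : ‖y‖ ≤ Bx) (a : EuclideanSpace ℝ (Fin K)),
      ‖a‖ ≤ Bw + Bv → maskEval ς B (netHat ρ θ a y) (-1) = 0 ∧
        maskEval ς' B (netHat ρ θ a y) (-1) = 0 := by
    intro y hy a ha
    have h := (abs_sigmoid_netHat_sub_le hg hδ1 hBu hm1 hθ hy ha le_rfl).2.2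
    exact ⟨maskEval_neg_one hg.bς (by linarith), maskEval_neg_one hg.bς' (by linarith)⟩
  -- The query token is masked in both residuals, so it does not enter the gradient sum.
  have hq1 : labelRes ρ ς B D θ (Sum.inr (Sum.inr ())) = 0 := by
    change maskEval ς B (netHat ρ θ θ.2.1 D.xq) (0 - 1) - 0 = 0
    rw [zero_sub, (hmask D.xq hD.2.2.2 θ.2.1 (by linarith)).1, sub_zero]
  have hq2 : domainRes ρ ς ς' B D θ (Sum.inr (Sum.inr ())) = 0 := by
    change 1 / (n : ℝ) * maskEval ς B (netHat ρ θ θ.2.2 D.xq) (0 - 1)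
      + 1 / (n' : ℝ) * maskEval ς' B (netHat ρ θ θ.2.2 D.xq) (0 - 0 - 1) = 0
    rw [sub_zero, zero_sub, (hmask D.xq hD.2.2.2 θ.2.2 (by linarith)).1,
      (hmask D.xq hD.2.2.2 θ.2.2 (by linarith)).2]
    ring
  have hs1 : ∀ i, labelRes ρ ς B D θ (Sum.inl i)
      = ς.eval (netHat ρ θ θ.2.1 (D.xS i)) - D.yS i := by
    intro i
    change maskEval ς B (netHat ρ θ θ.2.1 (D.xS i)) (1 - 1) - D.yS i = _
    rw [sub_self, maskEval_zero]
  have hs2 : ∀ i, domainRes ρ ς ς' B D θ (Sum.inl i)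
      = 1 / (n : ℝ) * ς.eval (netHat ρ θ θ.2.2 (D.xS i)) := by
    intro i
    change 1 / (n : ℝ) * maskEval ς B (netHat ρ θ θ.2.2 (D.xS i)) (1 - 1)
      + 1 / (n' : ℝ) * maskEval ς' B (netHat ρ θ θ.2.2 (D.xS i)) (1 - 1 - 1) = _
    rw [sub_self, zero_sub, maskEval_zero, (hmask _ (hD.1 i) θ.2.2 (by linarith)).2]
    ring
  have ht1 : ∀ i, labelRes ρ ς B D θ (Sum.inr (Sum.inl i)) = 0 := by
    intro i
    change maskEval ς B (netHat ρ θ θ.2.1 (D.xT i)) (0 - 1) - 0 = 0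
    rw [zero_sub, (hmask _ (hD.2.2.1 i) θ.2.1 (by linarith)).1, sub_zero]
  have ht2 : ∀ i, domainRes ρ ς ς' B D θ (Sum.inr (Sum.inl i))
      = 1 / (n' : ℝ) * ς'.eval (netHat ρ θ θ.2.2 (D.xT i)) := by
    intro i
    change 1 / (n : ℝ) * maskEval ς B (netHat ρ θ θ.2.2 (D.xT i)) (0 - 1)
      + 1 / (n' : ℝ) * maskEval ς' B (netHat ρ θ θ.2.2 (D.xT i)) (1 - 0 - 1) = _
    rw [zero_sub, sub_zero, sub_self, maskEval_zero, (hmask _ (hD.2.2.1 i) θ.2.2 (by linarith)).1]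
    ring
  have habs : ∀ (k : ℕ) {y : ℝ} {Y : ℝ}, |y| ≤ Y → |1 / (k : ℝ) * y| ≤ Y := by
    intro k y Y hy
    rw [abs_mul, abs_of_nonneg (hnn k)]
    exact (mul_le_of_le_one_left (abs_nonneg _) (one_div_natCast_le_one k)).trans hy
  have hσ : ∀ z, |Real.sigmoid z| ≤ 1 ∧ |Real.sigmoid z - 1| ≤ 1 := by
    intro z
    have h1 := Real.sigmoid_pos z
    have h2 := Real.sigmoid_lt_one z
    constructor <;> rw [abs_le] <;> constructor <;> linarith
  have hT : ∀ i, |((ς.eval (netHat ρ θ θ.2.1 (D.xS i)) - D.yS i) * labelCoef θ p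
      + 1 / (n : ℝ) * ς.eval (netHat ρ θ θ.2.2 (D.xS i)) * domainCoef lam θ p)
        * spareRes ρ ρ' ς ς' sq B D θ (Sum.inl i) (actRow p)
      - sourceTerm n r lam θ (D.xS i) (D.yS i) p| ≤ termBound K Bx By Bw Bv m lam * δ := by
    intro i
    have h1 := (abs_sigmoid_netHat_sub_le hg hδ1 hBu hm1 hθ (hD.1 i) hw
      (by linarith)).1
    have h2 := (abs_sigmoid_netHat_sub_le hg hδ1 hBu hm1 hθ (hD.1 i) hv
      (by linarith)).1
    obtain ⟨h3, h4⟩ := abs_spareRes_actRow_sub_le hg hδ hδ1 hBx hBu hm hm1 hm2 hθ (hD.1 i) B D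
      (Sum.inl i) rfl p
    refine abs_term_sub_le (by positivity) hδ1 ?_ ?_ hk1 hk2 ?_ ?_ h3 h4
    · rwa [sub_sub_sub_cancel_right]
    · rw [← mul_sub]
      exact habs n h2
    · exact (abs_sub _ _).trans (add_le_add (hσ _).1 (hD.2.1 i))
    · exact habs n (hσ _).1
  have hT' : ∀ i, |(0 * labelCoef θ p
      + 1 / (n' : ℝ) * ς'.eval (netHat ρ θ θ.2.2 (D.xT i)) * domainCoef lam θ p)
        * spareRes ρ ρ' ς ς' sq B D θ (Sum.inr (Sum.inl i)) (actRow p)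
      - targetTerm n' r lam θ (D.xT i) p| ≤ termBound K Bx By Bw Bv m lam * δ := by
    intro i
    have h2 := (abs_sigmoid_netHat_sub_le hg hδ1 hBu hm1 hθ (hD.2.2.1 i) hv
      (by linarith)).2.1
    obtain ⟨h3, h4⟩ := abs_spareRes_actRow_sub_le hg hδ hδ1 hBx hBu hm hm1 hm2 hθ (hD.2.2.1 i) B D
      (Sum.inr (Sum.inl i)) rfl p
    -- A target term is written with label residual 0, so that the estimate for source terms
    -- applies.
    have e : targetTerm n' r lam θ (D.xT i) p = (0 * labelCoef θ p
      + 1 / (n' : ℝ) * (Real.sigmoid (net r θ.1 θ.2.2 (D.xT i)) - 1) * domainCoef lam θ p)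
        * activation r θ.1 (D.xT i) p := by
      rw [zero_mul, zero_add]; rfl
    rw [e]
    refine abs_term_sub_le (by positivity) hδ1 ?_ ?_ hk1 hk2 ?_ ?_ h3 h4
    · rw [sub_self, abs_zero]; positivity
    · rw [← mul_sub]
      exact habs n' h2
    · rw [abs_zero]; positivity
    · exact habs n' (hσ _).2
  have hsum : ∑ i, (labelRes ρ ς B D θ i * labelCoef θ p
      + domainRes ρ ς ς' B D θ i * domainCoef lam θ p)
        * spareRes ρ ρ' ς ς' sq B D θ i (actRow p)
      - (∑ i, sourceTerm n r lam θ (D.xS i) (D.yS i) p + ∑ i, targetTerm n' r lam θ (D.xT i) p)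
      = ∑ i, (((ς.eval (netHat ρ θ θ.2.1 (D.xS i)) - D.yS i) * labelCoef θ p
      + 1 / (n : ℝ) * ς.eval (netHat ρ θ θ.2.2 (D.xS i)) * domainCoef lam θ p)
        * spareRes ρ ρ' ς ς' sq B D θ (Sum.inl i) (actRow p)
        - sourceTerm n r lam θ (D.xS i) (D.yS i) p)
      + ∑ i, ((0 * labelCoef θ p
      + 1 / (n' : ℝ) * ς'.eval (netHat ρ θ θ.2.2 (D.xT i)) * domainCoef lam θ p)
        * spareRes ρ ρ' ς ς' sq B D θ (Sum.inr (Sum.inl i)) (actRow p)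
        - targetTerm n' r lam θ (D.xT i) p) := by
    simp only [Fintype.sum_sum_type, hs1, hs2, ht1, ht2, Finset.sum_sub_distrib,
      Finset.univ_unique, Finset.sum_singleton]
    have : (default : Unit) = () := rfl
    rw [this, hq1, hq2]
    ring
  rw [toCoords_gradStep hr]
  unfold stepCoords
  have e2 : ∀ a b c : ℝ, (a - η * b) - (a - η * c) = -(η * (b - c)) := fun a b c => by ring
  have e3 := hsum
  change ∑ i, (spareRes ρ ρ' ς ς' sq B D θ i (Sum.inl 2) * labelCoef θ p
      + spareRes ρ ρ' ς ς' sq B D θ i (Sum.inl 3) * domainCoef lam θ p)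
        * spareRes ρ ρ' ς ς' sq B D θ i (actRow p) - _ = _ at e3
  rw [e2, e3, abs_neg, abs_mul, mul_assoc]
  refine mul_le_mul_of_nonneg_left ?_ (abs_nonneg η)
  refine (abs_add_le _ _).trans ?_
  have f1 := (Finset.abs_sum_le_sum_abs _ _).trans (Finset.sum_le_sum fun i (_ : i ∈ Finset.univ) =>
    hT i)
  have f2 := (Finset.abs_sum_le_sum_abs _ _).trans (Finset.sum_le_sum fun i (_ : i ∈ Finset.univ) =>
    hT' i)
  rw [Finset.sum_const, Finset.card_univ, Fintype.card_fin, nsmul_eq_mul] at f1 f2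
  linarith

end

end Accuracy


/-! ### Composition of the layers -/

section Composition

/-- With x = 1/ε, this places a width of order 1/ε within the budget 1 + ε⁻². -/
lemma le_one_add_sq (x : ℝ) : x ≤ 1 + x ^ 2 := by nlinarith [sq_nonneg (x - 1)]

lemma runTF_succ {ι κ : Type} [Fintype ι] [DecidableEq ι] [Fintype κ] (T : ℕ → TFLayer ι)
    (m : ℕ) (X : Matrix ι κ ℝ) :
    runTF (fun l : Fin (m + 1) => T l) X = (T m).apply (runTF (fun l : Fin m => T l) X) := by
  unfold runTF
  rw [Fin.foldl_succ_last]
  rfl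

/-- The map `f` embeds parameters as token matrices; each pair of layers preserves its image and
acts there as `step`, so the pairs iterate `step`. -/
lemma runTF_pairs {ι κ α : Type} [Fintype ι] [DecidableEq ι] [Fintype κ] {T : ℕ → TFLayer ι}
    {L : ℕ} {f : α → Matrix ι κ ℝ} {step : α → α}
    (h : ∀ l < L, ∀ a, (T (2 * l + 1)).apply ((T (2 * l)).apply (f a)) = f (step a)) (a : α) :
    ∀ l ≤ L, runTF (fun i : Fin (2 * l) => T i) (f a) = f (step^[l] a) := by
  intro l
  induction l with
  | zero => intro _; simp [runTF]
  | succ l ih =>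
    intro hl
    have e := runTF_succ T (2 * l + 1) (f a)
    rw [runTF_succ T (2 * l) (f a), ih (by omega), h l hl] at e
    rw [Function.iterate_succ_apply']
    exact e

/-- Perturbed iterates of a Lipschitz map stay close to its iterates. -/
lemma norm_iterate_sub_iterate_le {E : Type} [NormedAddCommGroup E] {S : Set E} {f g : E → E}
    {a Λ : ℝ} (ha : 0 ≤ a) (hΛ : 1 ≤ Λ) (hf : ∀ x ∈ S, f x ∈ S) (hg : ∀ x ∈ S, g x ∈ S)
    (hfg : ∀ x ∈ S, ‖f x - g x‖ ≤ a) (hgg : ∀ x ∈ S, ∀ y ∈ S, ‖g x - g y‖ ≤ Λ * ‖x - y‖)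
    {x : E} (hx : x ∈ S) (l : ℕ) :
    f^[l] x ∈ S ∧ g^[l] x ∈ S ∧ ‖f^[l] x - g^[l] x‖ ≤ a * (l * Λ ^ l) := by
  induction l with
  | zero => simpa using hx
  | succ l ih =>
    obtain ⟨h1, h2, h3⟩ := ih
    rw [Function.iterate_succ_apply', Function.iterate_succ_apply']
    refine ⟨hf _ h1, hg _ h2, ?_⟩
    have h4 := norm_sub_le_norm_sub_add_norm_sub (f (f^[l] x)) (g (f^[l] x)) (g (g^[l] x))
    have h5 := hgg _ h1 _ h2
    have h6 := mul_le_mul_of_nonneg_left h3 (zero_le_one.trans hΛ)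
    -- The new error `a` is enlarged to a·Λ^(l+1), so that it adds to the l such terms already
    -- present.
    have h7 : 1 ≤ Λ ^ (l + 1) := one_le_pow₀ hΛ
    have h8 : Λ * (a * (l * Λ ^ l)) = a * (l * Λ ^ (l + 1)) := by ring
    have h9 : a * 1 ≤ a * Λ ^ (l + 1) := mul_le_mul_of_nonneg_left h7 ha
    push_cast
    linarith [hfg _ h1]

variable {d K n n' M : ℕ}

/-- The layers of the transformer. -/
def layers (ρ ρ' ς ς' sq : ReluNet M) (n n' : ℕ) (B lam η : ℝ) (P : ParamBlock d K) (L j : ℕ) :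
    TFLayer (Row d K (spareCard d K)) :=
  if j = 2 * L then readoutLayer ρ
  else if Even j then firstLayer ρ ρ' ς ς' sq n n' B else secondLayer n n' lam η P

/-- The perturbed update that two layers perform. -/
def tfStep (ρ ρ' ς ς' sq : ReluNet M) (B lam η : ℝ) (P : ParamBlock d K) (D : Input d n n')
    (θ : Params d K) : Params d K :=
  P.map (ofCoords (stepCoords lam η θ (spareRes ρ ρ' ς ς' sq B D θ)))

lemma layers_pair_apply (ρ ρ' ς ς' sq : ReluNet M) (B lam η : ℝ) (P : ParamBlock d K) {L l : ℕ}
    (hl : l < L) (D : Input d n n') (θ : Params d K) :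
    (layers ρ ρ' ς ς' sq n n' B lam η P L (2 * l + 1)).apply
      ((layers ρ ρ' ς ς' sq n n' B lam η P L (2 * l)).apply (tokens (spareCard d K) D θ))
      = tokens (spareCard d K) D (tfStep ρ ρ' ς ς' sq B lam η P D θ) := by
  have h1 : layers ρ ρ' ς ς' sq n n' B lam η P L (2 * l) = firstLayer ρ ρ' ς ς' sq n n' B := by
    unfold layers
    rw [if_neg (by omega), if_pos (even_two_mul l)]
  have h2 : layers ρ ρ' ς ς' sq n n' B lam η P L (2 * l + 1) = secondLayer n n' lam η P := by
    unfold layers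
    rw [if_neg (by omega), if_neg (by simp)]
  rw [h1, h2, tokens_eq_state, firstLayer_apply, secondLayer_apply]
  rfl

/-- A bound for the number of heads and hidden units per unit of the nets. -/
def sizeConst (d K : ℕ) : ℝ :=
  5 + 4 * K + 2 * K * d + 2 * Fintype.card (ParamIdx d K) + 2 * spareCard d K

lemma layers_size (N : ℕ) (ρ ρ' ς ς' sq : ReluNet (N + 3)) (B lam η : ℝ) (P : ParamBlock d K)
    (L j : ℕ) :
    ((layers ρ ρ' ς ς' sq n n' B lam η P L j).heads : ℝ) ≤ sizeConst d K * (N + 3) ∧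
    ((layers ρ ρ' ς ς' sq n n' B lam η P L j).hidden : ℝ)
      ≤ sizeConst d K * (N + 3) + P.width := by
  have hN : (0 : ℝ) ≤ N := Nat.cast_nonneg _
  have hK : (0 : ℝ) ≤ K := Nat.cast_nonneg _
  have hw : (0 : ℝ) ≤ P.width := Nat.cast_nonneg _
  have hp : (0 : ℝ) ≤ Fintype.card (ParamIdx d K) := Nat.cast_nonneg _
  have hs : (0 : ℝ) ≤ spareCard d K := Nat.cast_nonneg _
  have hKd : (0 : ℝ) ≤ K * d := by positivity
  unfold layers sizeConst
  split_ifs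
  · have h1 : ((readoutLayer (d := d) (K := K) ρ).heads : ℝ) = K * (N + 3) := by
      change ((Fintype.card (Fin K × Fin (N + 3)) : ℕ) : ℝ) = _
      simp
    have h2 : ((readoutLayer (d := d) (K := K) ρ).hidden : ℝ) = 0 := by
      change ((Fintype.card (Fin 0) : ℕ) : ℝ) = _
      simp
    rw [h1, h2]
    constructor <;> nlinarith [mul_nonneg hK hN, mul_nonneg hKd hN, mul_nonneg hp hN, mul_nonneg hs hN]
  · have h1 : ((firstLayer (d := d) (K := K) ρ ρ' ς ς' sq n n' B).heads : ℝ)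
        = 4 * (K * (N + 3)) := by
      change ((Fintype.card (Fin 4 × Fin K × Fin (N + 3)) : ℕ) : ℝ) = _
      simp
    have h2 : ((firstLayer (d := d) (K := K) ρ ρ' ς ς' sq n n' B).hidden : ℝ)
        = 3 * (N + 3) + (2 + 2 * (K * d * (N + 3))) := by
      change ((Fintype.card (ResIdx d K (N + 3)) : ℕ) : ℝ) = _
      simp
    rw [h1, h2]
    constructor <;> nlinarith [mul_nonneg hK hN, mul_nonneg hKd hN, mul_nonneg hp hN, mul_nonneg hs hN]
  · have h1 : ((secondLayer n n' lam η P).heads : ℝ) = 2 * Fintype.card (ParamIdx d K) := by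
      change ((Fintype.card (Fin 2 × ParamIdx d K) : ℕ) : ℝ) = _
      rw [Fintype.card_prod]; simp
    have h2 : ((secondLayer n n' lam η P).hidden : ℝ) = P.width + 2 * spareCard d K := by
      change ((Fintype.card (Fin P.width ⊕ (Fin 2 × Spare d K)) : ℕ) : ℝ) = _
      rw [Fintype.card_sum, Fintype.card_prod]; simp
    rw [h1, h2]
    constructor <;> nlinarith [mul_nonneg hK hN, mul_nonneg hKd hN, mul_nonneg hp hN, mul_nonneg hs hN]

/-- A bound for the norm of the layers apart from the projection block. -/
def normConst (d K n n' : ℕ) (B C lam : ℝ) : ℝ :=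
  (C + d + 1 + 4 * (K * C) + (3 + 3 * B + C) * √(3 * C + 2 + K * d * C))
    + (2 + lam + 2 * √(2 * spareCard d K)
      + 2 * Fintype.card (ParamIdx d K) * Fintype.card (Col n n'))

lemma layers_norm_le {ρ ρ' ς ς' sq : ReluNet M} {B C lam η : ℝ} (hB : 0 ≤ B) (hC : 0 ≤ C)
    (hρ : ρ.Bounded C) (hρ' : ρ'.Bounded C) (hς : ς.Bounded C) (hς' : ς'.Bounded C)
    (hsq : sq.Bounded C) (hlam : 0 ≤ lam) (hη : 0 ≤ η) (P : ParamBlock d K) (L j : ℕ) :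
    (layers ρ ρ' ς ς' sq n n' B lam η P L j).norm
      ≤ normConst d K n n' B C lam * (1 + η) + P.norm := by
  have hP : 0 ≤ P.norm := add_nonneg (opNorm_nonneg _) (opNorm_nonneg _)
  set a : ℝ := C + d + 1 + 4 * (K * C) + (3 + 3 * B + C) * √(3 * C + 2 + K * d * C) with ha
  set b : ℝ := 2 + lam + 2 * √(2 * spareCard d K) with hb
  set k : ℝ := 2 * Fintype.card (ParamIdx d K) * Fintype.card (Col n n') with hk
  have e : normConst d K n n' B C lam = a + (b + k) := rfl
  have ha0 : 0 ≤ a := by positivity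
  have hb0 : 0 ≤ b := by positivity
  have hk0 : 0 ≤ k := by positivity
  have hbase : a + b + k * (1 + η) ≤ (a + (b + k)) * (1 + η) := by
    nlinarith [mul_nonneg ha0 hη, mul_nonneg hb0 hη]
  have hkη : 0 ≤ k * (1 + η) := by positivity
  rw [e]
  unfold layers
  split_ifs
  · have h := readoutLayer_norm_le (d := d) (K := K) hC hρ
    have h2 : 0 ≤ (3 + 3 * B + C) * √(3 * C + 2 + K * d * C) := by positivity
    have h3 : 0 ≤ (K : ℝ) * C := by positivity
    linarith
  · have h := firstLayer_norm_le (d := d) (K := K) (n := n) (n' := n') hB hC hρ hρ' hς hς' hsq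
    linarith
  · have h := secondLayer_norm_le (n := n) (n' := n') P hlam hη
    have h2 : 2 * (Fintype.card (ParamIdx d K) : ℝ) * (η * Fintype.card (Col n n')) = k * η := by
      rw [hk]; ring
    rw [h2] at h
    linarith

end Composition

end DANN

end

/-! ### The main theorem -/

set_option maxHeartbeats 400000 in
theorem mainTheorem3 (d K n n' : ℕ) (hn : 0 < n) (hn' : 0 < n')
    (Bx By Bu Bw Bv lam : ℝ) (hBx : 0 < Bx) (hBy : 0 < By)
    (hBu : 0 < Bu) (hBw : 0 < Bw) (hBv : 0 < Bv) (hlam : 0 < lam)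
    (r : ℝ → ℝ) (hr : ContDiff ℝ 4 r) :
    ∃ (F : ℕ) (A : ℝ), ∀ L : ℕ, 0 < L → ∀ η : ℝ, 0 < η →
      ∃ (C : ℝ) (q : ℕ) (c R : ℝ), 0 < c ∧ c ≤ 1 ∧ 0 < R ∧ ∀ ε : ℝ, 0 < ε →
        (∃ P : DANN.ParamBlock d K, P.Projects Bu Bw Bv (c * ε) R) ∧
        ∀ P : DANN.ParamBlock d K, P.Projects Bu Bw Bv (c * ε) R →
          ∃ T : Fin (2 * L + 1) → DANN.TFLayer (DANN.Row d K F),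
            -- size of the transformer
            (∀ l, ((T l).heads : ℝ) ≤ C * (1 + ε⁻¹ ^ 2) * (1 + Real.log (1 + ε⁻¹)) ^ q) ∧
            (∀ l, ((T l).hidden : ℝ)
              ≤ C * (1 + ε⁻¹ ^ 2) * (1 + Real.log (1 + ε⁻¹)) ^ q + P.width) ∧
            DANN.tfNorm T ≤ A * (1 + η) + P.norm ∧
            ∀ D : DANN.Input d n n', D.Bounded Bx By →
              -- each of the first `L` pairs of layers performs one perturbed update
              (∀ l : Fin L, ∀ θ ∈ DANN.paramSet Bu Bw Bv,
                ∃ e : DANN.Params d K, ‖e‖ ≤ ε ∧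
                  P.map (DANN.gradStep r D lam η θ + e) ∈ DANN.paramSet Bu Bw Bv ∧
                  ‖P.map (DANN.gradStep r D lam η θ + e)
                    - DANN.projW Bu Bw Bv (DANN.gradStep r D lam η θ + e)‖ ≤ ε ∧
                  (T ⟨2 * l + 1, by omega⟩).apply
                      ((T ⟨2 * l, by omega⟩).apply (DANN.tokens F D θ))
                    = DANN.tokens F D (P.map (DANN.gradStep r D lam η θ + e))) ∧
              -- output of the whole transformer, for every tuple of initial values
              ∀ θ₀ ∈ DANN.paramSet Bu Bw Bv,
                (∃ θ ∈ DANN.paramSet Bu Bw Bv,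
                  DANN.runTF (fun l : Fin (2 * L) => T l.castSucc) (DANN.tokens F D θ₀)
                    = DANN.tokens F D θ ∧
                  ∀ (p : DANN.ParamIdx d K) (i : DANN.Col n n'),
                    DANN.runTF T (DANN.tokens F D θ₀) (DANN.paramRow p) i
                      = DANN.toCoords θ p) ∧
                |DANN.runTF T (DANN.tokens F D θ₀) DANN.yRow DANN.queryCol
                    - DANN.dannClassifier Bu Bw Bv r D lam η θ₀ L D.xq| ≤ L * ε := by
  have hr1 : ContDiff ℝ 1 r := hr.of_le (by norm_num)
  have hr2 : ContDiff ℝ 2 r := hr.of_le (by norm_num)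
  have hrd : Differentiable ℝ r := hr1.differentiable (by norm_num)
  have hd3 : ContDiff ℝ 3 (deriv r) := ((contDiff_succ_iff_deriv (n := 3)).1 hr).2.2
  have hd2 : ContDiff ℝ 2 (deriv r) := hd3.of_le (by norm_num)
  have hd1 : ContDiff ℝ 1 (deriv r) := hd3.of_le (by norm_num)
  obtain ⟨m₁, hm₁⟩ := (isCompact_Icc (a := -(Bu * Bx)) (b := Bu * Bx)).exists_bound_of_continuousOn
    hr1.continuous.continuousOn
  obtain ⟨m₂, hm₂⟩ := (isCompact_Icc (a := -(Bu * Bx)) (b := Bu * Bx)).exists_bound_of_continuousOn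
    hd1.continuous.continuousOn
  obtain ⟨m, hm, hmr, hmr'⟩ : ∃ m : ℝ, 0 ≤ m ∧ (∀ s, |s| ≤ Bu * Bx → |r s| ≤ m) ∧
      ∀ s, |s| ≤ Bu * Bx → |deriv r s| ≤ m :=
    ⟨max 0 (max m₁ m₂), le_max_left _ _,
      fun s hs => (hm₁ s (abs_le.1 hs)).trans ((le_max_left _ _).trans (le_max_right _ _)),
      fun s hs => (hm₂ s (abs_le.1 hs)).trans ((le_max_right _ _).trans (le_max_right _ _))⟩
  obtain ⟨C, hC, hnets⟩ := DANN.exists_goodNets K hr2 hd2 hBx.le hBu.le hBw.le hBv.le hm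
  -- Mask size: the largest possible logit plus the largest bias.
  set B : ℝ := K * (Bw + Bv) * (m + 1) + C with hB
  have hB0 : 0 ≤ B := by positivity
  obtain ⟨Ln, hLn, hnet⟩ := DANN.exists_net_lipschitz (d := d) (K := K) (Bx := Bx)
    hBu.le hBw.le hBv.le hr1
  refine ⟨DANN.spareCard d K, DANN.normConst d K n n' B C lam, fun L hL η hη => ?_⟩
  obtain ⟨Cg, hCg, hgrad⟩ := DANN.exists_gradStep_bound (d := d) (K := K) (Bx := Bx) (By := By)
    hBu.le hBw.le hBv.le hr1 hd1 n n' lam η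
  set W : ℝ := (K * d + K) * 2 with hW
  have hW0 : 0 ≤ W := by positivity
  -- A Lipschitz constant of the exact projected update: `W` for the projection, `Cg` for the
  -- gradient step, and 1 added to make it at least one.
  set Λ : ℝ := W * Cg + 1 with hΛ
  have hΛ1 : 1 ≤ Λ := by rw [hΛ]; linarith [mul_nonneg hW0 hCg]
  set E₁ : ℝ := |η| * ((n + n') * DANN.termBound K Bx By Bw Bv m lam) with hE₁
  have hcoef : 0 ≤ DANN.coefBound Bw Bv lam := by unfold DANN.coefBound; positivity
  have hE₁0 : 0 ≤ E₁ := by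
    rw [hE₁]; unfold DANN.termBound; positivity
  set E : ℝ := (K * d + K) * E₁ with hE
  have hE0 : 0 ≤ E := by positivity
  -- Amplification of an error per update into the output: 1 for the readout net itself, and `Ln`
  -- times the deviation of the parameters after L updates.
  set Z : ℝ := 1 + Ln * ((1 + W) * (L * Λ ^ L)) with hZ
  have hZ1 : 1 ≤ Z := by
    have : 0 ≤ Λ := zero_le_one.trans hΛ1
    rw [hZ]
    have : 0 ≤ Ln * ((1 + W) * (L * Λ ^ L)) := by positivity
    linarith
  have hZ0 : 0 < Z := zero_lt_one.trans_le hZ1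
  set S : ℝ := DANN.sizeConst d K with hS
  have hS0 : 0 ≤ S := by rw [hS]; unfold DANN.sizeConst; positivity
  set H : ℝ := C * (E + K * Bw) * Z with hH
  have hH0 : 0 ≤ H := by positivity
  -- The block accuracy is divided by the amplification. The range covers every perturbed gradient
  -- step, as `Cg` bounds the step and `E` its perturbation.
  refine ⟨S * (C + 5 + H), 0, Z⁻¹, Cg + E + 1, by positivity, inv_le_one_of_one_le₀ hZ1,
    by positivity, fun ε hε => ?_⟩
  have hcε : 0 < Z⁻¹ * ε := by positivity
  have hcε1 : Z⁻¹ * ε ≤ ε := mul_le_of_le_one_left hε.le (inv_le_one_of_one_le₀ hZ1)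
  refine ⟨DANN.exists_projects hBu hBw hBv hcε _, fun P hP => ?_⟩
  -- N is at least C, so that δ = C/N ≤ 1, and large enough that gradient error Eδ and readout error
  -- K·Bw·δ together stay below ε/Z.
  obtain ⟨N, hN0, hNC, hNE, hNle⟩ : ∃ N : ℕ, 0 < N ∧ C ≤ N ∧
      C * (E + K * Bw) ≤ N * (Z⁻¹ * ε) ∧ (N : ℝ) ≤ C + H * ε⁻¹ + 2 := by
    have h0 : 0 ≤ C + H * ε⁻¹ := by positivity
    have h1 := Nat.le_ceil (C + H * ε⁻¹)
    have h2 := (Nat.ceil_lt_add_one h0).le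
    have h3 : 0 ≤ H * ε⁻¹ := by positivity
    refine ⟨⌈C + H * ε⁻¹⌉₊ + 1, Nat.succ_pos _, ?_, ?_, ?_⟩
    · push_cast; linarith
    · have h4 : H * ε⁻¹ ≤ ((⌈C + H * ε⁻¹⌉₊ + 1 : ℕ) : ℝ) := by push_cast; linarith
      have h5 := mul_le_mul_of_nonneg_right h4 hcε.le
      have h6 : H * ε⁻¹ * (Z⁻¹ * ε) = C * (E + K * Bw) := by
        rw [hH]; field_simp
      linarith
    · push_cast; linarith
  have hNpos : (0 : ℝ) < N := by exact_mod_cast hN0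
  obtain ⟨ρ, ρ', ς, ς', sq, hg⟩ := hnets N hN0
  set δ : ℝ := C / N with hδ
  have hδ0 : 0 ≤ δ := by positivity
  have hδ1 : δ ≤ 1 := (div_le_one hNpos).2 hNC
  have hδε : (E + K * Bw) * δ ≤ Z⁻¹ * ε := by
    rw [hδ, mul_div_assoc', div_le_iff₀ hNpos]
    linarith
  have hKB : 0 ≤ (K : ℝ) * Bw * δ := by positivity
  have hEδ0 : 0 ≤ E * δ := by positivity
  have hEδ : E * δ ≤ Z⁻¹ * ε := by rw [add_mul] at hδε; linarith
  have hKδ : K * Bw * δ ≤ Z⁻¹ * ε := by rw [add_mul] at hδε; linarith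
  have hsize : S * (N + 3) ≤ S * (C + 5 + H) * (1 + ε⁻¹ ^ 2) * (1 + Real.log (1 + ε⁻¹)) ^ 0 := by
    rw [pow_zero, mul_one, mul_assoc]
    refine mul_le_mul_of_nonneg_left ?_ hS0
    have h1 : ε⁻¹ ≤ 1 + ε⁻¹ ^ 2 := DANN.le_one_add_sq ε⁻¹
    have h2 := mul_le_mul_of_nonneg_left h1 hH0
    have h3 := mul_nonneg hC (sq_nonneg ε⁻¹)
    have h4 := sq_nonneg ε⁻¹
    linarith
  refine ⟨fun l => DANN.layers ρ ρ' ς ς' sq n n' B lam η P L l, fun l => ?_, fun l => ?_, ?_,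
    fun D hD => ?_⟩
  · exact (DANN.layers_size N ρ ρ' ς ς' sq B lam η P L l).1.trans hsize
  · exact (DANN.layers_size N ρ ρ' ς ς' sq B lam η P L l).2.trans (by linarith)
  · exact ciSup_le fun l => DANN.layers_norm_le hB0 hC hg.bρ hg.bρ' hg.bς hg.bς' hg.bsq hlam.le
      hη.le P L l
  set step := DANN.tfStep ρ ρ' ς ς' sq B lam η P D with hstep
  have herr : ∀ θ ∈ DANN.paramSet Bu Bw Bv, ∃ e : DANN.Params d K, ‖e‖ ≤ E * δ ∧
      step θ = P.map (DANN.gradStep r D lam η θ + e) ∧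
      P.map (DANN.gradStep r D lam η θ + e) ∈ DANN.paramSet Bu Bw Bv ∧
      ‖P.map (DANN.gradStep r D lam η θ + e)
        - DANN.projW Bu Bw Bv (DANN.gradStep r D lam η θ + e)‖ ≤ Z⁻¹ * ε := by
    intro θ hθ
    -- The parameters just before the projection block; the perturbation is their difference from
    -- the exact gradient step.
    set x := DANN.ofCoords (DANN.stepCoords lam η θ (DANN.spareRes ρ ρ' ς ς' sq B D θ)) with hx
    have he : ‖x - DANN.gradStep r D lam η θ‖ ≤ E * δ := by
      rw [hE, mul_assoc]
      refine DANN.params_norm_le (by positivity) fun p => ?_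
      rw [DANN.toCoords_sub, Pi.sub_apply, hx, DANN.toCoords_ofCoords]
      exact DANN.abs_stepCoords_sub_le hg hδ0 hδ1 hBx.le hBu.le hBw.le hBv.le hm hmr hmr' hθ hrd
        hlam.le hBy.le η hD p
    refine ⟨x - DANN.gradStep r D lam η θ, he, ?_⟩
    rw [add_sub_cancel]
    refine ⟨rfl, hP x ?_⟩
    have h1 := (hgrad D hD θ hθ).1
    have h2 := norm_add_le (DANN.gradStep r D lam η θ) (x - DANN.gradStep r D lam η θ)
    rw [add_sub_cancel] at h2
    have h3 : E * δ ≤ E := mul_le_of_le_one_right hE0 hδ1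
    linarith
  have hlayers : ∀ l < L, ∀ θ : DANN.Params d K,
      (DANN.layers ρ ρ' ς ς' sq n n' B lam η P L (2 * l + 1)).apply
        ((DANN.layers ρ ρ' ς ς' sq n n' B lam η P L (2 * l)).apply
          (DANN.tokens (DANN.spareCard d K) D θ))
        = DANN.tokens (DANN.spareCard d K) D (step θ) := fun l hl θ =>
    DANN.layers_pair_apply ρ ρ' ς ς' sq B lam η P hl D θ
  refine ⟨fun l θ hθ => ?_, fun θ₀ hθ₀ => ?_⟩
  · obtain ⟨e, he, hs, hmem, hdist⟩ := herr θ hθ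
    exact ⟨e, he.trans (hEδ.trans hcε1), hmem, hdist.trans hcε1, (hlayers l l.2 θ).trans (by rw [hs])⟩
  have hrun := DANN.runTF_pairs hlayers θ₀ L le_rfl
  have hout : DANN.runTF (fun l : Fin (2 * L + 1) => DANN.layers ρ ρ' ς ς' sq n n' B lam η P L l)
      (DANN.tokens (DANN.spareCard d K) D θ₀)
      = (DANN.readoutLayer ρ).apply (DANN.tokens (DANN.spareCard d K) D (step^[L] θ₀)) := by
    rw [DANN.runTF_succ, hrun]
    congr 1
    -- The test for the readout comes first in `layers`, so the even index 2L is not taken for a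
    -- first update layer.
    exact if_pos rfl
  set f := fun θ => DANN.projW Bu Bw Bv (DANN.gradStep r D lam η θ) with hf
  have hWnorm : ∀ x y : DANN.Params d K,
      ‖DANN.projW Bu Bw Bv x - DANN.projW Bu Bw Bv y‖ ≤ W * ‖x - y‖ := fun x y =>
    (DANN.norm_projW_sub_le hBu hBw hBv x y).trans_eq (by rw [hW]; ring)
  -- One update deviates by at most ε/Z from the block and W·ε/Z from the gradient error passed
  -- through the projection.
  obtain ⟨hmem, hmem', hclose⟩ := DANN.norm_iterate_sub_iterate_le (f := step) (g := f)
    (a := (1 + W) * (Z⁻¹ * ε)) (Λ := Λ) (by positivity) hΛ1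
    (fun θ hθ => by
      obtain ⟨e, _, hs, hmem, _⟩ := herr θ hθ
      rw [hs]; exact hmem)
    (fun θ _ => DANN.projW_mem hBu.le hBw.le hBv.le _)
    (fun θ hθ => by
      obtain ⟨e, he, hs, -, hdist⟩ := herr θ hθ
      have h1 := hWnorm (DANN.gradStep r D lam η θ + e) (DANN.gradStep r D lam η θ)
      rw [add_sub_cancel_left] at h1
      have h2 := norm_sub_le_norm_sub_add_norm_sub (step θ)
        (DANN.projW Bu Bw Bv (DANN.gradStep r D lam η θ + e)) (f θ)
      rw [← hs] at hdist
      have h3 := mul_le_mul_of_nonneg_left (he.trans hEδ) hW0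
      linarith)
    (fun θ hθ θ' hθ' => by
      have h1 := hWnorm (DANN.gradStep r D lam η θ) (DANN.gradStep r D lam η θ')
      have h2 := mul_le_mul_of_nonneg_left ((hgrad D hD θ hθ).2 θ' hθ') hW0
      rw [hΛ, add_mul, one_mul, mul_assoc]
      exact (h1.trans h2).trans (by linarith [norm_nonneg (θ - θ')]))
    hθ₀ L
  refine ⟨⟨step^[L] θ₀, hmem, hrun, fun p i => ?_⟩, ?_⟩
  · rw [hout, DANN.readoutLayer_apply, if_neg fun h => DANN.paramRow_ne_inl p _ h.symm, add_zero]
    rfl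
  · rw [hout, DANN.readoutLayer_apply, if_pos rfl]
    have hy : DANN.tokens (DANN.spareCard d K) D (step^[L] θ₀) DANN.yRow DANN.queryCol = 0 := rfl
    rw [hy, zero_add]
    have h1 := DANN.abs_netHat_sub_le hg hBu.le hmem hD.2.2.2 hmem.2.1
    have h2 := hnet D.xq hD.2.2.2 _ hmem _ hmem'
    have h3 := abs_sub_le (DANN.netHat ρ (step^[L] θ₀) (step^[L] θ₀).2.1 D.xq)
      (DANN.net r (step^[L] θ₀).1 (step^[L] θ₀).2.1 D.xq)
      (DANN.dannClassifier Bu Bw Bv r D lam η θ₀ L D.xq)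
    have h4 := mul_le_mul_of_nonneg_left hclose hLn
    -- By the choice of `Z`, readout and parameter errors add up to exactly ε, which is at most Lε
    -- since L ≥ 1.
    have h5 : Z⁻¹ * ε + Ln * ((1 + W) * (Z⁻¹ * ε) * (L * Λ ^ L)) = ε := by
      have : Z⁻¹ * ε + Ln * ((1 + W) * (Z⁻¹ * ε) * (L * Λ ^ L)) = Z⁻¹ * ε * Z := by rw [hZ]; ring
      rw [this]; field_simp
    have h6 : ε ≤ L * ε := le_mul_of_one_le_left hε.le (by exact_mod_cast hL)
    exact h3.trans ((add_le_add h1 (h2.trans h4)).trans (by linarith))
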